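/- Conventions. Let $S\subset\mathbb R^3$ be a smooth immersed oriented surface with unit normal $n$ and let $p\in S$ be a non-umbilic point, with principal curvatures $k_1>k_2$ near $p$. Let $X_1,X_2$ be unit vectors of $T_pS$ tangent to the lines of curvature of $k_1$ and $k_2$, put $\mu=(k_1-k_2)/2$, and let $\theta_i=X_i(k_i)/\mu^2$ $(i=1,2)$ be the conformal principal curvatures at $p$. The point $p$ is a *Dupin point* if $\theta_1=\theta_2=0$, and a *canal point* if $\theta_1\theta_2=0$. A *Dupin cyclide* is the image in $\mathbb R^3$, under a Möbius transformation of $\mathbb R^3\cup\{\infty\}$, of a ring torus, a circular cylinder or a circular double cone of revolution (singular points removed). A Möbius transformation $g$ brings a surface to *standard position* at $p$ if $g(p)=0$, $dg_p(n)$ is a positive multiple of $\partial_z$, and the image is, near $0$, a graph $$z=\tfrac12(x^2-y^2)+\tfrac16(t_1x^3+t_2y^3)+\tfrac1{24}(ax^4+4bx^3y+6\Psi x^2y^2+4cxy^3+dy^4)+O(5)$$ for some real coefficients. The number $\Psi$ is then a conformal invariant of the oriented surface at $p$; for a cyclide $C$ it is denoted $\Psi_C$. We say that a cyclide $C$ is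 *tangent to $S$ at $p$ to order $k$ in the direction* $\cos\alpha\,X_1+\sin\alpha\,X_2$ if a single Möbius transformation $g$ brings both $S$ and $C$ to standard position at $p$, with $dg_p(X_1),dg_p(X_2),dg_p(n)$ a common positive multiple of $\partial_x,\partial_y,\partial_z$, and if the equations $z=f_S(x,y)$ and $z=f_C(x,y)$ of their images satisfy $f_S(s\cos\alpha,s\sin\alpha)-f_C(s\cos\alpha,s\sin\alpha)=O(s^{k+1})$ as $s\to0$. **Theorem.** Suppose that $p$ is non-umbilic and not a Dupin point, and let $\alpha$ be such that $\tan\alpha=-\sqrt[3]{\theta_1/\theta_2}$ (that is, $\cos\alpha=0$ if $\theta_2=0$), so that this direction makes with the lines of curvature angles whose tangents are $|\theta_1/\theta_2|^{1/3}$ and its inverse. Then the Dupin cyclides that are tangent to $S$ at $p$ to order $3$ in the direction $\cos\alpha\,X_1+\sin\alpha\,X_2$ form a one-parameter family $(C_\Psi)_{\Psi\in\mathbb R}$, indexed bijectively by their invariant $\Psi_{C}=\Psi$ at $p$ ($C_\Psi$ being oriented at $p$ by $n$), which takes every real value. If moreover $p$ is not a canal point ($\theta_1\ne0$ and $\theta_2\ne0$),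 then there is exactly one Dupin cyclide, the osculating cyclide of $S$ at $p$, that is tangent to $S$ at $p$ to order $4$ in this direction; it belongs to the family. -/

import Mathlib

open Set Filter Topology Asymptotics
open scoped ContDiff

noncomputable section

/-- Euclidean 3-space. -/
abbrev E3 : Type := EuclideanSpace ℝ (Fin 3)

/-! ## Immersed surfaces, principal curvatures, conformal principal curvatures -/

/-- A smooth immersed (parametrized) surface `φ : U → ℝ³`, oriented by its parameters. -/
def IsImmersedSurface (U : Set (ℝ × ℝ)) (φ : ℝ × ℝ → E3) : Prop :=
  IsOpen U ∧ ContDiffOn ℝ ∞ φ U ∧ ∀ u ∈ U, Function.Injective (fderiv ℝ φ u)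

/-- The cross product of `ℝ³`. -/
def cross3 (a b : E3) : E3 := WithLp.toLp 2 (crossProduct (WithLp.ofLp a) (WithLp.ofLp b))

/-- The unit normal `φ_u × φ_v / |φ_u × φ_v|`. -/
def unitNormal (φ : ℝ × ℝ → E3) (u : ℝ × ℝ) : E3 :=
  ‖cross3 (fderiv ℝ φ u (1, 0)) (fderiv ℝ φ u (0, 1))‖⁻¹ •
    cross3 (fderiv ℝ φ u (1, 0)) (fderiv ℝ φ u (0, 1))

/-- The first fundamental form, as a form on the parameter plane. -/
def firstForm (φ : ℝ × ℝ → E3) (u v w : ℝ × ℝ) : ℝ :=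
  inner ℝ (fderiv ℝ φ u v) (fderiv ℝ φ u w)

/-- The second fundamental form with respect to `unitNormal`, as a form on the parameter plane. -/
def secondForm (φ : ℝ × ℝ → E3) (u v w : ℝ × ℝ) : ℝ :=
  inner ℝ (fderiv ℝ (fun x => fderiv ℝ φ x v) u w) (unitNormal φ u)

/-- The determinant `EG - F²` of the first fundamental form. -/
def firstDet (φ : ℝ × ℝ → E3) (u : ℝ × ℝ) : ℝ :=
  firstForm φ u (1, 0) (1, 0) * firstForm φ u (0, 1) (0, 1) - firstForm φ u (1, 0) (0, 1) ^ 2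

/-- The mean curvature `H = (k₁ + k₂) / 2`. -/
def meanCurv (φ : ℝ × ℝ → E3) (u : ℝ × ℝ) : ℝ :=
  (firstForm φ u (1, 0) (1, 0) * secondForm φ u (0, 1) (0, 1)
    - 2 * firstForm φ u (1, 0) (0, 1) * secondForm φ u (1, 0) (0, 1)
    + firstForm φ u (0, 1) (0, 1) * secondForm φ u (1, 0) (1, 0)) / (2 * firstDet φ u)

/-- The Gauss curvature `K = k₁ k₂`. -/
def gaussCurv (φ : ℝ × ℝ → E3) (u : ℝ × ℝ) : ℝ :=
  (secondForm φ u (1, 0) (1, 0) * secondForm φ u (0, 1) (0, 1)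
    - secondForm φ u (1, 0) (0, 1) ^ 2) / firstDet φ u

/-- The larger principal curvature `k₁`. -/
def princCurv₁ (φ : ℝ × ℝ → E3) (u : ℝ × ℝ) : ℝ :=
  meanCurv φ u + √(meanCurv φ u ^ 2 - gaussCurv φ u)

/-- The smaller principal curvature `k₂`. -/
def princCurv₂ (φ : ℝ × ℝ → E3) (u : ℝ × ℝ) : ℝ :=
  meanCurv φ u - √(meanCurv φ u ^ 2 - gaussCurv φ u)

/-- The point with parameter `p` is umbilic. -/
def IsUmbilic (φ : ℝ × ℝ → E3) (p : ℝ × ℝ) : Prop := princCurv₁ φ p = princCurv₂ φ p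

/-- `X₁ = dφ_p w₁` and `X₂ = dφ_p w₂` are unit vectors tangent to the lines of curvature of
`k₁` and of `k₂`, respectively. -/
def IsPrincipalFrame (φ : ℝ × ℝ → E3) (p w₁ w₂ : ℝ × ℝ) : Prop :=
  firstForm φ p w₁ w₁ = 1 ∧ firstForm φ p w₂ w₂ = 1 ∧
  (∀ v, secondForm φ p w₁ v = princCurv₁ φ p * firstForm φ p w₁ v) ∧
  (∀ v, secondForm φ p w₂ v = princCurv₂ φ p * firstForm φ p w₂ v)

/-- `μ = (k₁ - k₂) / 2`. -/
def halfDiff (φ : ℝ × ℝ → E3) (p : ℝ × ℝ) : ℝ := (princCurv₁ φ p - princCurv₂ φ p) / 2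

/-- The conformal principal curvature `θ₁ = X₁(k₁) / μ²`, where `X₁ = dφ_p w₁`. -/
def theta₁ (φ : ℝ × ℝ → E3) (p w₁ : ℝ × ℝ) : ℝ :=
  fderiv ℝ (princCurv₁ φ) p w₁ / halfDiff φ p ^ 2

/-- The conformal principal curvature `θ₂ = X₂(k₂) / μ²`, where `X₂ = dφ_p w₂`. -/
def theta₂ (φ : ℝ × ℝ → E3) (p w₂ : ℝ × ℝ) : ℝ :=
  fderiv ℝ (princCurv₂ φ) p w₂ / halfDiff φ p ^ 2

/-! ## Möbius transformations and Dupin cyclides -/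

/-- Möbius transformations of `ℝ³ ∪ {∞}`, orientation preserving or not: the similarities
(those fixing `∞`), and the inversions followed by an isometry (those sending some finite point
`c` to `∞`). -/
inductive Moebius : Type
  | sim (r : ℝ) (hr : 0 < r) (e : E3 ≃ᵃⁱ[ℝ] E3) : Moebius
  | inv (c : E3) (R : ℝ) (hR : 0 < R) (e : E3 ≃ᵃⁱ[ℝ] E3) : Moebius

/-- The finite points that are sent to finite points. -/
def Moebius.domain : Moebius → Set E3
  | .sim _ _ _ => univ
  | .inv c _ _ _ => {c}ᶜ

/-- The action on finite points (meaningful on `domain` only). -/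
def Moebius.toFun : Moebius → E3 → E3
  | .sim r _ e => fun x => r • e x
  | .inv c R _ e => fun x => e (EuclideanGeometry.inversion c R x)

/-- The image in `ℝ³` of a subset of `ℝ³`. -/
def Moebius.image (g : Moebius) (A : Set E3) : Set E3 := g.toFun '' (A ∩ g.domain)

/-- The ring torus of revolution with radii `0 < r < R`. -/
def torusSet (R r : ℝ) : Set E3 := {x | (√(x 0 ^ 2 + x 1 ^ 2) - R) ^ 2 + x 2 ^ 2 = r ^ 2}

/-- The circular cylinder of radius `r`. -/
def cylinderSet (r : ℝ) : Set E3 := {x | x 0 ^ 2 + x 1 ^ 2 = r ^ 2}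

/-- The circular (double) cone of slope parameter `m`, without its apex, which is not a
surface point. -/
def coneSet (m : ℝ) : Set E3 := {x | x 0 ^ 2 + x 1 ^ 2 = m ^ 2 * x 2 ^ 2 ∧ x ≠ 0}

/-- Dupin cyclides: Möbius images of tori, cylinders and cones of revolution, singular points
removed. (Horn tori and spindle tori are images of cylinders and of cones.) -/
def IsDupinCyclide (C : Set E3) : Prop :=
  ∃ g : Moebius,
    (∃ R r : ℝ, 0 < r ∧ r < R ∧ C = g.image (torusSet R r)) ∨
    (∃ r : ℝ, 0 < r ∧ C = g.image (cylinderSet r)) ∨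
    (∃ m : ℝ, 0 < m ∧ C = g.image (coneSet m))

/-! ## Standard position and order of tangency -/

/-- `f(x, y) = ½(x² - y²) + ⅙(t₁ x³ + t₂ y³)
  + (1/24)(a x⁴ + 4 b x³ y + 6 Ψ x² y² + 4 c x y³ + d y⁴) + O(5)` at the origin
for some coefficients `t₁, t₂, a, b, c, d`. -/
def HasStandardExpansion (f : ℝ × ℝ → ℝ) (Ψ : ℝ) : Prop :=
  ∃ t₁ t₂ a b c d : ℝ,
    (fun q : ℝ × ℝ => f q - ((q.1 ^ 2 - q.2 ^ 2) / 2 + (t₁ * q.1 ^ 3 + t₂ * q.2 ^ 3) / 6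
      + (a * q.1 ^ 4 + 4 * b * q.1 ^ 3 * q.2 + 6 * Ψ * q.1 ^ 2 * q.2 ^ 2
        + 4 * c * q.1 * q.2 ^ 3 + d * q.2 ^ 4) / 24))
      =O[𝓝 0] (fun q : ℝ × ℝ => ‖q‖ ^ 5)

/-- The standard basis vectors of `ℝ³`. -/
def stdVec (i : Fin 3) : E3 := EuclideanSpace.single i 1

/-- `g` carries the surface `φ`, at the point with parameter `p`, to the standard position: the
point goes to the origin, the frame `X₁ = dφ_p w₁`, `X₂ = dφ_p w₂`, normal, goes to a positive
multiple of the standard basis, and the image surface is near the origin the graph of `f`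
(which determines `f` near the origin), where `f` has a standard expansion. -/
def SurfaceInStandardPosition (g : Moebius) (φ : ℝ × ℝ → E3) (p w₁ w₂ : ℝ × ℝ)
    (f : ℝ × ℝ → ℝ) : Prop :=
  φ p ∈ g.domain ∧ g.toFun (φ p) = 0 ∧
  (∃ l : ℝ, 0 < l ∧ fderiv ℝ g.toFun (φ p) (fderiv ℝ φ p w₁) = l • stdVec 0 ∧
    fderiv ℝ g.toFun (φ p) (fderiv ℝ φ p w₂) = l • stdVec 1 ∧
    fderiv ℝ g.toFun (φ p) (unitNormal φ p) = l • stdVec 2) ∧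
  (∀ᶠ u in 𝓝 p, g.toFun (φ u) 2 = f (g.toFun (φ u) 0, g.toFun (φ u) 1)) ∧
  ∃ Ψ : ℝ, HasStandardExpansion f Ψ

/-- Near the origin, `A` is the graph of `f`. -/
def IsGraphNearOrigin (A : Set E3) (f : ℝ × ℝ → ℝ) : Prop :=
  ∀ᶠ x : E3 in 𝓝 0, x ∈ A ↔ x 2 = f (x 0, x 1)

/-- The conformal invariant `Ψ` of the surface `C ⊆ ℝ³` at its point `q`, for the orientation of
`C` near `q` given by the normal vector `n`, has the value `Ψ`. -/
def HasInvariantPsi (C : Set E3) (q n : E3) (Ψ : ℝ) : Prop :=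
  ∃ (g : Moebius) (f : ℝ × ℝ → ℝ), q ∈ g.domain ∧ g.toFun q = 0 ∧
    (∃ l : ℝ, 0 < l ∧ fderiv ℝ g.toFun q n = l • stdVec 2) ∧
    IsGraphNearOrigin (g.image C) f ∧ HasStandardExpansion f Ψ

/-- The surface `φ` and `C` are tangent of order (at least) `k` at the point with parameter `p`,
in the direction `cos α • X₁ + sin α • X₂`: one Möbius transformation brings both of them to
standard position, where their equations `z = fS (x, y)` and `z = fC (x, y)` agree to order `k`
along the line through the origin making the angle `α` with the `x`-axis. -/
def TangentOfOrder (k : ℕ) (φ : ℝ × ℝ → E3) (p w₁ w₂ : ℝ × ℝ) (α : ℝ) (C : Set E3) : Prop :=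
  ∃ (g : Moebius) (fS fC : ℝ × ℝ → ℝ),
    SurfaceInStandardPosition g φ p w₁ w₂ fS ∧
    IsGraphNearOrigin (g.image C) fC ∧ (∃ Ψ : ℝ, HasStandardExpansion fC Ψ) ∧
    (fun s : ℝ => fS (s * Real.cos α, s * Real.sin α) - fC (s * Real.cos α, s * Real.sin α))
      =O[𝓝 0] (fun s : ℝ => s ^ (k + 1))

/-- `tan α` is the real cube root of `-θ₁/θ₂`; when `θ₂ = 0` this means that `α` is a right angle
modulo `π`. -/
def IsDupinAngle (θ₁ θ₂ α : ℝ) : Prop :=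
  (θ₂ ≠ 0 ∧ Real.cos α ≠ 0 ∧ Real.tan α ^ 3 = -(θ₁ / θ₂)) ∨ (θ₂ = 0 ∧ Real.cos α = 0)

end

noncomputable section

/-! ## The Lorentz model of the conformal 3-sphere -/

/-! The argument takes place on the light cone of a Lorentz space of signature (4,1). A point `x`
becomes the isotropic vector `(1, x, ‖x‖²)`, and Möbius transformations become the linear maps that
multiply the form by a positive constant (`exists_lift_of_moebius`, `exists_moebius_of_conformal`).
A torus, a cylinder or a cone becomes the zero set on the cone of a quadratic form `⟨M v, v⟩`, where
`M` is self-adjoint with two distinct eigenvalues, each having an eigenspace of dimension at least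
two. Singular points are the isotropic eigenvectors. This description is invariant under conformal
conjugation, so it covers all Dupin cyclides (`IsDupinCyclide.exists_op`).

In standard position the cyclides are completely known. If the quadric of such an `M` contains a
graph with a standard expansion, the coefficients up to order four together with the two eigenplanes
force `M` to be, up to `M ↦ a M + b`, the operator `stdOp (-Ψ / 2)` (`IsDupinOp.exists_eq_stdOp`).
Conversely every `stdOp E` is conjugate to a torus, a cone or a cylinder according to its spectrum
(`stdOp_cyclide`), and near the origin its quadric is a graph with zero cubic part and quartic part
`(3x⁴ + 6Ψx²y² - 3y⁴) / 24`, where `Ψ = -2E` (`exists_graph_stdOp`). Hence standard cyclides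
correspond bijectively to real numbers `Ψ`.

On the surface side, a Möbius map with prescribed conformal frame at `p` has only its scale and a
vector free. These are determined by making the quadratic part `(x² - y²) / 2` and killing the mixed
cubic terms; the remaining cubic coefficients are then `θ₁` and `θ₂` (`exists_standard_position`).
The standard position is therefore unique, and the cyclides to be compared with the surface are
exactly the standard ones.

The difference of the two graphs along the direction `α` has cubic term proportional to `θ₁ cos³ α +
θ₂ sin³ α`, which vanishes by the choice of `α` for every `Ψ`. The quartic term is affine in `Ψ`
with leading coefficient a multiple of `cos² α sin² α`; at a non-canal point this is nonzero, so
exactly one `Ψ` gives contact of order four (`sub_along_line`). -/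

/-- The space `ℝ × E3 × ℝ` carrying the Lorentz form `lform`. -/
abbrev LV : Type := ℝ × E3 × ℝ

/-- The Lorentz form `⟨x, x'⟩ - (w ρ' + ρ w') / 2`. -/
def lform (v v' : LV) : ℝ := inner ℝ v.2.1 v'.2.1 - (v.1 * v'.2.2 + v.2.2 * v'.1) / 2

/-- The isotropic vector representing the point `x`. -/
def lift (x : E3) : LV := (1, x, ‖x‖ ^ 2)

/-- The isotropic vector representing the point at infinity. -/
def liftInf : LV := (0, 0, 1)

lemma lform_comm (v v' : LV) : lform v v' = lform v' v := by
  simp only [lform, real_inner_comm]; ring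

lemma lform_add_left (u v v' : LV) : lform (u + v) v' = lform u v' + lform v v' := by
  simp only [lform, Prod.fst_add, Prod.snd_add, inner_add_left]; ring

lemma lform_smul_left (a : ℝ) (v v' : LV) : lform (a • v) v' = a * lform v v' := by
  simp only [lform, Prod.smul_fst, Prod.smul_snd, real_inner_smul_left, smul_eq_mul]; ring

lemma lform_add_right (u v v' : LV) : lform u (v + v') = lform u v + lform u v' := by
  rw [lform_comm, lform_add_left, lform_comm v, lform_comm v']

lemma lform_smul_right (a : ℝ) (v v' : LV) : lform v (a • v') = a * lform v v' := by
  rw [lform_comm, lform_smul_left, lform_comm]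

/-- Products of lifts record Euclidean distances; this turns conformality of a linear map into a
metric statement. -/
lemma lform_lift_lift (x y : E3) : lform (lift x) (lift y) = -‖x - y‖ ^ 2 / 2 := by
  have := norm_sub_sq_real x y
  simp only [lform, lift]; rw [this]; ring

lemma lform_lift_self (x : E3) : lform (lift x) (lift x) = 0 := by simp [lform_lift_lift]

lemma lform_liftInf_right (v : LV) : lform v liftInf = -v.1 / 2 := by
  simp [lform, liftInf]; ring

lemma lform_liftInf_self : lform liftInf liftInf = 0 := by simp [lform, liftInf]

lemma liftInf_ne_zero : liftInf ≠ 0 := by simp [liftInf, Prod.ext_iff]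

lemma lift_ne_zero (x : E3) : lift x ≠ 0 := by simp [lift, Prod.ext_iff]

lemma eq_zero_of_lform_eq_zero {v : LV} (h : ∀ v', lform v v' = 0) : v = 0 := by
  have h1 := h (0, 0, 1)
  have h2 := h (1, 0, 0)
  have h3 := h (0, v.2.1, 0)
  simp [lform] at h1 h2 h3
  ext1
  · exact h1
  · ext1
    · exact h3
    · exact h2

/-- An isotropic vector with non-zero first coordinate represents a finite point. -/
lemma eq_smul_lift {v : LV} (h : lform v v = 0) (h1 : v.1 ≠ 0) :
    v = v.1 • lift (v.1⁻¹ • v.2.1) := by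
  have h2 : ‖v.2.1‖ ^ 2 = v.1 * v.2.2 := by
    simp only [lform, real_inner_self_eq_norm_sq] at h; linarith
  refine Prod.ext (by simp [lift]) (Prod.ext (by simp [lift, smul_smul, h1]) ?_)
  simp only [lift, Prod.smul_snd, smul_eq_mul, norm_smul, mul_pow, h2, norm_inv, Real.norm_eq_abs,
    inv_pow, sq_abs]
  field_simp

/-- An isotropic vector with vanishing first coordinate represents the point at infinity. -/
lemma eq_smul_liftInf {v : LV} (h : lform v v = 0) (h1 : v.1 = 0) : v = v.2.2 • liftInf := by
  have h2 : v.2.1 = 0 := by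
    simp only [lform, real_inner_self_eq_norm_sq, h1] at h
    simpa using h
  exact Prod.ext (by simp [liftInf, h1]) (Prod.ext (by simp [liftInf, h2]) (by simp [liftInf]))

lemma lift_injective {x y : E3} {a : ℝ} (h : lift x = a • lift y) : x = y := by
  have h1 : a = 1 := by
    have := congrArg Prod.fst h
    simp [lift] at this; exact this.symm
  rw [h1, one_smul] at h
  simpa [lift] using congrArg (fun v => v.2.1) h

/-! ### Conformal linear maps and Möbius transformations -/

/-- `T` multiplies the Lorentz form by `c`. -/
def IsConformal (c : ℝ) (T : LV →ₗ[ℝ] LV) : Prop :=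
  0 < c ∧ ∀ v v', lform (T v) (T v') = c * lform v v'

lemma IsConformal.injective {c : ℝ} {T : LV →ₗ[ℝ] LV} (h : IsConformal c T) :
    Function.Injective T := by
  rw [← LinearMap.ker_eq_bot, LinearMap.ker_eq_bot']
  intro v hv
  refine eq_zero_of_lform_eq_zero fun v' => ?_
  have := h.2 v v'
  rw [hv] at this
  have h0 : lform 0 (T v') = 0 := by simp [lform]
  rw [h0] at this
  rcases mul_eq_zero.1 this.symm with h1 | h1
  · exact absurd h1 h.1.ne'
  · exact h1

/-- A conformal linear map as a linear equivalence. -/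
def IsConformal.equiv {c : ℝ} {T : LV →ₗ[ℝ] LV} (h : IsConformal c T) : LV ≃ₗ[ℝ] LV :=
  LinearEquiv.ofInjectiveEndo T h.injective

lemma IsConformal.equiv_apply {c : ℝ} {T : LV →ₗ[ℝ] LV} (h : IsConformal c T) (v : LV) :
    h.equiv v = T v := rfl

lemma IsConformal.comp {c c' : ℝ} {T T' : LV →ₗ[ℝ] LV} (h : IsConformal c T)
    (h' : IsConformal c' T') : IsConformal (c * c') (T ∘ₗ T') :=
  ⟨mul_pos h.1 h'.1, fun v v' => by simp only [LinearMap.comp_apply, h.2, h'.2]; ring⟩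

lemma IsConformal.symm {c : ℝ} {T : LV ≃ₗ[ℝ] LV} (h : IsConformal c (T : LV →ₗ[ℝ] LV)) :
    IsConformal c⁻¹ (T.symm : LV →ₗ[ℝ] LV) := by
  refine ⟨inv_pos.2 h.1, fun v v' => ?_⟩
  have := h.2 (T.symm v) (T.symm v')
  simp only [LinearEquiv.coe_coe, LinearEquiv.apply_symm_apply] at this ⊢
  rw [this]; field_simp [h.1.ne']

/-- The lift of a Euclidean isometry. -/
def isoLift (e : E3 ≃ᵃⁱ[ℝ] E3) : LV →ₗ[ℝ] LV where
  toFun v := (v.1, e.linearIsometryEquiv v.2.1 + v.1 • e 0,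
    v.2.2 + 2 * inner ℝ (e.linearIsometryEquiv v.2.1) (e 0) + v.1 * ‖e 0‖ ^ 2)
  map_add' u v := by
    refine Prod.ext rfl (Prod.ext ?_ ?_)
    · simp only [Prod.fst_add, Prod.snd_add, map_add, add_smul]; abel
    · simp only [Prod.fst_add, Prod.snd_add, map_add, inner_add_left]; ring
  map_smul' a v := by
    refine Prod.ext rfl (Prod.ext ?_ ?_)
    · simp only [Prod.smul_fst, Prod.smul_snd, map_smul, smul_add, smul_smul, smul_eq_mul,
        RingHom.id_apply]
    · simp only [Prod.smul_fst, Prod.smul_snd, map_smul, real_inner_smul_left, smul_eq_mul,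
        RingHom.id_apply]; ring

lemma affineIsometry_apply (e : E3 ≃ᵃⁱ[ℝ] E3) (x : E3) : e x = e.linearIsometryEquiv x + e 0 := by
  have := e.map_vadd 0 x
  simpa using this

lemma isoLift_lift (e : E3 ≃ᵃⁱ[ℝ] E3) (x : E3) : isoLift e (lift x) = lift (e x) := by
  refine Prod.ext rfl (Prod.ext ?_ ?_)
  · simp [isoLift, lift, affineIsometry_apply e x]
  · simp only [isoLift, lift, LinearMap.coe_mk, AddHom.coe_mk]
    rw [affineIsometry_apply e x, norm_add_sq_real]
    simp

lemma isoLift_conformal (e : E3 ≃ᵃⁱ[ℝ] E3) : IsConformal 1 (isoLift e) := by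
  refine ⟨one_pos, fun v v' => ?_⟩
  simp only [lform, isoLift, LinearMap.coe_mk, AddHom.coe_mk, inner_add_left, inner_add_right,
    real_inner_smul_left, real_inner_smul_right, LinearIsometryEquiv.inner_map_map,
    real_inner_self_eq_norm_sq]
  rw [real_inner_comm (e.linearIsometryEquiv v'.2.1) (e 0)]
  ring

/-- The lift of a homothety. -/
def homothetyLift (r : ℝ) : LV →ₗ[ℝ] LV where
  toFun v := (v.1, r • v.2.1, r ^ 2 * v.2.2)
  map_add' u v := Prod.ext rfl (Prod.ext (by simp) (by simp [mul_add]))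
  map_smul' a v := Prod.ext rfl (Prod.ext (by simp [smul_smul, mul_comm]) (by simp; ring))

lemma homothetyLift_lift (r : ℝ) (x : E3) : homothetyLift r (lift x) = lift (r • x) :=
  Prod.ext rfl (Prod.ext rfl (by simp [homothetyLift, lift, norm_smul, mul_pow]))

lemma homothetyLift_conformal {r : ℝ} (hr : 0 < r) : IsConformal (r ^ 2) (homothetyLift r) := by
  refine ⟨by positivity, fun v v' => ?_⟩
  simp only [lform, homothetyLift, LinearMap.coe_mk, AddHom.coe_mk,
    real_inner_smul_left, real_inner_smul_right]
  ring

/-- The lift of an inversion. -/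
def inversionLift (c : E3) (R : ℝ) : LV →ₗ[ℝ] LV where
  toFun v := (v.2.2 - 2 * inner ℝ v.2.1 c + v.1 * ‖c‖ ^ 2,
    (v.2.2 - 2 * inner ℝ v.2.1 c + v.1 * ‖c‖ ^ 2) • c + R ^ 2 • (v.2.1 - v.1 • c),
    (v.2.2 - 2 * inner ℝ v.2.1 c + v.1 * ‖c‖ ^ 2) * ‖c‖ ^ 2
      + 2 * R ^ 2 * (inner ℝ v.2.1 c - v.1 * ‖c‖ ^ 2) + R ^ 4 * v.1)
  map_add' u v := by
    refine Prod.ext ?_ (Prod.ext ?_ ?_)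
    · simp only [Prod.fst_add, Prod.snd_add, inner_add_left]; ring
    · simp only [Prod.fst_add, Prod.snd_add, inner_add_left]; module
    · simp only [Prod.fst_add, Prod.snd_add, inner_add_left]; ring
  map_smul' a v := by
    refine Prod.ext ?_ (Prod.ext ?_ ?_)
    · simp only [Prod.smul_fst, Prod.smul_snd, real_inner_smul_left, smul_eq_mul,
        RingHom.id_apply]; ring
    · simp only [Prod.smul_fst, Prod.smul_snd, real_inner_smul_left, smul_eq_mul,
        RingHom.id_apply]; module
    · simp only [Prod.smul_fst, Prod.smul_snd, real_inner_smul_left, smul_eq_mul,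
        RingHom.id_apply]; ring

lemma inversionLift_conformal (c : E3) {R : ℝ} (hR : 0 < R) :
    IsConformal (R ^ 4) (inversionLift c R) := by
  refine ⟨by positivity, fun v v' => ?_⟩
  simp only [lform, inversionLift, LinearMap.coe_mk, AddHom.coe_mk, inner_add_left,
    inner_add_right, inner_sub_left, inner_sub_right,
    real_inner_smul_left, real_inner_smul_right, real_inner_self_eq_norm_sq]
  rw [real_inner_comm v'.2.1 c]
  ring

lemma inversionLift_lift (c : E3) (R : ℝ) (x : E3) (hx : x ≠ c) :
    inversionLift c R (lift x) = ‖x - c‖ ^ 2 • lift (EuclideanGeometry.inversion c R x) := by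
  have h0 : ‖x - c‖ ≠ 0 := by simpa [sub_eq_zero] using hx
  have h1 : ‖x‖ ^ 2 - 2 * inner ℝ x c + 1 * ‖c‖ ^ 2 = ‖x - c‖ ^ 2 := by
    rw [norm_sub_sq_real]; ring
  have h2 : EuclideanGeometry.inversion c R x = (R ^ 2 / ‖x - c‖ ^ 2) • (x - c) + c := by
    simp [EuclideanGeometry.inversion, dist_eq_norm, div_pow]
  refine Prod.ext ?_ (Prod.ext ?_ ?_)
  · simp only [inversionLift, lift, LinearMap.coe_mk, AddHom.coe_mk, h1]; simp
  · simp only [inversionLift, lift, LinearMap.coe_mk, AddHom.coe_mk, h1, h2, Prod.smul_snd,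
      Prod.smul_fst, smul_add, smul_smul, one_smul]
    rw [mul_div_cancel₀ _ (pow_ne_zero 2 h0)]; abel
  · simp only [inversionLift, lift, LinearMap.coe_mk, AddHom.coe_mk, h1, h2, Prod.smul_snd,
      smul_eq_mul]
    rw [norm_add_sq_real, norm_smul, real_inner_smul_left, inner_sub_left,
      real_inner_self_eq_norm_sq, Real.norm_eq_abs, mul_pow, sq_abs]
    field_simp
    ring

lemma inversionLift_center (c : E3) (R : ℝ) :
    inversionLift c R (lift c) = R ^ 4 • liftInf := by
  have h1 : ‖c‖ ^ 2 - 2 * ‖c‖ ^ 2 + ‖c‖ ^ 2 = 0 := by ring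
  refine Prod.ext ?_ (Prod.ext ?_ ?_) <;>
  simp [inversionLift, lift, liftInf, h1]

lemma inversionLift_inf (c : E3) (R : ℝ) :
    inversionLift c R liftInf = lift c := by
  refine Prod.ext ?_ (Prod.ext ?_ ?_) <;>
  simp [inversionLift, lift, liftInf]

lemma isoLift_inf (e : E3 ≃ᵃⁱ[ℝ] E3) : isoLift e liftInf = liftInf := by
  refine Prod.ext ?_ (Prod.ext ?_ ?_) <;> simp [isoLift, liftInf]

/-- The linear map `T` induces the Möbius transformation `g`. -/
def IsLiftOf (T : LV →ₗ[ℝ] LV) (g : Moebius) : Prop :=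
  (∀ x ∈ g.domain, ∃ d : ℝ, d ≠ 0 ∧ T (lift x) = d • lift (g.toFun x)) ∧
    ∀ x, x ∉ g.domain → (T (lift x)).1 = 0

lemma exists_lift_of_moebius (g : Moebius) :
    ∃ (c : ℝ) (T : LV →ₗ[ℝ] LV), IsConformal c T ∧ IsLiftOf T g := by
  cases g with
  | sim r hr e =>
    refine ⟨_, homothetyLift r ∘ₗ isoLift e, (homothetyLift_conformal hr).comp
      (isoLift_conformal e), fun x _ => ⟨1, one_ne_zero, ?_⟩, fun x hx => (hx trivial).elim⟩
    simp only [LinearMap.comp_apply, isoLift_lift, homothetyLift_lift, one_smul]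
    rfl
  | inv c R hR e =>
    refine ⟨_, isoLift e ∘ₗ inversionLift c R, (isoLift_conformal e).comp
      (inversionLift_conformal c hR), fun x hx => ⟨‖x - c‖ ^ 2, ?_, ?_⟩, fun x hx => ?_⟩
    · have : x ≠ c := hx
      simpa [sub_eq_zero] using this
    · rw [LinearMap.comp_apply, inversionLift_lift c R x hx, map_smul, isoLift_lift]
      rfl
    · have : x = c := by
        by_contra h
        exact hx h
      subst this
      rw [LinearMap.comp_apply, inversionLift_center, map_smul, isoLift_inf]
      simp [liftInf]

lemma inversionLift_involutive (c : E3) (v : LV) :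
    inversionLift c 1 (inversionLift c 1 v) = v := by
  refine Prod.ext ?_ (Prod.ext ?_ ?_)
  · simp only [inversionLift, LinearMap.coe_mk, AddHom.coe_mk, inner_add_left, inner_sub_left,
    real_inner_smul_left, real_inner_self_eq_norm_sq]; ring
  · simp only [inversionLift, LinearMap.coe_mk, AddHom.coe_mk, inner_add_left, inner_sub_left,
    real_inner_smul_left, real_inner_self_eq_norm_sq]; module
  · simp only [inversionLift, LinearMap.coe_mk, AddHom.coe_mk, inner_add_left, inner_sub_left,
    real_inner_smul_left, real_inner_self_eq_norm_sq]; ring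

/-- A conformal linear map fixing the direction of the point at infinity is the lift of a
similarity. -/
lemma exists_similarity_of_conformal {c : ℝ} {T : LV →ₗ[ℝ] LV} (hT : IsConformal c T)
    (h : (T liftInf).1 = 0) :
    ∃ (r : ℝ) (_ : 0 < r) (e : E3 ≃ᵃⁱ[ℝ] E3) (D : ℝ), D ≠ 0 ∧
      ∀ x, T (lift x) = D • lift (r • e x) := by
  have hn : lform (T liftInf) (T liftInf) = 0 := by
    rw [hT.2, lform_liftInf_self, mul_zero]
  obtain ⟨κ, hκ⟩ : ∃ κ : ℝ, T liftInf = κ • liftInf := ⟨_, eq_smul_liftInf hn h⟩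
  have hκ0 : κ ≠ 0 := by
    rintro rfl
    rw [zero_smul] at hκ
    exact liftInf_ne_zero (hT.injective (by rw [hκ, map_zero]))
  -- Pairing with `liftInf` shows that all the vectors `T (lift x)` have the same first coordinate
  -- `c / κ`.
  obtain ⟨D, hD⟩ : ∃ D, D = c / κ := ⟨_, rfl⟩
  have hD0 : D ≠ 0 := by rw [hD]; exact div_ne_zero hT.1.ne' hκ0
  have hw : ∀ x, (T (lift x)).1 = D := by
    intro x
    have h1 := hT.2 (lift x) liftInf
    rw [hκ, lform_smul_right, lform_liftInf_right, lform_liftInf_right] at h1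
    have h2 : (lift x).1 = 1 := rfl
    rw [h2] at h1
    rw [hD]; field_simp; linarith
  obtain ⟨G, hG⟩ : ∃ G : E3 → E3, ∀ x, T (lift x) = D • lift (G x) := by
    refine ⟨fun x => D⁻¹ • (T (lift x)).2.1, fun x => ?_⟩
    have h1 := eq_smul_lift (v := T (lift x)) (by rw [hT.2, lform_lift_self, mul_zero])
      (by rw [hw]; exact hD0)
    rwa [hw] at h1
  have hdist : ∀ x y, D ^ 2 * ‖G x - G y‖ ^ 2 = c * ‖x - y‖ ^ 2 := by
    intro x y
    have h1 := hT.2 (lift x) (lift y)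
    rw [hG, hG, lform_smul_left, lform_smul_right, lform_lift_lift, lform_lift_lift] at h1
    linarith
  obtain ⟨r, hr, hr2⟩ : ∃ r : ℝ, 0 < r ∧ D ^ 2 * r ^ 2 = c := by
    refine ⟨√(c / D ^ 2), Real.sqrt_pos.2 (div_pos hT.1 (by positivity)), ?_⟩
    rw [Real.sq_sqrt (div_nonneg hT.1.le (by positivity))]
    field_simp
  -- An isometry of a strictly convex space is affine, so `r⁻¹ • G` is automatically a Euclidean
  -- motion.
  have hiso : Isometry fun x => r⁻¹ • G x := by
    refine Isometry.of_dist_eq fun x y => ?_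
    rw [dist_eq_norm, dist_eq_norm, ← smul_sub, norm_smul]
    have h1 : ‖G x - G y‖ ^ 2 = (r * ‖x - y‖) ^ 2 := by
      have h2 := hdist x y
      rw [← hr2] at h2
      have h3 : D ^ 2 * (‖G x - G y‖ ^ 2 - (r * ‖x - y‖) ^ 2) = 0 := by linarith
      rcases mul_eq_zero.1 h3 with h4 | h4
      · exact absurd h4 (by positivity)
      · linarith
    have h2 : ‖G x - G y‖ = r * ‖x - y‖ :=
      (pow_left_inj₀ (norm_nonneg _) (by positivity) two_ne_zero).1 h1
    rw [h2, norm_inv, Real.norm_of_nonneg hr.le]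
    field_simp
  refine ⟨r, hr, hiso.affineIsometryOfStrictConvexSpace.toAffineIsometryEquiv rfl, D, hD0,
    fun x => ?_⟩
  rw [hG]
  have : (hiso.affineIsometryOfStrictConvexSpace.toAffineIsometryEquiv rfl) x = r⁻¹ • G x := rfl
  rw [this, smul_smul, mul_inv_cancel₀ hr.ne', one_smul]

/-- Every conformal linear map is the lift of a Möbius transformation. -/
lemma exists_moebius_of_conformal {c : ℝ} {T : LV →ₗ[ℝ] LV} (hT : IsConformal c T) :
    ∃ g : Moebius, IsLiftOf T g := by
  by_cases h : (T liftInf).1 = 0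
  · obtain ⟨r, hr, e, D, hD, h1⟩ := exists_similarity_of_conformal hT h
    exact ⟨.sim r hr e, fun x _ => ⟨D, hD, h1 x⟩, fun x hx => (hx trivial).elim⟩
  -- Here `v` spans the isotropic line that `T` sends to infinity. It represents a finite point `q`,
  -- and composing `T` with the unit inversion at `q` reduces to the case of a similarity.
  · set v := hT.equiv.symm liftInf with hv
    have hTv : T v = liftInf := by rw [← hT.equiv_apply, hv, LinearEquiv.apply_symm_apply]
    have hvn : lform v v = 0 := by
      have := hT.2 v v
      rw [hTv] at this
      rw [lform_liftInf_self] at this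
      exact (mul_eq_zero.1 this.symm).resolve_left hT.1.ne'
    have hv1 : v.1 ≠ 0 := by
      intro hv1
      have h1 := eq_smul_liftInf hvn hv1
      have h2 := congrArg T h1
      rw [hTv, map_smul] at h2
      have h3 := congrArg Prod.fst h2
      simp only [Prod.smul_fst, smul_eq_mul] at h3
      rcases mul_eq_zero.1 (h3.symm.trans rfl) with h4 | h4
      · rw [h4, zero_smul] at h2
        exact liftInf_ne_zero h2
      · exact h h4
    obtain ⟨q, κ, hκ, hq⟩ : ∃ (q : E3) (κ : ℝ), κ ≠ 0 ∧ v = κ • lift q :=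
      ⟨_, _, hv1, eq_smul_lift hvn hv1⟩
    have hTq : T (lift q) = κ⁻¹ • liftInf := by
      rw [← hTv, hq, map_smul, smul_smul, inv_mul_cancel₀ hκ, one_smul]
    obtain ⟨r, hr, e, D, hD, h1⟩ := exists_similarity_of_conformal
      (hT.comp (inversionLift_conformal q one_pos)) (by
        rw [LinearMap.comp_apply, inversionLift_inf, hTq]; simp [liftInf])
    -- the similarity followed by the inversion
    obtain ⟨s, hs, hs2⟩ : ∃ s : ℝ, 0 < s ∧ s ^ 2 = r := ⟨√r, Real.sqrt_pos.2 hr, Real.sq_sqrt hr.le⟩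
    -- The ratio `r` is absorbed into the radius: inversion of radius `√r` at `q` is the unit
    -- inversion followed by the homothety of centre `q` and ratio `r`. Only the isometric part is
    -- left for `e'`.
    let e' : E3 ≃ᵃⁱ[ℝ] E3 := (AffineIsometryEquiv.vaddConst ℝ q).symm.trans
      (e.linearIsometryEquiv.toAffineIsometryEquiv.trans
        (AffineIsometryEquiv.vaddConst ℝ (r • e q)))
    have he' : ∀ x, e' x = e.linearIsometryEquiv (x - q) + r • e q := fun x => rfl
    refine ⟨.inv q s hs e', fun x hx => ?_, fun x hx => ?_⟩
    · have hx' : x ≠ q := hx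
      have h0 : ‖x - q‖ ≠ 0 := by simpa [sub_eq_zero] using hx'
      refine ⟨‖x - q‖ ^ 2 * D, mul_ne_zero (pow_ne_zero 2 h0) hD, ?_⟩
      have h2 : T (lift x) = (T ∘ₗ inversionLift q 1) (inversionLift q 1 (lift x)) := by
        rw [LinearMap.comp_apply, inversionLift_involutive]
      rw [h2, inversionLift_lift q 1 x hx', map_smul, h1, smul_smul]
      congr 2
      change _ = e' (EuclideanGeometry.inversion q s x)
      rw [he', affineIsometry_apply e, affineIsometry_apply e q]
      have h3 : ∀ R : ℝ, EuclideanGeometry.inversion q R x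
          = (R ^ 2 / ‖x - q‖ ^ 2) • (x - q) + q := by
        intro R
        simp [EuclideanGeometry.inversion, dist_eq_norm, div_pow]
      rw [h3, h3, hs2]
      simp only [map_add, map_smul, add_sub_cancel_right, smul_add, smul_smul]
      rw [add_assoc]
      congr 2
      ring
    · have : x = q := by
        by_contra h
        exact hx h
      subst this
      rw [hTq]; simp [liftInf]

/-! ## Cyclides as quadratic sections of the light cone -/

/-- The isotropic direction `v` is a regular point of the quadric of the operator `M`. -/
def OnCyc (M : LV →ₗ[ℝ] LV) (v : LV) : Prop := lform (M v) v = 0 ∧ ∀ a : ℝ, M v ≠ a • v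

/-- The regular finite points of the quadric of the operator `M`. -/
def cyc (M : LV →ₗ[ℝ] LV) : Set E3 := {x | OnCyc M (lift x)}

lemma onCyc_smul {M : LV →ₗ[ℝ] LV} {v : LV} {d : ℝ} (hd : d ≠ 0) :
    OnCyc M (d • v) ↔ OnCyc M v := by
  simp only [OnCyc, map_smul, lform_smul_left, lform_smul_right, ne_eq, smul_comm _ d,
    smul_right_inj hd, mul_eq_zero, hd, false_or]

lemma onCyc_conj {c : ℝ} {T : LV ≃ₗ[ℝ] LV} (hT : IsConformal c (T : LV →ₗ[ℝ] LV))
    {M : LV →ₗ[ℝ] LV} {v : LV} : OnCyc (T.conj M) (T v) ↔ OnCyc M v := by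
  have h1 : T.conj M (T v) = T (M v) := by simp [LinearEquiv.conj_apply]
  have h2 := hT.2 (M v) v
  simp only [LinearEquiv.coe_coe] at h2
  simp only [OnCyc, h1, h2, mul_eq_zero, hT.1.ne', false_or, ne_eq, ← map_smul,
    T.injective.eq_iff]

lemma mem_cyc_conj {c : ℝ} {T : LV ≃ₗ[ℝ] LV} (hT : IsConformal c (T : LV →ₗ[ℝ] LV))
    {g : Moebius} (hg : IsLiftOf (T : LV →ₗ[ℝ] LV) g) (M : LV →ₗ[ℝ] LV) {x : E3}
    (hx : x ∈ g.domain) : g.toFun x ∈ cyc (T.conj M) ↔ x ∈ cyc M := by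
  obtain ⟨d, hd, h⟩ := hg.1 x hx
  simp only [cyc, mem_ofPred_eq]
  rw [← onCyc_conj hT (M := M), ← onCyc_smul hd, ← h]
  rfl

lemma isotropic_symm {c : ℝ} {T : LV ≃ₗ[ℝ] LV} (hT : IsConformal c (T : LV →ₗ[ℝ] LV)) (y : E3) :
    lform (T.symm (lift y)) (T.symm (lift y)) = 0 := by
  have := hT.symm.2 (lift y) (lift y)
  rw [lform_lift_self, mul_zero] at this
  exact this

lemma mem_image_of_fst_ne_zero {c : ℝ} {T : LV ≃ₗ[ℝ] LV}
    (hT : IsConformal c (T : LV →ₗ[ℝ] LV)) {g : Moebius}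
    (hg : IsLiftOf (T : LV →ₗ[ℝ] LV) g) {y : E3} (h : (T.symm (lift y)).1 ≠ 0) :
    ∃ x ∈ g.domain, g.toFun x = y := by
  have h2 := eq_smul_lift (isotropic_symm hT y) h
  set κ := (T.symm (lift y)).1
  set x := κ⁻¹ • (T.symm (lift y)).2.1
  have h3 : T (lift x) = κ⁻¹ • lift y := by
    rw [← T.apply_symm_apply (lift y), h2, map_smul, smul_smul, inv_mul_cancel₀ h, one_smul]
  have hx : x ∈ g.domain := by
    by_contra hx
    have h4 := hg.2 x hx
    rw [LinearEquiv.coe_coe, h3] at h4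
    simp [lift, h] at h4
  obtain ⟨d, hd, h5⟩ := hg.1 x hx
  rw [LinearEquiv.coe_coe, h3] at h5
  refine ⟨x, hx, ?_⟩
  have h6 : lift (g.toFun x) = (d⁻¹ * κ⁻¹) • lift y := by
    rw [mul_smul, h5, smul_smul, inv_mul_cancel₀ hd, one_smul]
  exact lift_injective h6

lemma mem_image_cyc {c : ℝ} {T : LV ≃ₗ[ℝ] LV} (hT : IsConformal c (T : LV →ₗ[ℝ] LV))
    {g : Moebius} (hg : IsLiftOf (T : LV →ₗ[ℝ] LV) g) (M : LV →ₗ[ℝ] LV) {y : E3}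
    (h : (T.symm (lift y)).1 ≠ 0) : y ∈ g.image (cyc M) ↔ y ∈ cyc (T.conj M) := by
  constructor
  · rintro ⟨x, ⟨hx, hxd⟩, rfl⟩
    exact (mem_cyc_conj hT hg M hxd).2 hx
  · intro hy
    obtain ⟨x, hx, rfl⟩ := mem_image_of_fst_ne_zero hT hg h
    exact ⟨x, ⟨(mem_cyc_conj hT hg M hx).1 hy, hx⟩, rfl⟩

/-- The only point of the transformed quadric that `g.image` can miss is the image of infinity,
hence the condition at `liftInf`. -/
lemma image_cyc {c : ℝ} {T : LV ≃ₗ[ℝ] LV} (hT : IsConformal c (T : LV →ₗ[ℝ] LV))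
    {g : Moebius} (hg : IsLiftOf (T : LV →ₗ[ℝ] LV) g) {M : LV →ₗ[ℝ] LV}
    (hM : ¬ OnCyc M liftInf) : g.image (cyc M) = cyc (T.conj M) := by
  ext y
  by_cases h : (T.symm (lift y)).1 = 0
  · constructor
    · rintro ⟨x, ⟨hx, hxd⟩, rfl⟩
      exact (mem_cyc_conj hT hg M hxd).2 hx
    · intro hy
      exfalso
      have h2 := eq_smul_liftInf (isotropic_symm hT y) h
      have h3 : (T.symm (lift y)).2.2 ≠ 0 := by
        intro h3
        rw [h3, zero_smul] at h2
        exact lift_ne_zero y (by simpa using h2)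
      have h4 : OnCyc (T.conj M) (T (T.symm (lift y))) := by
        rw [T.apply_symm_apply]; exact hy
      rw [onCyc_conj hT, h2, onCyc_smul h3] at h4
      exact hM h4
  · exact mem_image_cyc hT hg M h

/-- The form of the identity vanishes on the light cone, and adding it does not change eigenvectors.
A quadric thus determines its operator at best up to such an affine change. -/
lemma cyc_smul_add {M : LV →ₗ[ℝ] LV} {a b : ℝ} (ha : a ≠ 0) :
    cyc (a • M + b • LinearMap.id) = cyc M := by
  ext x
  simp only [cyc, OnCyc, mem_ofPred_eq, LinearMap.add_apply, LinearMap.smul_apply,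
    LinearMap.id_apply, lform_add_left, lform_smul_left, lform_lift_self, mul_zero, add_zero,
    mul_eq_zero, ha, false_or]
  refine and_congr_right fun _ => ⟨fun h t ht => h (a * t + b) ?_, fun h t ht => ?_⟩
  · rw [ht]; module
  · refine h (a⁻¹ * (t - b)) ?_
    have h1 : a • M (lift x) = (t - b) • lift x := by rw [sub_smul, ← ht]; abel
    rw [mul_smul, ← h1, smul_smul, inv_mul_cancel₀ ha, one_smul]

/-! ### Dupin operators -/

/-- The eigenspace of `M` for the eigenvalue `a` is at least two-dimensional. -/
def HasEigenplane (M : LV →ₗ[ℝ] LV) (a : ℝ) : Prop :=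
  ∃ u v : LV, M u = a • u ∧ M v = a • v ∧ ∀ s t : ℝ, s • u + t • v = 0 → s = 0 ∧ t = 0

/-- A plane meets every hyperplane. Hyperplanes chosen among the coordinate ones will turn the
double eigenvalues into explicit equations. -/
lemma HasEigenplane.exists_mem_ker {M : LV →ₗ[ℝ] LV} {a : ℝ} (h : HasEigenplane M a)
    (l : LV →ₗ[ℝ] ℝ) : ∃ v, v ≠ 0 ∧ M v = a • v ∧ l v = 0 := by
  obtain ⟨u, v, hu, hv, hi⟩ := h
  by_cases h0 : l u = 0
  · refine ⟨u, ?_, hu, h0⟩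
    rintro rfl
    simpa using (hi 1 0 (by simp)).1
  · refine ⟨l v • u - l u • v, fun h => h0 ?_, ?_, ?_⟩
    · have := (hi (l v) (-l u) (by rw [neg_smul, ← sub_eq_add_neg]; exact h)).2
      linarith
    · rw [map_sub, map_smul, map_smul, hu, hv]; module
    · simp [mul_comm]

/-- Self-adjoint operators with two distinct eigenvalues of geometric multiplicity at least two. -/
def IsDupinOp (M : LV →ₗ[ℝ] LV) : Prop :=
  (∀ v v', lform (M v) v' = lform v (M v')) ∧
    ∃ a b : ℝ, a ≠ b ∧ HasEigenplane M a ∧ HasEigenplane M b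

lemma HasEigenplane.conj {M : LV →ₗ[ℝ] LV} {a : ℝ} (h : HasEigenplane M a) (T : LV ≃ₗ[ℝ] LV) :
    HasEigenplane (T.conj M) a := by
  obtain ⟨u, v, hu, hv, hi⟩ := h
  refine ⟨T u, T v, by simp [LinearEquiv.conj_apply, hu], by simp [LinearEquiv.conj_apply, hv],
    fun s t hst => hi s t ?_⟩
  rw [← map_smul, ← map_smul, ← map_add] at hst
  exact T.map_eq_zero_iff.1 hst

lemma IsDupinOp.conj {M : LV →ₗ[ℝ] LV} (h : IsDupinOp M) {c : ℝ} {T : LV ≃ₗ[ℝ] LV}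
    (hT : IsConformal c (T : LV →ₗ[ℝ] LV)) : IsDupinOp (T.conj M) := by
  obtain ⟨h1, a, b, hab, ha, hb⟩ := h
  refine ⟨fun v v' => ?_, a, b, hab, ha.conj T, hb.conj T⟩
  have h2 := hT.2 (M (T.symm v)) (T.symm v')
  have h3 := hT.2 (T.symm v) (M (T.symm v'))
  simp only [LinearEquiv.coe_coe, LinearEquiv.apply_symm_apply] at h2 h3
  simp only [LinearEquiv.conj_apply, LinearMap.comp_apply, LinearEquiv.coe_coe]
  rw [h2, h3, h1]

/-! ### The model surfaces -/

lemma inner_eq3 (x y : E3) : inner ℝ x y = x 0 * y 0 + x 1 * y 1 + x 2 * y 2 := by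
  simp [PiLp.inner_apply, Fin.sum_univ_three, mul_comm]

lemma norm_sq3 (x : E3) : ‖x‖ ^ 2 = x 0 ^ 2 + x 1 ^ 2 + x 2 ^ 2 := by
  rw [← real_inner_self_eq_norm_sq, inner_eq3]; ring

lemma LV.ext_iff {u v : LV} : u = v ↔ u.1 = v.1 ∧ u.2.1 0 = v.2.1 0 ∧ u.2.1 1 = v.2.1 1 ∧
    u.2.1 2 = v.2.1 2 ∧ u.2.2 = v.2.2 := by
  constructor
  · rintro rfl; simp
  · rintro ⟨h1, h2, h3, h4, h5⟩
    refine Prod.ext h1 (Prod.ext ?_ h5)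
    ext i; fin_cases i <;> assumption

/-- The linear map with the given coordinates. -/
def coordMap (f : Fin 5 → LV → ℝ) (hf : ∀ i u v, f i (u + v) = f i u + f i v)
    (hf' : ∀ i (a : ℝ) v, f i (a • v) = a * f i v) : LV →ₗ[ℝ] LV where
  toFun v := (f 0 v, !₂[f 1 v, f 2 v, f 3 v], f 4 v)
  map_add' u v := by rw [LV.ext_iff]; simp [hf]
  map_smul' a v := by rw [LV.ext_iff]; simp [hf']

/-- The operator of the torus. -/
def torusOp (R r : ℝ) : LV →ₗ[ℝ] LV :=
  coordMap ![fun v => -2 * (v.2.2 + (R ^ 2 - r ^ 2) * v.1), fun v => -4 * R ^ 2 * v.2.1 0,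
    fun v => -4 * R ^ 2 * v.2.1 1, fun _ => 0,
    fun v => -2 * (R ^ 2 - r ^ 2) * (v.2.2 + (R ^ 2 - r ^ 2) * v.1)]
    (by intro i u v; fin_cases i <;> simp <;> ring) (by intro i u v; fin_cases i <;> simp <;> ring)

/-- The operator of the cylinder. -/
def cylinderOp (r : ℝ) : LV →ₗ[ℝ] LV :=
  coordMap ![fun _ => 0, fun v => v.2.1 0, fun v => v.2.1 1, fun _ => 0, fun v => 2 * r ^ 2 * v.1]
    (by intro i u v; fin_cases i <;> simp <;> ring) (by intro i u v; fin_cases i <;> simp <;> ring)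

/-- The operator of the cone. -/
def coneOp (m : ℝ) : LV →ₗ[ℝ] LV :=
  coordMap ![fun _ => 0, fun v => v.2.1 0, fun v => v.2.1 1, fun v => -m ^ 2 * v.2.1 2, fun _ => 0]
    (by intro i u v; fin_cases i <;> simp <;> ring) (by intro i u v; fin_cases i <;> simp <;> ring)

lemma torusSet_eq {R r : ℝ} (hr : 0 < r) (hR : r < R) : torusSet R r = cyc (torusOp R r) := by
  ext x
  have hd : 0 < R ^ 2 - r ^ 2 := by nlinarith
  have hR0 : 0 < R := hr.trans hR
  have hs := Real.sq_sqrt (show 0 ≤ x 0 ^ 2 + x 1 ^ 2 by positivity)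
  have hs0 := Real.sqrt_nonneg (x 0 ^ 2 + x 1 ^ 2)
  have hq : lform (torusOp R r (lift x)) (lift x)
      = (‖x‖ ^ 2 + (R ^ 2 - r ^ 2)) ^ 2 - 4 * R ^ 2 * (x 0 ^ 2 + x 1 ^ 2) := by
    simp [lform, torusOp, coordMap, lift, inner_eq3]; ring
  simp only [torusSet, cyc, OnCyc, mem_ofPred_eq, hq]
  -- The torus is `‖x‖² + R² - r² = 2 R √(x₀² + x₁²)`; both sides are nonnegative, so squaring loses
  -- nothing.
  have key : (√(x 0 ^ 2 + x 1 ^ 2) - R) ^ 2 + x 2 ^ 2 = r ^ 2 ↔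
      (‖x‖ ^ 2 + (R ^ 2 - r ^ 2)) ^ 2 - 4 * R ^ 2 * (x 0 ^ 2 + x 1 ^ 2) = 0 := by
    have h1 : 0 ≤ ‖x‖ ^ 2 + (R ^ 2 - r ^ 2) := by positivity
    have h2 : ‖x‖ ^ 2 = √(x 0 ^ 2 + x 1 ^ 2) ^ 2 + x 2 ^ 2 := by rw [hs, norm_sq3]
    constructor
    · intro h
      have h3 : ‖x‖ ^ 2 + (R ^ 2 - r ^ 2) = 2 * R * √(x 0 ^ 2 + x 1 ^ 2) := by
        rw [h2]; linarith
      rw [h3, mul_pow, hs]; ring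
    · intro h
      have h3 : (‖x‖ ^ 2 + (R ^ 2 - r ^ 2)) ^ 2 = (2 * R * √(x 0 ^ 2 + x 1 ^ 2)) ^ 2 := by
        rw [mul_pow, hs]; linarith
      have h4 := (pow_left_inj₀ h1 (by positivity) two_ne_zero).1 h3
      rw [h2] at h4; linarith
  rw [key]
  -- No singular points: the horizontal coordinates of an eigenvector on the quadric force the
  -- eigenvalue `-4R²`, and the first and last coordinates then give `‖x‖² = R² - r²` and `r = 0`.
  refine ⟨fun h => ⟨h, fun a ha => ?_⟩, fun h => h.1⟩
  rw [LV.ext_iff] at ha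
  simp [torusOp, coordMap, lift] at ha
  obtain ⟨h1, h2, h3, -, h5⟩ := ha
  have h6 : 0 < x 0 ^ 2 + x 1 ^ 2 := by
    by_contra h6
    have h7 : x 0 ^ 2 + x 1 ^ 2 = 0 := le_antisymm (not_lt.1 h6) (by positivity)
    rw [h7] at h
    have h8 : 0 < ‖x‖ ^ 2 + (R ^ 2 - r ^ 2) := by positivity
    nlinarith
  have h7 : a = -(4 * R ^ 2) := by
    have : (a + 4 * R ^ 2) * (x 0 ^ 2 + x 1 ^ 2) = 0 := by linear_combination -x 0 * h2 - x 1 * h3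
    rcases mul_eq_zero.1 this with h | h
    · linarith
    · exact absurd h h6.ne'
  have h8 : ‖x‖ ^ 2 + (R ^ 2 - r ^ 2) = 2 * R ^ 2 := by linarith
  have h9 : ‖x‖ ^ 2 = R ^ 2 - r ^ 2 := by
    rw [h8, h7] at h5
    have : R ^ 2 * (‖x‖ ^ 2 - (R ^ 2 - r ^ 2)) = 0 := by linarith
    rcases mul_eq_zero.1 this with h | h
    · exact absurd h (by positivity)
    · linarith
  nlinarith

lemma cylinderSet_eq {r : ℝ} (hr : 0 < r) : cylinderSet r = cyc (cylinderOp r) := by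
  ext x
  have hq : lform (cylinderOp r (lift x)) (lift x) = x 0 ^ 2 + x 1 ^ 2 - r ^ 2 := by
    simp [lform, cylinderOp, coordMap, lift, inner_eq3]; ring
  simp only [cylinderSet, cyc, OnCyc, mem_ofPred_eq, hq, sub_eq_zero]
  refine ⟨fun h => ⟨h, fun a ha => ?_⟩, fun h => h.1⟩
  rw [LV.ext_iff] at ha
  simp [cylinderOp, coordMap, lift] at ha
  obtain ⟨h1, h2, h3, -, h5⟩ := ha
  rw [← h1, zero_mul] at h5
  nlinarith

lemma coneSet_eq {m : ℝ} (hm : 0 < m) : coneSet m = cyc (coneOp m) := by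
  ext x
  have hq : lform (coneOp m (lift x)) (lift x) = x 0 ^ 2 + x 1 ^ 2 - m ^ 2 * x 2 ^ 2 := by
    simp [lform, coneOp, coordMap, lift, inner_eq3]; ring
  simp only [coneSet, cyc, OnCyc, mem_ofPred_eq, hq, sub_eq_zero]
  refine and_congr_right fun _ => ⟨fun h a ha => h ?_, fun h hx => h 0 ?_⟩
  · rw [LV.ext_iff] at ha
    simp [coneOp, coordMap, lift] at ha
    obtain ⟨rfl, h2, h3, h4, -⟩ := ha
    ext i
    fin_cases i
    · simpa using h2
    · simpa using h3
    · simpa [hm.ne'] using h4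
  · rw [hx, LV.ext_iff]
    simp [coneOp, coordMap, lift]

lemma torusOp_inf (R r : ℝ) : ¬ OnCyc (torusOp R r) liftInf := by
  intro h
  have := h.1
  simp [lform, torusOp, coordMap, liftInf] at this

/-- Infinity does lie on the quadric of a cylinder or a cone, but as an eigenvector for the
eigenvalue 0, that is, as a singular point. -/
lemma cylinderOp_inf (r : ℝ) : ¬ OnCyc (cylinderOp r) liftInf := by
  intro h
  refine h.2 0 ?_
  rw [LV.ext_iff]
  simp [cylinderOp, coordMap, liftInf]

lemma coneOp_inf (m : ℝ) : ¬ OnCyc (coneOp m) liftInf := by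
  intro h
  refine h.2 0 ?_
  rw [LV.ext_iff]
  simp [coneOp, coordMap, liftInf]

lemma torusOp_dupin {R r : ℝ} (hr : 0 < r) (hR : r < R) : IsDupinOp (torusOp R r) := by
  have hR0 : 0 < R := hr.trans hR
  have hd : 0 < R ^ 2 - r ^ 2 := by nlinarith
  refine ⟨fun v v' => ?_, -4 * R ^ 2, 0, by nlinarith [sq_pos_of_pos hR0],
    ⟨(0, !₂[1, 0, 0], 0), (0, !₂[0, 1, 0], 0), ?_, ?_, fun s t h => ?_⟩,
    ⟨(0, !₂[0, 0, 1], 0), (-1, 0, R ^ 2 - r ^ 2), ?_, ?_, fun s t h => ?_⟩⟩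
  · simp [lform, torusOp, coordMap, inner_eq3]; ring
  all_goals rw [LV.ext_iff] at *
  all_goals simp [torusOp, coordMap] at *
  · exact h
  · exact ⟨h.2.1, h.1⟩

lemma cylinderOp_dupin (r : ℝ) : IsDupinOp (cylinderOp r) := by
  refine ⟨fun v v' => ?_, 1, 0, one_ne_zero,
    ⟨(0, !₂[1, 0, 0], 0), (0, !₂[0, 1, 0], 0), ?_, ?_, fun s t h => ?_⟩,
    ⟨(0, !₂[0, 0, 1], 0), (0, 0, 1), ?_, ?_, fun s t h => ?_⟩⟩
  · simp [lform, cylinderOp, coordMap, inner_eq3]; ring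
  all_goals rw [LV.ext_iff] at *
  all_goals simp [cylinderOp, coordMap] at *
  · exact h
  · exact h

lemma coneOp_dupin (m : ℝ) : IsDupinOp (coneOp m) := by
  refine ⟨fun v v' => ?_, 1, 0, one_ne_zero,
    ⟨(0, !₂[1, 0, 0], 0), (0, !₂[0, 1, 0], 0), ?_, ?_, fun s t h => ?_⟩,
    ⟨(1, 0, 0), (0, 0, 1), ?_, ?_, fun s t h => ?_⟩⟩
  · simp [lform, coneOp, coordMap, inner_eq3]; ring
  all_goals rw [LV.ext_iff] at *
  all_goals simp [coneOp, coordMap] at *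
  · exact h
  · exact h

/-- Every Dupin cyclide is the regular part of the quadric of a Dupin operator. -/
lemma IsDupinCyclide.exists_op {C : Set E3} (hC : IsDupinCyclide C) :
    ∃ M, IsDupinOp M ∧ C = cyc M := by
  obtain ⟨g, h⟩ := hC
  obtain ⟨c, T, hT, hg⟩ := exists_lift_of_moebius g
  have hT' : IsConformal c (hT.equiv : LV →ₗ[ℝ] LV) := hT
  have hg' : IsLiftOf (hT.equiv : LV →ₗ[ℝ] LV) g := hg
  rcases h with ⟨R, r, hr, hR, rfl⟩ | ⟨r, hr, rfl⟩ | ⟨m, hm, rfl⟩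
  · refine ⟨_, (torusOp_dupin hr hR).conj hT', ?_⟩
    rw [torusSet_eq hr hR, image_cyc hT' hg' (torusOp_inf R r)]
  · refine ⟨_, (cylinderOp_dupin r).conj hT', ?_⟩
    rw [cylinderSet_eq hr, image_cyc hT' hg' (cylinderOp_inf r)]
  · refine ⟨_, (coneOp_dupin m).conj hT', ?_⟩
    rw [coneSet_eq hm, image_cyc hT' hg' (coneOp_inf m)]

/-! ### The standard operators are cyclide operators -/

/-- All conformal images of the quadric of `M` are Dupin cyclides. -/
def IsCyclideOp (M : LV →ₗ[ℝ] LV) : Prop :=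
  ∀ (c : ℝ) (T : LV ≃ₗ[ℝ] LV), IsConformal c (T : LV →ₗ[ℝ] LV) → IsDupinCyclide (cyc (T.conj M))

lemma torusOp_cyclide {R r : ℝ} (hr : 0 < r) (hR : r < R) : IsCyclideOp (torusOp R r) := by
  intro c T hT
  obtain ⟨g, hg⟩ := exists_moebius_of_conformal hT
  exact ⟨g, Or.inl ⟨R, r, hr, hR, by rw [torusSet_eq hr hR, image_cyc hT hg (torusOp_inf R r)]⟩⟩

lemma cylinderOp_cyclide {r : ℝ} (hr : 0 < r) : IsCyclideOp (cylinderOp r) := by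
  intro c T hT
  obtain ⟨g, hg⟩ := exists_moebius_of_conformal hT
  exact ⟨g, Or.inr (Or.inl ⟨r, hr,
    by rw [cylinderSet_eq hr, image_cyc hT hg (cylinderOp_inf r)]⟩)⟩

lemma coneOp_cyclide {m : ℝ} (hm : 0 < m) : IsCyclideOp (coneOp m) := by
  intro c T hT
  obtain ⟨g, hg⟩ := exists_moebius_of_conformal hT
  exact ⟨g, Or.inr (Or.inr ⟨m, hm, by rw [coneSet_eq hm, image_cyc hT hg (coneOp_inf m)]⟩)⟩

/-- `M'` is the conjugate of `a M + b` by `S`, and the affine change does not affect quadrics. It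
therefore suffices to match spectra by an affine map of the line and eigenvectors by a conformal
`S`. -/
lemma IsCyclideOp.of_intertwine {M M' : LV →ₗ[ℝ] LV} (h : IsCyclideOp M) {c : ℝ}
    {S : LV →ₗ[ℝ] LV} (hS : IsConformal c S) {a b : ℝ} (ha : a ≠ 0)
    (hM : ∀ v, M' (S v) = S (a • M v + b • v)) : IsCyclideOp M' := by
  intro c' T hT
  have h1 := h _ (hS.equiv.trans T) (hT.comp hS)
  have h2 : T.conj M' = a • ((hS.equiv.trans T).conj M) + b • LinearMap.id := by
    refine LinearMap.ext fun v => ?_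
    obtain ⟨u, rfl⟩ := (hS.equiv.trans T).surjective v
    have h3 : T.conj M' ((hS.equiv.trans T) u) = T (M' (S u)) := by
      simp [LinearEquiv.conj_apply, LinearEquiv.trans_apply, hS.equiv_apply]
    have h4 : (hS.equiv.trans T).conj M ((hS.equiv.trans T) u) = T (S (M u)) := by
      simp only [LinearEquiv.conj_apply, LinearMap.comp_apply, LinearEquiv.coe_coe,
        LinearEquiv.symm_apply_apply]
      rfl
    have h5 : (hS.equiv.trans T) u = T (S u) := rfl
    rw [h3, hM, LinearMap.add_apply, LinearMap.smul_apply, LinearMap.smul_apply,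
      LinearMap.id_apply, h4, h5]
    simp
  rw [h2, cyc_smul_add ha]
  exact h1

/-- The operator of the cyclide `2z = x² - y² + E z² + z ρ / 2 - E ρ² / 4`, `ρ = x² + y² + z²`. -/
def stdOp (E : ℝ) : LV →ₗ[ℝ] LV :=
  coordMap ![fun v => -v.2.1 2 / 2 + E * v.2.2 / 2, fun v => v.2.1 0, fun v => -v.2.1 1,
    fun v => E * v.2.1 2 + v.2.2 / 4 - v.1, fun v => 2 * v.2.1 2]
    (by intro i u v; fin_cases i <;> simp <;> ring) (by intro i u v; fin_cases i <;> simp <;> ring)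

lemma exists_sq_mul_eq_one {a : ℝ} (ha : 0 < a) : ∃ b : ℝ, b ^ 2 * a = 1 :=
  ⟨√(a⁻¹), by rw [Real.sq_sqrt (inv_pos.2 ha).le, inv_mul_cancel₀ ha.ne']⟩

/-- `stdOp E` has the eigenvalue `1` on the `x` axis and on `(E - 1/2, 1, 2)`, the eigenvalue `-1`
on the `y` axis and on `(E + 1/2, 1, -2)`, and the eigenvalue `E` on `(1/2, E, 2)`, in the
coordinates `(w, z, ρ)`. The Lorentz squares of the three vectors are `2 - 2E`, `2 + 2E` and `E² -
1`. For `|E| < 1` only the last one is timelike, as for a torus. -/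
lemma stdOp_cyclide_of_abs_lt {E : ℝ} (h1 : -1 < E) (h2 : E < 1) : IsCyclideOp (stdOp E) := by
  -- The numbers `α`, `β`, `γ` normalize these three eigenvectors.
  obtain ⟨α, hα⟩ := exists_sq_mul_eq_one (show 0 < 2 - 2 * E by linarith)
  obtain ⟨β, hβ⟩ := exists_sq_mul_eq_one (show 0 < 2 + 2 * E by linarith)
  obtain ⟨γ, hγ⟩ := exists_sq_mul_eq_one (show 0 < 1 - E ^ 2 by nlinarith)
  have hE : 0 < 1 + E := by linarith
  have hR : 1 < √(2 / (1 + E)) := by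
    rw [Real.lt_sqrt zero_le_one, lt_div_iff₀ hE]; linarith
  have hR2 : √(2 / (1 + E)) ^ 2 = 2 / (1 + E) := Real.sq_sqrt (by positivity)
  set R := √(2 / (1 + E))
  have hr2 : √(R ^ 2 - 1) ^ 2 = R ^ 2 - 1 := Real.sq_sqrt (by nlinarith)
  have hr : 0 < √(R ^ 2 - 1) := Real.sqrt_pos.2 (by nlinarith)
  set r := √(R ^ 2 - 1)
  have hrR : r < R := by nlinarith
  have hd : R ^ 2 - r ^ 2 = 1 := by linarith
  have hRE : R ^ 2 * (1 + E) = 2 := by rw [hR2]; field_simp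
  let S : LV →ₗ[ℝ] LV := coordMap ![
    fun v => v.2.1 1 * α * (E - 1 / 2) + (v.2.2 - v.1) / 2 * β * (E + 1 / 2)
      + (v.2.2 + v.1) / 2 * γ * (1 / 2),
    fun v => v.2.1 0, fun v => v.2.1 2,
    fun v => v.2.1 1 * α + (v.2.2 - v.1) / 2 * β + (v.2.2 + v.1) / 2 * γ * E,
    fun v => 2 * v.2.1 1 * α - 2 * ((v.2.2 - v.1) / 2) * β + 2 * ((v.2.2 + v.1) / 2) * γ]
    (by intro i u v; fin_cases i <;> simp <;> ring) (by intro i u v; fin_cases i <;> simp <;> ring)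
  have hS : IsConformal 1 S := by
    refine ⟨one_pos, fun v v' => ?_⟩
    simp [lform, S, coordMap, inner_eq3]
    linear_combination (v.2.1 1 * v'.2.1 1) * hα
      + ((v.2.2 - v.1) / 2 * ((v'.2.2 - v'.1) / 2)) * hβ
      - ((v.2.2 + v.1) / 2 * ((v'.2.2 + v'.1) / 2)) * hγ
  -- With `R² - r² = 1` and `R² (1 + E) = 2`, this affine map takes the torus eigenvalues `-4R²`,
  -- `0`, `-4` to `1`, `-1`, `E`.
  refine (torusOp_cyclide hr hrR).of_intertwine hS (a := -(1 + E) / 4) (b := -1)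
    (by linarith) fun v => ?_
  rw [LV.ext_iff]
  simp [S, coordMap, stdOp, torusOp, hd]
  refine ⟨?_, ?_, ?_, ?_⟩
  · linear_combination (-v.2.1 1 * α * (E - 1 / 2)) * hRE
  · linear_combination (-v.2.1 0) * hRE
  · linear_combination (-v.2.1 1 * α) * hRE
  · linear_combination (-2 * v.2.1 1 * α) * hRE

/-- Now the timelike eigenvector belongs to the eigenvalue `-1`, whose eigenplane is Lorentzian; for
a cone this plane is spanned by the apex and infinity. The slope comes from sending the cone
eigenvalues `1`, `0`, `-m²` to `1`, `-1`, `E` by `t ↦ 2t - 1`. -/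
lemma stdOp_cyclide_of_lt {E : ℝ} (h1 : E < -1) : IsCyclideOp (stdOp E) := by
  obtain ⟨α, hα⟩ := exists_sq_mul_eq_one (show 0 < 2 - 2 * E by linarith)
  obtain ⟨β, hβ⟩ := exists_sq_mul_eq_one (show 0 < -2 - 2 * E by linarith)
  obtain ⟨γ, hγ⟩ := exists_sq_mul_eq_one (show 0 < E ^ 2 - 1 by nlinarith)
  have hm : 0 < √(-(1 + E) / 2) := Real.sqrt_pos.2 (by linarith)
  have hm2 : √(-(1 + E) / 2) ^ 2 = -(1 + E) / 2 := Real.sq_sqrt (by linarith)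
  set m := √(-(1 + E) / 2)
  let S : LV →ₗ[ℝ] LV := coordMap ![
    fun v => v.2.1 1 * α * (E - 1 / 2) + (v.2.2 + v.1) / 2 * β * (E + 1 / 2)
      + v.2.1 2 * γ * (1 / 2),
    fun v => v.2.1 0, fun v => (v.2.2 - v.1) / 2,
    fun v => v.2.1 1 * α + (v.2.2 + v.1) / 2 * β + v.2.1 2 * γ * E,
    fun v => 2 * v.2.1 1 * α - 2 * ((v.2.2 + v.1) / 2) * β + 2 * v.2.1 2 * γ]
    (by intro i u v; fin_cases i <;> simp <;> ring) (by intro i u v; fin_cases i <;> simp <;> ring)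
  have hS : IsConformal 1 S := by
    refine ⟨one_pos, fun v v' => ?_⟩
    simp [lform, S, coordMap, inner_eq3]
    linear_combination (v.2.1 1 * v'.2.1 1) * hα
      - ((v.2.2 + v.1) / 2 * ((v'.2.2 + v'.1) / 2)) * hβ
      + (v.2.1 2 * v'.2.1 2) * hγ
  refine (coneOp_cyclide hm).of_intertwine hS (a := 2) (b := -1) two_ne_zero fun v => ?_
  rw [LV.ext_iff]
  simp [S, coordMap, stdOp, coneOp, hm2]
  refine ⟨?_, ?_, ?_, ?_, ?_⟩ <;> ring

/-- The eigenvalue `E` merges with `-1` in a Jordan block, as infinity does for a cylinder. The map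
`S` takes `liftInf` to the isotropic eigenvector `(-1/2, 1, -2)` and `lift 0` to an isotropic
generalized eigenvector above it. -/
lemma stdOp_cyclide_neg_one : IsCyclideOp (stdOp (-1)) := by
  let S : LV →ₗ[ℝ] LV := coordMap ![
    fun v => v.2.1 1 * (-3 / 4) - v.2.2 / 2 - 9 / 32 * v.1,
    fun v => v.2.1 0, fun v => v.2.1 2,
    fun v => v.2.1 1 / 2 + v.2.2 - 3 / 16 * v.1,
    fun v => v.2.1 1 - 2 * v.2.2 - v.1 / 8]
    (by intro i u v; fin_cases i <;> simp <;> ring) (by intro i u v; fin_cases i <;> simp <;> ring)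
  have hS : IsConformal 1 S := by
    refine ⟨one_pos, fun v v' => ?_⟩
    simp [lform, S, coordMap, inner_eq3]
    ring
  refine (cylinderOp_cyclide (r := 1 / 4) (by norm_num)).of_intertwine hS (a := 2) (b := -1)
    two_ne_zero fun v => ?_
  rw [LV.ext_iff]
  simp [S, coordMap, stdOp, cylinderOp]
  refine ⟨?_, ?_, ?_, ?_⟩ <;> ring

/-- Exchanging `x` and `y` and reversing `z` turns the form of `stdOp E` into the negative of that
of `stdOp (-E)`. -/
lemma stdOp_cyclide_neg {E : ℝ} (h : IsCyclideOp (stdOp E)) : IsCyclideOp (stdOp (-E)) := by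
  let S : LV →ₗ[ℝ] LV := coordMap ![
    fun v => v.1, fun v => v.2.1 1, fun v => v.2.1 0, fun v => -v.2.1 2, fun v => v.2.2]
    (by intro i u v; fin_cases i <;> simp <;> ring) (by intro i u v; fin_cases i <;> simp)
  have hS : IsConformal 1 S := by
    refine ⟨one_pos, fun v v' => ?_⟩
    simp [lform, S, coordMap, inner_eq3]
    ring
  refine h.of_intertwine hS (a := -1) (b := 0) (by norm_num) fun v => ?_
  rw [LV.ext_iff]
  simp [S, coordMap, stdOp]
  ring

lemma stdOp_cyclide (E : ℝ) : IsCyclideOp (stdOp E) := by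
  rcases lt_trichotomy E (-1) with h | rfl | h
  · exact stdOp_cyclide_of_lt h
  · exact stdOp_cyclide_neg_one
  · rcases lt_trichotomy E 1 with h' | rfl | h'
    · exact stdOp_cyclide_of_abs_lt h h'
    · simpa using stdOp_cyclide_neg stdOp_cyclide_neg_one
    · simpa using stdOp_cyclide_neg (stdOp_cyclide_of_lt (E := -E) (by linarith))

/-! ## Taylor expansions -/

lemma multilinear_diag_eq (k : ℕ) (m : MultilinearMap ℝ (fun _ : Fin k => ℝ × ℝ) ℝ) :
    ∃ c : ℕ → ℝ, ∀ q : ℝ × ℝ,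
      m (fun _ => q) = ∑ i ∈ Finset.range (k + 1), c i * q.1 ^ i * q.2 ^ (k - i) := by
  induction k with
  | zero =>
    refine ⟨fun _ => m 0, fun q => ?_⟩
    simp only [zero_add, Finset.range_one, Finset.sum_singleton, pow_zero, mul_one, Nat.sub_zero]
    exact congrArg m (Subsingleton.elim _ _)
  | succ k ih =>
    obtain ⟨c, hc⟩ := ih (m.curryLeft (1, 0))
    obtain ⟨d, hd⟩ := ih (m.curryLeft (0, 1))
    refine ⟨fun i => (if i = 0 then 0 else c (i - 1)) + (if i = k + 1 then 0 else d i),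
      fun q => ?_⟩
    have h1 : m (fun _ => q) = q.1 * m.curryLeft (1, 0) (fun _ => q)
        + q.2 * m.curryLeft (0, 1) (fun _ => q) := by
      have h2 : m (fun _ => q) = m.curryLeft q (fun _ => q) := by
        rw [MultilinearMap.curryLeft_apply]
        congr 1
        ext i : 1
        refine Fin.cases ?_ (fun j => ?_) i <;> simp
      have h3 : q = q.1 • ((1, 0) : ℝ × ℝ) + q.2 • ((0, 1) : ℝ × ℝ) := by ext <;> simp
      rw [h2]
      conv_lhs => rw [congrArg m.curryLeft h3]
      rw [map_add, map_smul, map_smul]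
      rfl
    rw [h1, hc, hd]
    simp only [add_mul, Finset.sum_add_distrib, Finset.mul_sum]
    congr 1
    · rw [Finset.sum_range_succ' _ (k + 1)]
      simp only [Nat.add_eq_zero_iff, one_ne_zero, and_false, if_false, if_true, zero_mul,
        add_zero, Nat.add_sub_cancel, Nat.add_sub_add_right]
      exact Finset.sum_congr rfl fun i _ => by ring
    · rw [Finset.sum_range_succ _ (k + 1)]
      simp only [if_true, zero_mul, add_zero]
      refine Finset.sum_congr rfl fun i hi => ?_
      have hi' : i < k + 1 := Finset.mem_range.1 hi
      rw [if_neg hi'.ne, Nat.succ_sub (Nat.lt_succ_iff.1 hi'), pow_succ]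
      ring

/-- Integral form of the remainder, with the next derivative bounded near the origin by continuity.
-/
lemma taylor_isBigO {f : ℝ × ℝ → ℝ} (hf : ContDiffAt ℝ ∞ f 0) (n : ℕ) :
    (fun q => f q - ∑ k ∈ Finset.range (n + 1),
      ((k.factorial : ℝ))⁻¹ • iteratedFDeriv ℝ k f 0 (fun _ => q))
      =O[𝓝 0] fun q => ‖q‖ ^ (n + 1) := by
  have hf' : ContDiffAt ℝ (n + 1 : ℕ) f 0 := hf.of_le (by exact_mod_cast le_top)
  have h1 : ∀ᶠ q in 𝓝 (0 : ℝ × ℝ), ContDiffAt ℝ (n + 1 : ℕ) f q := hf'.eventually (by simp)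
  have h2 : ContinuousAt (iteratedFDeriv ℝ (n + 1) f) 0 :=
    hf'.continuousAt_iteratedFDeriv le_rfl
  obtain ⟨C, hC⟩ : ∃ C, C = ‖iteratedFDeriv ℝ (n + 1) f 0‖ + 1 := ⟨_, rfl⟩
  have h3 : ∀ᶠ q in 𝓝 (0 : ℝ × ℝ), ‖iteratedFDeriv ℝ (n + 1) f q‖ < C :=
    h2.norm.eventually (gt_mem_nhds (by rw [hC]; linarith))
  obtain ⟨δ, hδ, hb⟩ := Metric.eventually_nhds_iff_ball.1 (h1.and h3)
  refine IsBigO.of_bound C ?_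
  filter_upwards [Metric.ball_mem_nhds (0 : ℝ × ℝ) hδ] with q hq
  have hmem : ∀ t ∈ Icc (0 : ℝ) 1, (0 : ℝ × ℝ) + t • q ∈ Metric.ball (0 : ℝ × ℝ) δ := by
    intro t ht
    rw [zero_add, mem_ball_zero_iff, norm_smul, Real.norm_of_nonneg ht.1]
    rw [mem_ball_zero_iff] at hq
    nlinarith [norm_nonneg q, ht.2]
  have h4 := map_add_eq_sum_add_integral_iteratedFDeriv (f := f) (x := 0) (y := q) (n := n)
    (fun t ht => by exact_mod_cast (hb _ (hmem t ht)).1)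
  rw [zero_add] at h4
  rw [h4, add_sub_cancel_left, norm_smul]
  have h5 : ‖∫ t in (0 : ℝ)..1, (1 - t) ^ n •
      iteratedFDeriv ℝ (n + 1) f (0 + t • q) (fun _ => q)‖ ≤ C * ‖q‖ ^ (n + 1) * |(1 : ℝ) - 0| := by
    refine intervalIntegral.norm_integral_le_of_norm_le_const fun t ht => ?_
    rw [uIoc_of_le zero_le_one] at ht
    have h6 := (iteratedFDeriv ℝ (n + 1) f (0 + t • q)).le_opNorm (fun _ => q)
    simp only [Finset.prod_const, Finset.card_univ, Fintype.card_fin] at h6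
    have h7 : ‖(1 - t) ^ n‖ ≤ 1 := by
      rw [norm_pow, Real.norm_of_nonneg (by linarith [ht.2])]
      exact pow_le_one₀ (by linarith [ht.2]) (by linarith [ht.1])
    rw [norm_smul]
    calc _ ≤ 1 * (‖iteratedFDeriv ℝ (n + 1) f (0 + t • q)‖ * ‖q‖ ^ (n + 1)) :=
          mul_le_mul h7 h6 (norm_nonneg _) zero_le_one
      _ ≤ C * ‖q‖ ^ (n + 1) := by
          rw [one_mul]
          exact mul_le_mul_of_nonneg_right (hb _ (hmem t ⟨ht.1.le, ht.2⟩)).2.le (by positivity)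
  have h8 : ‖((n.factorial : ℝ))⁻¹‖ ≤ 1 := by
    rw [norm_inv, Real.norm_natCast]
    exact inv_le_one_of_one_le₀ (by exact_mod_cast Nat.one_le_iff_ne_zero.2 n.factorial_ne_zero)
  rw [norm_pow, norm_norm]
  calc _ ≤ 1 * (C * ‖q‖ ^ (n + 1) * |(1 : ℝ) - 0|) :=
        mul_le_mul h8 h5 (norm_nonneg _) zero_le_one
    _ = C * ‖q‖ ^ (n + 1) := by simp

/-- The fourth order Taylor expansion of a smooth function of two variables. -/
lemma exists_taylor_four {f : ℝ × ℝ → ℝ} (hf : ContDiffAt ℝ ∞ f 0) :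
    ∃ c : ℕ → ℕ → ℝ, (fun q : ℝ × ℝ => f q - (c 0 0 + (c 1 0 * q.1 + c 0 1 * q.2)
      + (c 2 0 * q.1 ^ 2 + 2 * c 1 1 * q.1 * q.2 + c 0 2 * q.2 ^ 2) / 2
      + (c 3 0 * q.1 ^ 3 + 3 * c 2 1 * q.1 ^ 2 * q.2 + 3 * c 1 2 * q.1 * q.2 ^ 2
        + c 0 3 * q.2 ^ 3) / 6
      + (c 4 0 * q.1 ^ 4 + 4 * c 3 1 * q.1 ^ 3 * q.2 + 6 * c 2 2 * q.1 ^ 2 * q.2 ^ 2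
        + 4 * c 1 3 * q.1 * q.2 ^ 3 + c 0 4 * q.2 ^ 4) / 24))
      =O[𝓝 0] fun q => ‖q‖ ^ 5 := by
  choose d hd using fun k =>
    multilinear_diag_eq k (iteratedFDeriv ℝ k f 0).toMultilinearMap
  -- Dividing by the binomial coefficient gives `c i j` the normalization of a partial derivative.
  refine ⟨fun i j => d (i + j) i / (Nat.choose (i + j) i : ℝ), ?_⟩
  refine (taylor_isBigO hf 4).congr_left fun q => ?_
  congr 1
  have hd' : ∀ k, iteratedFDeriv ℝ k f 0 (fun _ => q)
      = ∑ i ∈ Finset.range (k + 1), d k i * q.1 ^ i * q.2 ^ (k - i) := fun k => hd k q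
  simp only [hd', Finset.sum_range_succ, Finset.range_zero, Finset.sum_empty]
  simp [Nat.factorial, Nat.choose]
  ring

/-! ## Comparing expansions along curves -/

/-- Writing the remainder along a curve as `s ^ n * ε s` turns asymptotic comparisons into
identities that are polynomial in `s` and `ε s`. -/
lemma exists_remainder {g : ℝ × ℝ → ℝ} {n : ℕ} (hg : g =O[𝓝 0] fun q => ‖q‖ ^ (n + 1))
    {γ : ℝ → ℝ × ℝ} (hγ : Tendsto γ (𝓝[≠] 0) (𝓝 0)) (hγ' : γ =O[𝓝[≠] 0] fun s : ℝ => s) :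
    ∃ ε : ℝ → ℝ, Tendsto ε (𝓝[≠] 0) (𝓝 0) ∧ ∀ᶠ s in 𝓝[≠] 0, g (γ s) = s ^ n * ε s := by
  have h1 : (fun s => g (γ s)) =O[𝓝[≠] 0] fun s : ℝ => s ^ (n + 1) :=
    (hg.comp_tendsto hγ).trans (hγ'.norm_left.pow _)
  have h2 : (fun s => g (γ s)) =o[𝓝[≠] 0] fun s : ℝ => s ^ n := by
    refine h1.trans_isLittleO ?_
    have h3 : (fun s : ℝ => s) =o[𝓝[≠] 0] fun _ => (1 : ℝ) :=
      (isLittleO_one_iff ℝ).2 (tendsto_id.mono_left nhdsWithin_le_nhds)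
    simpa [pow_succ] using (isBigO_refl (fun s : ℝ => s ^ n) _).mul_isLittleO h3
  refine ⟨fun s => g (γ s) / s ^ n, h2.tendsto_div_nhds_zero, ?_⟩
  filter_upwards [self_mem_nhdsWithin] with s hs
  rw [mul_div_cancel₀]
  exact pow_ne_zero n hs

lemma line_tendsto (a b : ℝ) : Tendsto (fun s : ℝ => (s * a, s * b)) (𝓝[≠] 0) (𝓝 0) := by
  have : Continuous fun s : ℝ => (s * a, s * b) := by fun_prop
  refine (this.tendsto' 0 0 (by simp)).mono_left nhdsWithin_le_nhds

lemma line_isBigO (a b : ℝ) : (fun s : ℝ => (s * a, s * b)) =O[𝓝[≠] 0] fun s : ℝ => s := by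
  refine IsBigO.of_bound ‖(a, b)‖ (Eventually.of_forall fun s => ?_)
  have : (s * a, s * b) = s • (a, b) := rfl
  rw [this, norm_smul, mul_comm]

/-- Coefficient extraction: once a power of `s` has been cancelled, the equation makes sense at `s =
0`, and its value there is the next Taylor coefficient. -/
lemma eq_zero_of_eventually {V : Type*} [TopologicalSpace V] {K : ℝ × V → ℝ} (hK : Continuous K)
    {ε : ℝ → V} {e : V} (hε : Tendsto ε (𝓝[≠] 0) (𝓝 e))
    (h : ∀ᶠ s in 𝓝[≠] 0, K (s, ε s) = 0) : K (0, e) = 0 := by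
  have h1 : Tendsto (fun s : ℝ => K (s, ε s)) (𝓝[≠] 0) (𝓝 (K (0, e))) :=
    (hK.tendsto _).comp ((tendsto_id.mono_left nhdsWithin_le_nhds).prodMk_nhds hε)
  exact tendsto_nhds_unique (h1.congr' h) tendsto_const_nhds |>.symm ▸ rfl

/-- Vanishing to all orders of a quadratic section along the lines of a graph. -/
lemma coeff_along_line {c l q2 qn : ℝ} {A B3 q33 L3 : ℝ} {Bn : ℝ} {a b p2 p3 p4 : ℝ}
    {ε ζ : ℝ → ℝ} (hε : Tendsto ε (𝓝[≠] 0) (𝓝 0))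
    (hζ : ∀ s, ζ s = p2 + s * p3 + s ^ 2 * p4 + s ^ 2 * ε s)
    (h : ∀ᶠ s in 𝓝[≠] 0, c + s * l + s ^ 2 * (L3 * ζ s + q2)
      + s ^ 3 * (2 * qn * ζ s + (a ^ 2 + b ^ 2 + s ^ 2 * ζ s ^ 2) * Bn)
      + s ^ 4 * (q33 * ζ s ^ 2 + B3 * (a ^ 2 + b ^ 2 + s ^ 2 * ζ s ^ 2) * ζ s
        + A * (a ^ 2 + b ^ 2 + s ^ 2 * ζ s ^ 2) ^ 2) = 0) :
    c = 0 ∧ l = 0 ∧ L3 * p2 + q2 = 0 ∧ L3 * p3 + 2 * qn * p2 + (a ^ 2 + b ^ 2) * Bn = 0 ∧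
      L3 * p4 + 2 * qn * p3 + q33 * p2 ^ 2 + B3 * (a ^ 2 + b ^ 2) * p2
        + A * (a ^ 2 + b ^ 2) ^ 2 = 0 := by
  simp only [hζ] at h
  have hne : ∀ᶠ s : ℝ in 𝓝[≠] 0, s ≠ 0 := self_mem_nhdsWithin
  let Z : ℝ × ℝ → ℝ := fun v => p2 + v.1 * p3 + v.1 ^ 2 * p4 + v.1 ^ 2 * v.2
  have h0 : c = 0 := by
    have := eq_zero_of_eventually (K := fun v : ℝ × ℝ => c + v.1 * l + v.1 ^ 2 * (L3 * Z v + q2)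
      + v.1 ^ 3 * (2 * qn * Z v + (a ^ 2 + b ^ 2 + v.1 ^ 2 * Z v ^ 2) * Bn)
      + v.1 ^ 4 * (q33 * Z v ^ 2 + B3 * (a ^ 2 + b ^ 2 + v.1 ^ 2 * Z v ^ 2) * Z v
        + A * (a ^ 2 + b ^ 2 + v.1 ^ 2 * Z v ^ 2) ^ 2)) (by fun_prop) hε h
    simpa using this
  subst h0
  have h1 : l = 0 := by
    have := eq_zero_of_eventually (K := fun v : ℝ × ℝ => l + v.1 * (L3 * Z v + q2)
      + v.1 ^ 2 * (2 * qn * Z v + (a ^ 2 + b ^ 2 + v.1 ^ 2 * Z v ^ 2) * Bn)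
      + v.1 ^ 3 * (q33 * Z v ^ 2 + B3 * (a ^ 2 + b ^ 2 + v.1 ^ 2 * Z v ^ 2) * Z v
        + A * (a ^ 2 + b ^ 2 + v.1 ^ 2 * Z v ^ 2) ^ 2)) (by fun_prop) hε (by
      filter_upwards [h, hne] with s hs hs0
      refine (mul_eq_zero.1 ?_).resolve_left hs0
      rw [← hs]; simp only [Z]; ring)
    simpa using this
  subst h1
  have h2 : L3 * p2 + q2 = 0 := by
    have := eq_zero_of_eventually (K := fun v : ℝ × ℝ => (L3 * Z v + q2)
      + v.1 * (2 * qn * Z v + (a ^ 2 + b ^ 2 + v.1 ^ 2 * Z v ^ 2) * Bn)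
      + v.1 ^ 2 * (q33 * Z v ^ 2 + B3 * (a ^ 2 + b ^ 2 + v.1 ^ 2 * Z v ^ 2) * Z v
        + A * (a ^ 2 + b ^ 2 + v.1 ^ 2 * Z v ^ 2) ^ 2)) (by fun_prop) hε (by
      filter_upwards [h, hne] with s hs hs0
      refine (mul_eq_zero.1 ?_).resolve_left (pow_ne_zero 2 hs0)
      rw [← hs]; simp only [Z]; ring)
    simpa [Z] using this
  -- The previous equation removes the leading term of `L3 * Z v + q2`, which makes one more
  -- division by `s` possible.
  have h3 : L3 * p3 + 2 * qn * p2 + (a ^ 2 + b ^ 2) * Bn = 0 := by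
    have := eq_zero_of_eventually (K := fun v : ℝ × ℝ => L3 * (p3 + v.1 * p4 + v.1 * v.2)
      + (2 * qn * Z v + (a ^ 2 + b ^ 2 + v.1 ^ 2 * Z v ^ 2) * Bn)
      + v.1 * (q33 * Z v ^ 2 + B3 * (a ^ 2 + b ^ 2 + v.1 ^ 2 * Z v ^ 2) * Z v
        + A * (a ^ 2 + b ^ 2 + v.1 ^ 2 * Z v ^ 2) ^ 2)) (by fun_prop) hε (by
      filter_upwards [h, hne] with s hs hs0
      refine (mul_eq_zero.1 ?_).resolve_left (pow_ne_zero 3 hs0)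
      rw [← hs]; simp only [Z]; linear_combination (-s ^ 2) * h2)
    simpa [Z, add_assoc] using this
  have h4 : L3 * p4 + 2 * qn * p3 + q33 * p2 ^ 2 + B3 * (a ^ 2 + b ^ 2) * p2
        + A * (a ^ 2 + b ^ 2) ^ 2 = 0 := by
    have := eq_zero_of_eventually (K := fun v : ℝ × ℝ => L3 * (p4 + v.2)
      + (2 * qn * (p3 + v.1 * p4 + v.1 * v.2) + (v.1 * Z v ^ 2) * Bn)
      + (q33 * Z v ^ 2 + B3 * (a ^ 2 + b ^ 2 + v.1 ^ 2 * Z v ^ 2) * Z v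
        + A * (a ^ 2 + b ^ 2 + v.1 ^ 2 * Z v ^ 2) ^ 2)) (by fun_prop) hε (by
      filter_upwards [h, hne] with s hs hs0
      refine (mul_eq_zero.1 ?_).resolve_left (pow_ne_zero 4 hs0)
      rw [← hs]; simp only [Z]; linear_combination (-s ^ 2) * h2 - s ^ 3 * h3)
    simpa [Z, add_assoc] using this
  exact ⟨rfl, rfl, h2, h3, h4⟩

/-! ## Dupin operators in standard position -/

/-- The entries of a self-adjoint operator of the Lorentz space. -/
lemma exists_entries {M : LV →ₗ[ℝ] LV} (hM : ∀ v v', lform (M v) v' = lform v (M v')) :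
    ∃ ww wx wy wz wr xx xy xz xr yy yz yr zz zr rr : ℝ, ∀ v : LV,
      (M v).1 = -2 * (wr * v.1 + xr * v.2.1 0 + yr * v.2.1 1 + zr * v.2.1 2 + rr * v.2.2) ∧
      (M v).2.1 0 = wx * v.1 + xx * v.2.1 0 + xy * v.2.1 1 + xz * v.2.1 2 + xr * v.2.2 ∧
      (M v).2.1 1 = wy * v.1 + xy * v.2.1 0 + yy * v.2.1 1 + yz * v.2.1 2 + yr * v.2.2 ∧
      (M v).2.1 2 = wz * v.1 + xz * v.2.1 0 + yz * v.2.1 1 + zz * v.2.1 2 + zr * v.2.2 ∧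
      (M v).2.2 = -2 * (ww * v.1 + wx * v.2.1 0 + wy * v.2.1 1 + wz * v.2.1 2 + wr * v.2.2) := by
  let e : Fin 5 → LV := ![(1, 0, 0), (0, !₂[1, 0, 0], 0), (0, !₂[0, 1, 0], 0),
    (0, !₂[0, 0, 1], 0), (0, 0, 1)]
  have hs : ∀ i j, lform (M (e i)) (e j) = lform (M (e j)) (e i) := fun i j => by
    rw [hM, lform_comm]
  have hc : ∀ v j, lform (M v) (e j) = v.1 * lform (M (e 0)) (e j)
      + v.2.1 0 * lform (M (e 1)) (e j) + v.2.1 1 * lform (M (e 2)) (e j)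
      + v.2.1 2 * lform (M (e 3)) (e j) + v.2.2 * lform (M (e 4)) (e j) := by
    intro v j
    have hv : v = v.1 • e 0 + v.2.1 0 • e 1 + v.2.1 1 • e 2 + v.2.1 2 • e 3 + v.2.2 • e 4 := by
      rw [LV.ext_iff]; simp [e]
    conv_lhs => rw [hv]
    simp only [map_add, map_smul, lform_add_left, lform_smul_left]
  refine ⟨lform (M (e 0)) (e 0), lform (M (e 0)) (e 1), lform (M (e 0)) (e 2),
    lform (M (e 0)) (e 3), lform (M (e 0)) (e 4), lform (M (e 1)) (e 1), lform (M (e 1)) (e 2),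
    lform (M (e 1)) (e 3), lform (M (e 1)) (e 4), lform (M (e 2)) (e 2), lform (M (e 2)) (e 3),
    lform (M (e 2)) (e 4), lform (M (e 3)) (e 3), lform (M (e 3)) (e 4), lform (M (e 4)) (e 4),
    fun v => ⟨?_, ?_, ?_, ?_, ?_⟩⟩
  -- The vectors `e 0` and `e 4` are isotropic with product `-1/2`; hence the factors `-2` and the
  -- exchange of these two indices.
  · have h1 : (M v).1 = -2 * lform (M v) (e 4) := by simp [e, lform]; ring
    rw [h1, hc]; ring
  · have h1 : (M v).2.1 0 = lform (M v) (e 1) := by simp [e, lform, inner_eq3]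
    rw [h1, hc, hs 2 1, hs 3 1, hs 4 1]; ring
  · have h1 : (M v).2.1 1 = lform (M v) (e 2) := by simp [e, lform, inner_eq3]
    rw [h1, hc, hs 3 2, hs 4 2]; ring
  · have h1 : (M v).2.1 2 = lform (M v) (e 3) := by simp [e, lform, inner_eq3]
    rw [h1, hc, hs 4 3]; ring
  · have h1 : (M v).2.2 = -2 * lform (M v) (e 0) := by simp [e, lform]; ring
    rw [h1, hc, hs 1 0, hs 2 0, hs 3 0, hs 4 0]; ring

lemma HasEigenplane.smul_add {M : LV →ₗ[ℝ] LV} {a : ℝ} (h : HasEigenplane M a) (s t : ℝ) :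
    HasEigenplane (s • M + t • LinearMap.id) (s * a + t) := by
  obtain ⟨u, v, hu, hv, hi⟩ := h
  exact ⟨u, v, by simp [hu, add_smul, mul_smul], by simp [hv, add_smul, mul_smul], hi⟩

lemma IsDupinOp.smul_add {M : LV →ₗ[ℝ] LV} (h : IsDupinOp M) {s : ℝ} (hs : s ≠ 0) (t : ℝ) :
    IsDupinOp (s • M + t • LinearMap.id) := by
  obtain ⟨h1, a, b, hab, ha, hb⟩ := h
  refine ⟨fun v v' => ?_, _, _, fun hh => hab ?_, ha.smul_add s t, hb.smul_add s t⟩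
  · simp only [LinearMap.add_apply, LinearMap.smul_apply, LinearMap.id_apply, lform_add_left,
      lform_add_right, lform_smul_left, lform_smul_right, h1]
  · exact mul_left_cancel₀ hs (by linarith)

/-- The coordinate functionals of `LV`. -/
def coordX (i : Fin 3) : LV →ₗ[ℝ] ℝ where
  toFun v := v.2.1 i
  map_add' _ _ := by simp
  map_smul' _ _ := by simp

def coordR : LV →ₗ[ℝ] ℝ where
  toFun v := v.2.2
  map_add' _ _ := by simp
  map_smul' _ _ := by simp

/-- A Dupin operator whose quadric osculates the standard one to second order is standard. -/
lemma IsDupinOp.eq_stdOp {M : LV →ₗ[ℝ] LV} (hM : IsDupinOp M) {τ₁ τ₂ E β A : ℝ}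
    (h : ∀ v : LV, (M v).1 = -(τ₁ * v.2.1 0 + τ₂ * v.2.1 1 + β * v.2.1 2) - 2 * A * v.2.2 ∧
      (M v).2.1 0 = v.2.1 0 + τ₁ * v.2.1 2 + τ₁ / 2 * v.2.2 ∧
      (M v).2.1 1 = -v.2.1 1 - τ₂ * v.2.1 2 + τ₂ / 2 * v.2.2 ∧
      (M v).2.1 2 = -v.1 + τ₁ * v.2.1 0 - τ₂ * v.2.1 1 + E * v.2.1 2 + β / 2 * v.2.2 ∧
      (M v).2.2 = 2 * v.2.1 2) : M = stdOp E := by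
  have eig : ∀ (a : ℝ) (v : LV), M v = a • v →
      -(τ₁ * v.2.1 0 + τ₂ * v.2.1 1 + β * v.2.1 2) - 2 * A * v.2.2 = a * v.1 ∧
      v.2.1 0 + τ₁ * v.2.1 2 + τ₁ / 2 * v.2.2 = a * v.2.1 0 ∧
      -v.2.1 1 - τ₂ * v.2.1 2 + τ₂ / 2 * v.2.2 = a * v.2.1 1 ∧
      -v.1 + τ₁ * v.2.1 0 - τ₂ * v.2.1 1 + E * v.2.1 2 + β / 2 * v.2.2 = a * v.2.1 2 ∧
      2 * v.2.1 2 = a * v.2.2 := by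
    intro a v hv
    obtain ⟨h1, h2, h3, h4, h5⟩ := h v
    rw [LV.ext_iff] at hv
    simp only [Prod.smul_fst, Prod.smul_snd, PiLp.smul_apply, smul_eq_mul] at hv
    exact ⟨h1 ▸ hv.1, h2 ▸ hv.2.1, h3 ▸ hv.2.2.1, h4 ▸ hv.2.2.2.1, h5 ▸ hv.2.2.2.2⟩
  have zero : ∀ (a : ℝ) (v : LV), M v = a • v → v.2.1 0 = 0 → v.2.1 1 = 0 → v.2.2 = 0 →
      v = 0 := by
    intro a v hv hx hy hr
    obtain ⟨-, -, -, h4, h5⟩ := eig a v hv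
    rw [hr, mul_zero] at h5
    have hz : v.2.1 2 = 0 := by linarith
    rw [hx, hy, hz, hr] at h4
    rw [LV.ext_iff]
    simp [hx, hy, hr, hz]
    linarith
  -- the double eigenvalues are `1` and `-1`
  have pm : ∀ a, HasEigenplane M a → a = 1 ∨ a = -1 := by
    intro a ha
    by_contra! hcon
    -- On `ρ = 0` the last eigenvalue equation gives `z = 0`. If `a ≠ ±1`, then `x` and `y` vanish
    -- as well, and so does the vector.
    obtain ⟨v, hv0, hv, hr⟩ := ha.exists_mem_ker coordR
    have hr : v.2.2 = 0 := hr
    obtain ⟨-, h2, h3, -, h5⟩ := eig a v hv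
    rw [hr, mul_zero] at h5
    have hz : v.2.1 2 = 0 := by linarith
    rw [hz, hr] at h2 h3
    refine hv0 (zero a v hv ?_ ?_ hr)
    · have : (1 - a) * v.2.1 0 = 0 := by linarith
      exact (mul_eq_zero.1 this).resolve_left (sub_ne_zero.2 (Ne.symm hcon.1))
    · have : (1 + a) * v.2.1 1 = 0 := by linarith
      exact (mul_eq_zero.1 this).resolve_left fun h => hcon.2 (by linarith)
  have key : HasEigenplane M 1 ∧ HasEigenplane M (-1) := by
    obtain ⟨-, a, b, hab, ha, hb⟩ := hM
    rcases pm a ha with rfl | rfl <;> rcases pm b hb with rfl | rfl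
    · exact absurd rfl hab
    · exact ⟨ha, hb⟩
    · exact ⟨hb, ha⟩
    · exact absurd rfl hab
  -- A vector of the eigenplane of `1` with `x = 0` also has `y = 0`, hence `ρ ≠ 0`, and its `x`
  -- equation becomes `τ₁ ρ = 0`. The eigenvalue `-1` gives `τ₂ = 0` in the same way.
  have pos : τ₁ = 0 ∧ ∃ v : LV, M v = (1 : ℝ) • v ∧ v.2.2 = 2 ∧ v.2.1 2 = 1 ∧ v.2.1 1 = 0 := by
    obtain ⟨v, hv0, hv, hx⟩ := key.1.exists_mem_ker (coordX 0)
    have hx : v.2.1 0 = 0 := hx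
    obtain ⟨h1, h2, h3, h4, h5⟩ := eig 1 v hv
    have hy : v.2.1 1 = 0 := by linear_combination -1 / 2 * h3 - τ₂ / 4 * h5
    have hr : v.2.2 ≠ 0 := fun hr => hv0 (zero 1 v hv hx hy hr)
    refine ⟨?_, (2 / v.2.2) • v, by rw [map_smul, hv, smul_comm], ?_, ?_, ?_⟩
    · have : τ₁ * v.2.2 = 0 := by linear_combination h2 - τ₁ / 2 * h5
      exact (mul_eq_zero.1 this).resolve_right hr
    · simp [hr]
    · simp; field_simp; linarith
    · simp [hy]
  have neg : τ₂ = 0 ∧ ∃ v : LV, M v = (-1 : ℝ) • v ∧ v.2.2 = 2 ∧ v.2.1 2 = -1 ∧ v.2.1 0 = 0 := by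
    obtain ⟨v, hv0, hv, hy⟩ := key.2.exists_mem_ker (coordX 1)
    have hy : v.2.1 1 = 0 := hy
    obtain ⟨h1, h2, h3, h4, h5⟩ := eig (-1) v hv
    have hx : v.2.1 0 = 0 := by linear_combination 1 / 2 * h2 - τ₁ / 4 * h5
    have hr : v.2.2 ≠ 0 := fun hr => hv0 (zero (-1) v hv hx hy hr)
    refine ⟨?_, (2 / v.2.2) • v, by rw [map_smul, hv, smul_comm], ?_, ?_, ?_⟩
    · have : τ₂ * v.2.2 = 0 := by linear_combination h3 + τ₂ / 2 * h5
      exact (mul_eq_zero.1 this).resolve_right hr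
    · simp [hr]
    · simp; field_simp; linarith
    · simp [hx]
  obtain ⟨hτ₁, u, hu, hu1, hu2, -⟩ := pos
  obtain ⟨hτ₂, v, hv, hv1, hv2, -⟩ := neg
  -- Eliminating the first coordinates of `u` and `v` leaves two linear equations in `β` and `A`.
  obtain ⟨a1, -, -, a4, -⟩ := eig 1 u hu
  obtain ⟨b1, -, -, b4, -⟩ := eig (-1) v hv
  rw [hu1, hu2, hτ₁, hτ₂] at a1 a4
  rw [hv1, hv2, hτ₁, hτ₂] at b1 b4
  have hβ : β = 1 / 2 := by linarith
  have hA : A = -E / 4 := by linarith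
  refine LinearMap.ext fun w => ?_
  obtain ⟨h1, h2, h3, h4, h5⟩ := h w
  rw [LV.ext_iff, h1, h2, h3, h4, h5, hτ₁, hτ₂, hβ, hA]
  simp [stdOp, coordMap]
  constructor <;> ring

lemma lift_apply (x y z : ℝ) : lift !₂[x, y, z] = (1, !₂[x, y, z], x ^ 2 + y ^ 2 + z ^ 2) := by
  simp [lift, norm_sq3]

/-- A Dupin operator whose quadric contains the graph of a function with a standard expansion. -/
lemma IsDupinOp.exists_eq_stdOp {M : LV →ₗ[ℝ] LV} (hM : IsDupinOp M) {f : ℝ × ℝ → ℝ} {Ψ : ℝ}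
    (hf : HasStandardExpansion f Ψ)
    (h : ∀ᶠ q in 𝓝 (0 : ℝ × ℝ),
      lform (M (lift !₂[q.1, q.2, f q])) (lift !₂[q.1, q.2, f q]) = 0) :
    ∃ a b : ℝ, a ≠ 0 ∧ M = a • stdOp (-Ψ / 2) + b • LinearMap.id := by
  obtain ⟨ww, wx, wy, wz, wr, xx, xy, xz, xr, yy, yz, yr, zz, zr, rr, hent⟩ :=
    exists_entries hM.1
  obtain ⟨t₁, t₂, a4, b4, c4, d4, hO⟩ := hf
  have along : ∀ a b : ℝ, ww = 0 ∧ 2 * (wx * a + wy * b) = 0 ∧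
      2 * wz * ((a ^ 2 - b ^ 2) / 2) + ((xx + 2 * wr) * a ^ 2 + 2 * xy * a * b
        + (yy + 2 * wr) * b ^ 2) = 0 ∧
      2 * wz * ((t₁ * a ^ 3 + t₂ * b ^ 3) / 6) + 2 * (xz * a + yz * b) * ((a ^ 2 - b ^ 2) / 2)
        + (a ^ 2 + b ^ 2) * (2 * (xr * a + yr * b)) = 0 ∧
      2 * wz * ((a4 * a ^ 4 + 4 * b4 * a ^ 3 * b + 6 * Ψ * a ^ 2 * b ^ 2 + 4 * c4 * a * b ^ 3
        + d4 * b ^ 4) / 24) + 2 * (xz * a + yz * b) * ((t₁ * a ^ 3 + t₂ * b ^ 3) / 6)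
        + (zz + 2 * wr) * ((a ^ 2 - b ^ 2) / 2) ^ 2
        + 2 * zr * (a ^ 2 + b ^ 2) * ((a ^ 2 - b ^ 2) / 2) + rr * (a ^ 2 + b ^ 2) ^ 2 = 0 := by
    intro a b
    obtain ⟨ε, hε, hε'⟩ := exists_remainder (n := 4) hO (line_tendsto a b) (line_isBigO a b)
    refine coeff_along_line (p4 := (a4 * a ^ 4 + 4 * b4 * a ^ 3 * b + 6 * Ψ * a ^ 2 * b ^ 2
      + 4 * c4 * a * b ^ 3 + d4 * b ^ 4) / 24) hε (fun s => rfl) ?_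
    filter_upwards [hε', (line_tendsto a b).eventually h] with s hs hs'
    have hfs : f (s * a, s * b) = s ^ 2 * ((a ^ 2 - b ^ 2) / 2
        + s * ((t₁ * a ^ 3 + t₂ * b ^ 3) / 6)
        + s ^ 2 * ((a4 * a ^ 4 + 4 * b4 * a ^ 3 * b + 6 * Ψ * a ^ 2 * b ^ 2
          + 4 * c4 * a * b ^ 3 + d4 * b ^ 4) / 24) + s ^ 2 * ε s) := by
      linear_combination hs
    generalize (a ^ 2 - b ^ 2) / 2 + s * ((t₁ * a ^ 3 + t₂ * b ^ 3) / 6)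
        + s ^ 2 * ((a4 * a ^ 4 + 4 * b4 * a ^ 3 * b + 6 * Ψ * a ^ 2 * b ^ 2
          + 4 * c4 * a * b ^ 3 + d4 * b ^ 4) / 24) + s ^ 2 * ε s = ζ at hfs ⊢
    rw [hfs, lift_apply] at hs'
    obtain ⟨h1, h2, h3, h4, h5⟩ := hent (1, !₂[s * a, s * b, s ^ 2 * ζ],
      (s * a) ^ 2 + (s * b) ^ 2 + (s ^ 2 * ζ) ^ 2)
    rw [lform, inner_eq3, h1, h2, h3, h4, h5] at hs'
    simp only [Matrix.cons_val_zero, Matrix.cons_val_one, Matrix.cons_val] at hs'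
    rw [← hs']
    ring
  obtain ⟨hww, p1, p2, p3, p4⟩ := along 1 0
  obtain ⟨-, q1, q2, q3, q4⟩ := along 0 1
  obtain ⟨-, -, r2, r3, r4⟩ := along 1 1
  obtain ⟨-, -, -, s3, s4⟩ := along 1 (-1)
  norm_num at p1 p2 p3 p4 q1 q2 q3 q4 r2 r3 r4 s3 s4
  have hxx : xx = -wz - 2 * wr := by linarith
  have hyy : yy = wz - 2 * wr := by linarith
  have hxy : xy = 0 := by linarith
  have hxz : xz = 2 * xr := by linarith
  have hyz : yz = -2 * yr := by linarith
  -- The `x² y²` coefficient of order four, isolated by combining the diagonals with the axes.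
  have hΨ : 2 * wz * Ψ / 2 - (zz + 2 * wr) + 4 * rr = 0 := by linarith
  -- If the term linear in `z` vanished, all the equations together would make `M` scalar, against
  -- its two distinct eigenvalues.
  have hwz : wz ≠ 0 := by
    intro h0
    rw [h0] at hxx hyy p3 p4 q3 q4 r3 r4 s3 s4
    have e1 : xr = 0 := by linarith
    have e2 : yr = 0 := by linarith
    rw [e1, mul_zero] at hxz
    rw [e2, mul_zero] at hyz
    simp only [hxz, hyz] at p4 q4 r4 s4
    have e3 : rr = 0 := by linarith
    have e4 : zr = 0 := by linarith
    have e5 : zz = -2 * wr := by linarith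
    obtain ⟨-, a, b, hab, ha, hb⟩ := hM
    have hid : ∀ v, M v = (-2 * wr) • v := by
      intro v
      obtain ⟨h1, h2, h3, h4, h5⟩ := hent v
      rw [LV.ext_iff, h1, h2, h3, h4, h5, hww, p1, q1, hxx, hyy, hxy, hxz, hyz, h0, e1, e2, e3,
        e4, e5]
      simp
      constructor <;> ring
    have huniq : ∀ a, HasEigenplane M a → a = -2 * wr := by
      intro a ha
      obtain ⟨v, hv0, hv, -⟩ := ha.exists_mem_ker 0
      rw [hid] at hv
      exact (smul_left_injective ℝ hv0 hv).symm
    exact hab ((huniq a ha).trans (huniq b hb).symm)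
  -- The value of `E` is simply `-(zz + 2 * wr) / wz`, written as `-Ψ / 2` plus an excess that `hΨ`
  -- and the relation `A = -E / 4` contained in `hN` will show to be zero.
  have hN := (hM.smul_add (s := -wz⁻¹) (neg_ne_zero.2 (inv_ne_zero hwz)) (-2 * wr / wz)).eq_stdOp
    (τ₁ := -2 * xr / wz) (τ₂ := -2 * yr / wz) (E := -Ψ / 2 + (Ψ / 2 - (zz + 2 * wr) / wz))
    (β := -2 * zr / wz) (A := -rr / wz) fun v => by
      obtain ⟨h1, h2, h3, h4, h5⟩ := hent v
      simp only [LinearMap.add_apply, LinearMap.smul_apply, LinearMap.id_apply, Prod.fst_add,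
        Prod.snd_add, Prod.smul_fst, Prod.smul_snd, PiLp.add_apply, PiLp.smul_apply, smul_eq_mul,
        h1, h2, h3, h4, h5, hww, p1, q1, hxx, hyy, hxy, hxz, hyz]
      refine ⟨?_, ?_, ?_, ?_, ?_⟩ <;> field_simp <;> ring
  -- comparison of the coefficients of `x² y²`
  have hE : -Ψ / 2 + (Ψ / 2 - (zz + 2 * wr) / wz) = -Ψ / 2 := by
    have h1 := congrArg (fun L : LV →ₗ[ℝ] LV => (L liftInf).1) hN
    simp only [LinearMap.add_apply, LinearMap.smul_apply, LinearMap.id_apply, Prod.fst_add,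
      Prod.smul_fst, smul_eq_mul, (hent liftInf).1] at h1
    simp [liftInf, stdOp, coordMap] at h1
    field_simp at h1 ⊢
    linarith
  rw [hE] at hN
  refine ⟨-wz, -2 * wr, neg_ne_zero.2 hwz, ?_⟩
  rw [← hN]
  refine LinearMap.ext fun v => ?_
  simp only [LinearMap.add_apply, LinearMap.smul_apply, LinearMap.id_apply]
  match_scalars
  · field_simp
  · field_simp
    ring

/-! ## The standard cyclides as graphs -/

lemma lform_stdOp_lift (E : ℝ) (x : E3) : lform (stdOp E (lift x)) (lift x) =
    x 0 ^ 2 - x 1 ^ 2 + E * x 2 ^ 2 + x 2 * (x 0 ^ 2 + x 1 ^ 2 + x 2 ^ 2) / 2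
      - E * (x 0 ^ 2 + x 1 ^ 2 + x 2 ^ 2) ^ 2 / 4 - 2 * x 2 := by
  simp [lform, stdOp, coordMap, lift, inner_eq3, norm_sq3]; ring

/-- Bootstrapping from mere continuity at the origin: the equation gives `f = O(‖q‖²)`, then `f -
(x² - y²) / 2 = O(‖q‖⁴)`. Substituting this once more leaves the quartic `(x⁴ - y⁴) / 8 - E x² y² /
2`. -/
lemma standardExpansion_of_eq {f : ℝ × ℝ → ℝ} {E : ℝ} (h0 : Tendsto f (𝓝 0) (𝓝 0))
    (h : ∀ᶠ q in 𝓝 (0 : ℝ × ℝ), q.1 ^ 2 - q.2 ^ 2 + E * f q ^ 2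
      + f q * (q.1 ^ 2 + q.2 ^ 2 + f q ^ 2) / 2 - E * (q.1 ^ 2 + q.2 ^ 2 + f q ^ 2) ^ 2 / 4
      - 2 * f q = 0) :
    (fun q : ℝ × ℝ => f q - ((q.1 ^ 2 - q.2 ^ 2) / 2
        + (0 * q.1 ^ 3 + 0 * q.2 ^ 3) / 6 + (3 * q.1 ^ 4 + 4 * 0 * q.1 ^ 3 * q.2
          + 6 * (-2 * E) * q.1 ^ 2 * q.2 ^ 2 + 4 * 0 * q.1 * q.2 ^ 3 + -3 * q.2 ^ 4) / 24))
        =O[𝓝 0] fun q => ‖q‖ ^ 5 := by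
  let N : ℝ × ℝ → ℝ := fun q => ‖q‖
  have hN0 : Tendsto N (𝓝 0) (𝓝 0) := by
    have : Continuous N := continuous_norm
    exact this.tendsto' 0 0 (by simp [N])
  have hx : (fun q : ℝ × ℝ => q.1) =O[𝓝 0] N := isBigO_of_le _ fun q => by
    rw [norm_norm]; exact norm_fst_le q
  have hy : (fun q : ℝ × ℝ => q.2) =O[𝓝 0] N := isBigO_of_le _ fun q => by
    rw [norm_norm]; exact norm_snd_le q
  have hmono : ∀ m n : ℕ, m ≤ n → (fun q => N q ^ n) =O[𝓝 0] fun q => N q ^ m := by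
    intro m n hmn
    obtain ⟨k, rfl⟩ := Nat.exists_eq_add_of_le hmn
    have h1 : (fun q => N q ^ k) =O[𝓝 0] fun _ => (1 : ℝ) := (hN0.pow k).isBigO_one ℝ
    simpa [pow_add] using (isBigO_refl (fun q => N q ^ m) (𝓝 0)).mul h1
  have hx2 := hx.pow 2
  have hy2 := hy.pow 2
  have hs := hx2.add hy2
  have hd := hx2.sub hy2
  have hs4 : (fun q : ℝ × ℝ => (q.1 ^ 2 + q.2 ^ 2) ^ 2) =O[𝓝 0] fun q => N q ^ 2 :=
    (hs.pow 2).trans ((hmono 2 4 (by norm_num)).congr_left fun q => by ring)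
  -- This is the factor multiplying `f` when the equation is solved for `x² - y² - E (x² + y²)² /
  -- 4`.
  have ht : Tendsto (fun q : ℝ × ℝ => 2 - E * f q - (q.1 ^ 2 + q.2 ^ 2 + f q ^ 2) / 2
      + E / 4 * (2 * (q.1 ^ 2 + q.2 ^ 2) * f q + f q ^ 3)) (𝓝 0) (𝓝 2) := by
    have hK : Continuous fun v : (ℝ × ℝ) × ℝ => 2 - E * v.2
        - (v.1.1 ^ 2 + v.1.2 ^ 2 + v.2 ^ 2) / 2
        + E / 4 * (2 * (v.1.1 ^ 2 + v.1.2 ^ 2) * v.2 + v.2 ^ 3) := by fun_prop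
    exact (hK.tendsto' (0, 0) 2 (by simp)).comp (tendsto_id.prodMk_nhds h0)
  -- the function is quadratically small
  have hf2 : f =O[𝓝 0] fun q => N q ^ 2 := by
    have h1 : (fun q : ℝ × ℝ => q.1 ^ 2 - q.2 ^ 2 - E / 4 * (q.1 ^ 2 + q.2 ^ 2) ^ 2)
        =O[𝓝 0] fun q => N q ^ 2 := hd.sub (hs4.const_mul_left _)
    have h2 := (ht.inv₀ two_ne_zero).isBigO_one ℝ
    refine (h2.mul h1).congr' ?_ (Eventually.of_forall fun q => one_mul _)
    filter_upwards [h, ht.eventually_ne two_ne_zero] with q hq hq0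
    rw [inv_mul_eq_iff_eq_mul₀ hq0]
    linear_combination hq
  have hf4 : (fun q => f q ^ 2) =O[𝓝 0] fun q => N q ^ 4 :=
    (hf2.pow 2).congr_right fun q => by ring
  have hfd : (fun q => f q + (q.1 ^ 2 - q.2 ^ 2) / 2) =O[𝓝 0] fun q => N q ^ 2 := by
    refine hf2.add ((hd.const_mul_left (1 / 2)).congr_left fun q => by ring)
  have hss : (fun q : ℝ × ℝ => 2 * (q.1 ^ 2 + q.2 ^ 2) + f q ^ 2) =O[𝓝 0] fun q => N q ^ 2 :=
    (hs.const_mul_left 2).add (hf4.trans (hmono 2 4 (by norm_num)))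
  have he : (fun q => f q - (q.1 ^ 2 - q.2 ^ 2) / 2) =O[𝓝 0] fun q => N q ^ 4 := by
    have h1 : (fun q => f q * (q.1 ^ 2 + q.2 ^ 2)) =O[𝓝 0] fun q => N q ^ 4 :=
      (hf2.mul hs).congr_right fun q => by ring
    have h2 : (fun q => f q ^ 3) =O[𝓝 0] fun q => N q ^ 4 :=
      ((hf2.mul hf4).congr (fun q => by ring) fun q => by ring).trans (hmono 4 6 (by norm_num))
    have h3 : (fun q : ℝ × ℝ => (q.1 ^ 2 + q.2 ^ 2) ^ 2) =O[𝓝 0] fun q => N q ^ 4 :=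
      (hs.pow 2).congr_right fun q => by ring
    have h4 : (fun q => f q ^ 2 * (2 * (q.1 ^ 2 + q.2 ^ 2) + f q ^ 2)) =O[𝓝 0]
        fun q => N q ^ 4 :=
      ((hf4.mul hss).congr_right fun q => by ring).trans (hmono 4 6 (by norm_num))
    refine ((((hf4.const_mul_left (E / 2)).add (h1.const_mul_left (1 / 4))).add
      (h2.const_mul_left (1 / 4))).sub ((h3.add h4).const_mul_left (E / 8))).congr' ?_
      EventuallyEq.rfl
    filter_upwards [h] with q hq
    linear_combination hq / 2
  have h6 : (fun q => N q ^ 6) =O[𝓝 0] fun q => N q ^ 5 := hmono 5 6 (by norm_num)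
  have g1 : (fun q => (f q - (q.1 ^ 2 - q.2 ^ 2) / 2) * (f q + (q.1 ^ 2 - q.2 ^ 2) / 2))
      =O[𝓝 0] fun q => N q ^ 5 := ((he.mul hfd).congr_right fun q => by ring).trans h6
  have g2 : (fun q => (f q - (q.1 ^ 2 - q.2 ^ 2) / 2) * (q.1 ^ 2 + q.2 ^ 2))
      =O[𝓝 0] fun q => N q ^ 5 := ((he.mul hs).congr_right fun q => by ring).trans h6
  have g3 : (fun q => f q ^ 3) =O[𝓝 0] fun q => N q ^ 5 :=
    ((hf2.mul hf4).congr (fun q => by ring) fun q => by ring).trans h6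
  have g4 : (fun q => f q ^ 2 * (2 * (q.1 ^ 2 + q.2 ^ 2) + f q ^ 2)) =O[𝓝 0] fun q => N q ^ 5 :=
    ((hf4.mul hss).congr_right fun q => by ring).trans h6
  refine ((((g1.const_mul_left (E / 2)).add (g2.const_mul_left (1 / 4))).add
    (g3.const_mul_left (1 / 4))).sub (g4.const_mul_left (E / 8))).congr' ?_ EventuallyEq.rfl
  filter_upwards [h] with q hq
  linear_combination hq / 2

lemma isInvertible_of_apply_one {L : ℝ →L[ℝ] ℝ} (h : L 1 ≠ 0) : L.IsInvertible := by
  refine ⟨ContinuousLinearEquiv.unitsEquivAut ℝ (Units.mk0 _ h), ?_⟩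
  ext
  simp

/-- Near the origin the standard cyclide is the graph of a function with a standard expansion. -/
lemma exists_graph_stdOp (E : ℝ) : ∃ f : ℝ × ℝ → ℝ,
    ((fun q : ℝ × ℝ => f q - ((q.1 ^ 2 - q.2 ^ 2) / 2
        + (0 * q.1 ^ 3 + 0 * q.2 ^ 3) / 6 + (3 * q.1 ^ 4 + 4 * 0 * q.1 ^ 3 * q.2
          + 6 * (-2 * E) * q.1 ^ 2 * q.2 ^ 2 + 4 * 0 * q.1 * q.2 ^ 3 + -3 * q.2 ^ 4) / 24))
        =O[𝓝 0] fun q => ‖q‖ ^ 5) ∧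
    IsGraphNearOrigin (cyc (stdOp E)) f := by
  let F : (ℝ × ℝ) × ℝ → ℝ := fun v => v.1.1 ^ 2 - v.1.2 ^ 2 + E * v.2 ^ 2
    + v.2 * (v.1.1 ^ 2 + v.1.2 ^ 2 + v.2 ^ 2) / 2 - E * (v.1.1 ^ 2 + v.1.2 ^ 2 + v.2 ^ 2) ^ 2 / 4
    - 2 * v.2
  have hF : ContDiff ℝ ∞ F := by fun_prop
  have hF0 : F 0 = 0 := by simp [F]
  have hinv : (fderiv ℝ F 0 ∘L .inr ℝ (ℝ × ℝ) ℝ).IsInvertible := by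
    apply isInvertible_of_apply_one
    have h1 : HasDerivAt (fun z : ℝ => F (0, z)) (fderiv ℝ F 0 (0, 1)) 0 := by
      have h2 : HasDerivAt (fun z : ℝ => ((0 : ℝ × ℝ), z)) (0, 1) 0 :=
        (hasDerivAt_const _ _).prodMk (hasDerivAt_id _)
      exact ((hF.differentiable (by simp)).differentiableAt.hasFDerivAt
        (x := ((0 : ℝ × ℝ), (0 : ℝ)))).comp_hasDerivAt (0 : ℝ) h2
    have h3 : HasDerivAt (fun z : ℝ => F (0, z)) (-2) 0 := by
      have h4 : (fun z : ℝ => F (0, z))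
          = fun z => E * z ^ 2 + z ^ 3 / 2 - E / 4 * z ^ 4 - 2 * z := by
        funext z; simp [F]; ring
      rw [h4]
      have := (((((hasDerivAt_id (0 : ℝ)).pow 2).const_mul E).add
        (((hasDerivAt_id (0 : ℝ)).pow 3).div_const 2)).sub
        (((hasDerivAt_id (0 : ℝ)).pow 4).const_mul (E / 4))).sub
        ((hasDerivAt_id (0 : ℝ)).const_mul 2)
      refine (show HasDerivAt (fun z : ℝ => E * z ^ 2 + z ^ 3 / 2 - E / 4 * z ^ 4 - 2 * z) _ 0
        from this).congr_deriv ?_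
      simp
    have h5 := h1.unique h3
    simp only [ContinuousLinearMap.comp_apply, ContinuousLinearMap.inr_apply]
    rw [h5]; norm_num
  have hn : (∞ : WithTop ℕ∞) ≠ 0 := by simp
  have e1 := hF.contDiffAt.eventually_apply_implicitFunction hn hinv
  have e2 := hF.contDiffAt.eventually_apply_eq_iff_implicitFunction hn hinv
  have e3 := (hF.contDiffAt.contDiffAt_implicitFunction hn hinv).continuousAt.tendsto
  rw [hF.contDiffAt.implicitFunction_apply_self hn hinv] at e3
  generalize hF.contDiffAt.implicitFunction hn hinv = f at e1 e2 e3
  rw [hF0] at e1 e2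
  refine ⟨f, standardExpansion_of_eq e3 e1, ?_⟩
  have hc : Tendsto (fun x : E3 => (((x 0, x 1), x 2) : (ℝ × ℝ) × ℝ)) (𝓝 0) (𝓝 0) := by
    have : Continuous fun x : E3 => (((x 0, x 1), x 2) : (ℝ × ℝ) × ℝ) := by fun_prop
    exact this.tendsto' 0 0 (by simp)
  -- Regularity near the origin: at an eigenvector the first coordinate gives the eigenvalue, and
  -- inserting it into the `z` coordinate would make this expression zero, while its value at the
  -- origin is `-1`.
  have hreg : ∀ᶠ x : E3 in 𝓝 0, E * x 2 + (x 0 ^ 2 + x 1 ^ 2 + x 2 ^ 2) / 4 - 1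
      - (-x 2 / 2 + E * (x 0 ^ 2 + x 1 ^ 2 + x 2 ^ 2) / 2) * x 2 ≠ 0 := by
    have hcont : Continuous fun x : E3 => E * x 2 + (x 0 ^ 2 + x 1 ^ 2 + x 2 ^ 2) / 4 - 1
      - (-x 2 / 2 + E * (x 0 ^ 2 + x 1 ^ 2 + x 2 ^ 2) / 2) * x 2 := by fun_prop
    exact (hcont.tendsto' 0 (-1) (by simp)).eventually_ne (by norm_num)
  filter_upwards [hc.eventually e2, hreg] with x hx hxr
  simp only [cyc, OnCyc, mem_ofPred_eq, lform_stdOp_lift]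
  rw [eq_comm (a := x 2), ← hx]
  refine and_iff_left fun a ha => hxr ?_
  rw [LV.ext_iff] at ha
  simp [stdOp, coordMap, lift, norm_sq3] at ha
  obtain ⟨h1, -, -, h4, -⟩ := ha
  rw [h1, ← h4]; ring

/-! ## Möbius transformations with a prescribed similar frame -/

/-- The isometry `x ↦ A (x - q)`. -/
def frameMap (q : E3) (A : E3 ≃ₗᵢ[ℝ] E3) : E3 ≃ᵃⁱ[ℝ] E3 :=
  (AffineIsometryEquiv.vaddConst ℝ q).symm.trans A.toAffineIsometryEquiv

lemma frameMap_apply (q : E3) (A : E3 ≃ₗᵢ[ℝ] E3) (x : E3) : frameMap q A x = A (x - q) := rfl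

/-- The linear map inducing `y ↦ (l y + |y|² m) / (1 + 2 ⟨m, y⟩ / l + |m|² |y|² / l²)`. -/
def normLift (l : ℝ) (m : E3) : LV →ₗ[ℝ] LV where
  toFun v := (v.1 + 2 / l * inner ℝ v.2.1 m + ‖m‖ ^ 2 / l ^ 2 * v.2.2, l • v.2.1 + v.2.2 • m,
    l ^ 2 * v.2.2)
  map_add' u v := by
    refine Prod.ext ?_ (Prod.ext ?_ ?_)
    · simp only [Prod.fst_add, Prod.snd_add, inner_add_left]; ring
    · simp only [Prod.fst_add, Prod.snd_add]; module
    · simp only [Prod.snd_add]; ring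
  map_smul' a v := by
    refine Prod.ext ?_ (Prod.ext ?_ ?_)
    · simp only [Prod.smul_fst, Prod.smul_snd, real_inner_smul_left, smul_eq_mul,
        RingHom.id_apply]; ring
    · simp only [Prod.smul_fst, Prod.smul_snd, smul_eq_mul, RingHom.id_apply]; module
    · simp only [Prod.smul_snd, smul_eq_mul, RingHom.id_apply]; ring

lemma normLift_conformal {l : ℝ} (hl : 0 < l) (m : E3) : IsConformal (l ^ 2) (normLift l m) := by
  refine ⟨by positivity, fun v v' => ?_⟩
  simp only [lform, normLift, LinearMap.coe_mk, AddHom.coe_mk, inner_add_left, inner_add_right,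
    real_inner_smul_left, real_inner_smul_right, real_inner_self_eq_norm_sq]
  rw [real_inner_comm v'.2.1 m]
  field_simp
  ring

/-- The denominator of the normalized Möbius map. -/
def normDen (l : ℝ) (m y : E3) : ℝ := 1 + 2 / l * inner ℝ y m + ‖m‖ ^ 2 / l ^ 2 * ‖y‖ ^ 2

/-- The normalized Möbius map. -/
def normMap (l : ℝ) (m y : E3) : E3 := (normDen l m y)⁻¹ • (l • y + ‖y‖ ^ 2 • m)

/-- The numerator vanishes at the origin, so neither the denominator nor the quadratic terms
contribute to the derivative there. -/
lemma hasFDerivAt_moebius_form (L : E3 →L[ℝ] E3) (β : E3 →L[ℝ] ℝ) (γ : ℝ) (m : E3) :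
    HasFDerivAt (fun y : E3 => (1 + β y + γ * ‖y‖ ^ 2)⁻¹ • (L y + ‖y‖ ^ 2 • m)) L 0 := by
  have hn : HasFDerivAt (fun y : E3 => ‖y‖ ^ 2) (0 : E3 →L[ℝ] ℝ) 0 := by
    have := (hasStrictFDerivAt_norm_sq (0 : E3)).hasFDerivAt
    simpa using this
  have hD : HasFDerivAt (fun y : E3 => 1 + β y + γ * ‖y‖ ^ 2) (β + γ • (0 : E3 →L[ℝ] ℝ)) 0 := by
    exact (β.hasFDerivAt (x := (0 : E3))).const_add 1 |>.add (hn.const_mul γ)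
  have hN : HasFDerivAt (fun y : E3 => L y + ‖y‖ ^ 2 • m)
      (L + (0 : E3 →L[ℝ] ℝ).smulRight m) 0 := L.hasFDerivAt.add (hn.smul_const m)
  have h1 : HasFDerivAt (fun y : E3 => (1 + β y + γ * ‖y‖ ^ 2)⁻¹)
      ((-((1 : ℝ) ^ 2)⁻¹) • (β + γ • (0 : E3 →L[ℝ] ℝ))) 0 := by
    have h2 : HasDerivAt (fun t : ℝ => t⁻¹) (-((1 : ℝ) ^ 2)⁻¹)
        ((fun y : E3 => 1 + β y + γ * ‖y‖ ^ 2) 0) := by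
      simpa using hasDerivAt_inv (one_ne_zero (α := ℝ))
    exact h2.comp_hasFDerivAt 0 hD
  have h3 := h1.smul hN
  refine h3.congr_fderiv ?_
  ext1 v
  simp

lemma domain_mem_nhds {g : Moebius} {q : E3} (hq : q ∈ g.domain) : g.domain ∈ 𝓝 q := by
  cases g with
  | sim r hr e => exact univ_mem
  | inv c R hR e => exact isOpen_compl_singleton.mem_nhds hq

/-- The Möbius transformation induced by `normLift l m` in a given frame. -/
lemma moebius_of_normLift {g : Moebius} {q : E3} {A : E3 ≃ₗᵢ[ℝ] E3} {l : ℝ} {m : E3}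
    {κ : ℝ} (hκ : κ ≠ 0)
    (hg : IsLiftOf (κ • (normLift l m ∘ₗ isoLift (frameMap q A))) g) :
    q ∈ g.domain ∧ (∀ x ∈ g.domain, g.toFun x = normMap l m (A (x - q))) := by
  have hT : ∀ x, (normLift l m ∘ₗ isoLift (frameMap q A)) (lift x)
      = (normDen l m (A (x - q)), l • A (x - q) + ‖A (x - q)‖ ^ 2 • m,
        l ^ 2 * ‖A (x - q)‖ ^ 2) := by
    intro x
    rw [LinearMap.comp_apply, isoLift_lift, frameMap_apply]
    rfl
  constructor
  · by_contra h
    have h1 := hg.2 q h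
    rw [LinearMap.smul_apply, hT] at h1
    simp [normDen, hκ] at h1
  · intro x hx
    obtain ⟨d, hd, h⟩ := hg.1 x hx
    rw [LinearMap.smul_apply, hT] at h
    have h1 : κ * normDen l m (A (x - q)) = d := by
      simpa [lift] using congrArg Prod.fst h
    have h2 : κ • (l • A (x - q) + ‖A (x - q)‖ ^ 2 • m) = d • g.toFun x := by
      exact congrArg (fun v : LV => v.2.1) h
    have h0 : normDen l m (A (x - q)) ≠ 0 := by
      intro h0
      rw [h0, mul_zero] at h1
      exact hd h1.symm
    rw [normMap]
    rw [← h1, mul_smul] at h2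
    have h3 := smul_right_injective E3 hκ h2
    rw [h3, smul_smul, inv_mul_cancel₀ h0, one_smul]

lemma normMap_zero (l : ℝ) (m : E3) : normMap l m 0 = 0 := by simp [normMap]

lemma normMap_hasFDerivAt (l : ℝ) (m : E3) :
    HasFDerivAt (normMap l m) (l • ContinuousLinearMap.id ℝ E3) 0 := by
  have h := hasFDerivAt_moebius_form (l • ContinuousLinearMap.id ℝ E3)
    ((2 / l) • innerSL ℝ m) (‖m‖ ^ 2 / l ^ 2) m
  refine h.congr_of_eventuallyEq (Eventually.of_forall fun y => ?_)
  simp [normMap, normDen, real_inner_comm]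

lemma hasFDerivAt_frame (A : E3 ≃ₗᵢ[ℝ] E3) (q : E3) :
    HasFDerivAt (fun x => A (x - q)) (A : E3 →L[ℝ] E3) q := by
  have := ((A : E3 →L[ℝ] E3).hasFDerivAt (x := q - q)).comp (f := fun x => x - q) q
    ((hasFDerivAt_id (𝕜 := ℝ) q).sub_const q)
  exact this.congr_fderiv (by ext1; simp)

lemma moebius_hasFDerivAt {g : Moebius} {q : E3} {A : E3 ≃ₗᵢ[ℝ] E3} {l : ℝ} {m : E3}
    (hq : q ∈ g.domain) (hg : ∀ x ∈ g.domain, g.toFun x = normMap l m (A (x - q))) (v : E3) :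
    fderiv ℝ g.toFun q v = l • A v := by
  have h1 := hasFDerivAt_frame A q
  have h2 : HasFDerivAt (normMap l m) (l • ContinuousLinearMap.id ℝ E3) (A (q - q)) := by
    rw [sub_self, map_zero]; exact normMap_hasFDerivAt l m
  have h3 := (h2.comp q h1).congr_of_eventuallyEq
    (f₁ := g.toFun) (by filter_upwards [domain_mem_nhds hq] with x hx using hg x hx)
  rw [h3.fderiv]
  simp

/-- A Möbius transformation sending `q` to the origin with derivative `l A` is normalized. -/
lemma exists_normLift {g : Moebius} {c : ℝ} {T : LV →ₗ[ℝ] LV} (hT : IsConformal c T)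
    (hg : IsLiftOf T g) {q : E3} {A : E3 ≃ₗᵢ[ℝ] E3} {l : ℝ} (hl : 0 < l)
    (hq : q ∈ g.domain) (hgq : g.toFun q = 0)
    (hd : ∀ v, fderiv ℝ g.toFun q v = l • A v) :
    ∃ (m : E3) (κ : ℝ), κ ≠ 0 ∧ T = κ • (normLift l m ∘ₗ isoLift (frameMap q A)) := by
  obtain ⟨κ, hκ, hκ'⟩ := hg.1 q hq
  have hσ : IsConformal 1 (isoLift (frameMap q A)) := isoLift_conformal _
  have hσs : IsConformal 1⁻¹ (hσ.equiv.symm : LV →ₗ[ℝ] LV) := IsConformal.symm (T := hσ.equiv) hσ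
  -- `S` is `T` read in the frame `A` at `q` and rescaled to fix `lift 0`. Products with `lift 0`
  -- control its last coordinate, the derivative of `g` gives its Euclidean block, and conformality
  -- determines the rest from `m`.
  obtain ⟨S, hS⟩ : ∃ S : LV →ₗ[ℝ] LV, S = κ⁻¹ • (T ∘ₗ (hσ.equiv.symm : LV →ₗ[ℝ] LV)) := ⟨_, rfl⟩
  have hTS : ∀ v, T v = κ • S (isoLift (frameMap q A) v) := by
    intro v
    have h1 : hσ.equiv.symm (isoLift (frameMap q A) v) = v := hσ.equiv.symm_apply_apply v
    simp only [hS, LinearMap.smul_apply, LinearMap.comp_apply, LinearEquiv.coe_coe]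
    rw [h1, smul_smul, mul_inv_cancel₀ hκ, one_smul]
  obtain ⟨c', hc'⟩ : ∃ c', IsConformal c' S := by
    refine ⟨κ⁻¹ ^ 2 * (c * 1⁻¹), mul_pos (by positivity) (hT.comp hσs).1, fun v v' => ?_⟩
    rw [hS, LinearMap.smul_apply, LinearMap.smul_apply, lform_smul_left, lform_smul_right,
      (hT.comp hσs).2]
    ring
  have hS0 : S (lift 0) = lift 0 := by
    have h1 := hTS (lift q)
    rw [isoLift_lift, frameMap_apply, sub_self, map_zero, hκ', hgq] at h1
    exact (smul_right_injective LV hκ h1).symm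
  have hl0 : ∀ v, lform v (lift 0) = -v.2.2 / 2 := by
    intro v; simp [lform, lift]; ring
  have hρ : ∀ v, (S v).2.2 = c' * v.2.2 := by
    intro v
    have h1 := hc'.2 v (lift 0)
    rw [hS0, hl0, hl0] at h1
    linarith
  obtain ⟨L, β, hSι⟩ : ∃ (L : E3 →ₗ[ℝ] E3) (β : E3 →ₗ[ℝ] ℝ), ∀ x, S (0, x, 0) = (β x, L x, 0) := by
    let ι : E3 →ₗ[ℝ] LV := (LinearMap.inr ℝ ℝ (E3 × ℝ)) ∘ₗ (LinearMap.inl ℝ E3 ℝ)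
    refine ⟨LinearMap.fst ℝ E3 ℝ ∘ₗ LinearMap.snd ℝ ℝ (E3 × ℝ) ∘ₗ S ∘ₗ ι,
      LinearMap.fst ℝ ℝ (E3 × ℝ) ∘ₗ S ∘ₗ ι, fun x => Prod.ext rfl (Prod.ext rfl ?_)⟩
    rw [hρ]; simp
  obtain ⟨γ, m, hγ⟩ : ∃ γ m, S liftInf = (γ, m, c') := by
    refine ⟨(S liftInf).1, (S liftInf).2.1, Prod.ext rfl (Prod.ext rfl ?_)⟩
    rw [hρ]; simp [liftInf]
  have hSv : ∀ v : LV, S v = (v.1 + β v.2.1 + γ * v.2.2, L v.2.1 + v.2.2 • m, c' * v.2.2) := by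
    intro v
    have h1 : v = v.1 • lift 0 + (0, v.2.1, 0) + v.2.2 • liftInf := by
      refine Prod.ext ?_ (Prod.ext ?_ ?_) <;> simp [lift, liftInf]
    conv_lhs => rw [h1]
    rw [map_add, map_add, map_smul, map_smul, hS0, hSι, hγ]
    refine Prod.ext ?_ (Prod.ext ?_ ?_)
    · simp [lift, mul_comm]
    · simp [lift]
    · simp [lift, mul_comm]
  -- the derivative of `g`
  have hL : ∀ x, L x = l • x := by
    have h1 := hasFDerivAt_frame A q
    have h2 := hasFDerivAt_moebius_form L.toContinuousLinearMap β.toContinuousLinearMap γ m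
    rw [show (0 : E3) = A (q - q) by simp] at h2
    have h3 := (h2.comp q h1).congr_of_eventuallyEq (f₁ := g.toFun) (by
      filter_upwards [domain_mem_nhds hq] with x hx
      obtain ⟨d, hd0, h4⟩ := hg.1 x hx
      rw [hTS, isoLift_lift, frameMap_apply, hSv] at h4
      have h5 : κ * (1 + β (A (x - q)) + γ * ‖A (x - q)‖ ^ 2) = d := by
        simpa [lift] using congrArg Prod.fst h4
      have h6 : κ • (L (A (x - q)) + ‖A (x - q)‖ ^ 2 • m) = d • g.toFun x := by
        exact congrArg (fun v : LV => v.2.1) h4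
      have h0 : 1 + β (A (x - q)) + γ * ‖A (x - q)‖ ^ 2 ≠ 0 := by
        intro h0
        rw [h0, mul_zero] at h5
        exact hd0 h5.symm
      rw [← h5, mul_smul] at h6
      have h7 := smul_right_injective E3 hκ h6
      simp only [Function.comp_apply, LinearMap.coe_toContinuousLinearMap']
      rw [h7, smul_smul, inv_mul_cancel₀ h0, one_smul])
    intro x
    have h8 := hd (A.symm x)
    rw [h3.fderiv] at h8
    simpa using h8
  have hcl : c' = l ^ 2 := by
    have h1 := hc'.2 (0, stdVec 0, 0) (0, stdVec 0, 0)
    have h2 : ‖stdVec 0‖ = 1 := by simp [stdVec]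
    rw [hSι, hL] at h1
    simp [lform, norm_smul, h2] at h1
    linarith
  have hβ : ∀ x, β x = 2 / l * inner ℝ x m := by
    intro x
    have h1 := hc'.2 (0, x, 0) liftInf
    rw [hSι, hγ, hL, hcl] at h1
    simp [lform, liftInf, real_inner_smul_left] at h1
    field_simp
    have h2 : l * (2 * inner ℝ x m - β x * l) = 0 := by linarith
    have := (mul_eq_zero.1 h2).resolve_left hl.ne'
    linarith
  have hγm : γ = ‖m‖ ^ 2 / l ^ 2 := by
    have h1 := hc'.2 liftInf liftInf
    rw [lform_liftInf_self, mul_zero, hγ, hcl] at h1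
    simp only [lform, real_inner_self_eq_norm_sq] at h1
    field_simp
    linarith
  refine ⟨m, κ, hκ, LinearMap.ext fun v => ?_⟩
  rw [hTS, hSv, LinearMap.smul_apply, LinearMap.comp_apply, hβ, hL, hγm, hcl]
  rfl

/-! ## Surfaces as graphs, and the effect of a normalized Möbius map on a graph -/

/-- A surface whose tangent plane is horizontal is locally a graph. -/
lemma exists_graph {Y : ℝ × ℝ → E3} {p w₁ w₂ : ℝ × ℝ} {l : ℝ} (hl : 0 < l)
    (hY : ContDiffAt ℝ ∞ Y p) (hY0 : Y p = 0) (h1 : fderiv ℝ Y p w₁ = l • stdVec 0)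
    (h2 : fderiv ℝ Y p w₂ = l • stdVec 1) :
    map (fun u => (Y u 0, Y u 1)) (𝓝 p) = 𝓝 (0 : ℝ × ℝ) ∧
      ∃ f : ℝ × ℝ → ℝ, ContDiffAt ℝ ∞ f 0 ∧ ∀ᶠ u in 𝓝 p, Y u 2 = f (Y u 0, Y u 1) := by
  have hn : (∞ : WithTop ℕ∞) ≠ 0 := by simp
  let π : E3 →L[ℝ] ℝ × ℝ := (EuclideanSpace.proj 0).prod (EuclideanSpace.proj 1)
  have hπ : ∀ x, π x = (x 0, x 1) := fun x => rfl
  have hΦ : ContDiffAt ℝ ∞ (fun u => (Y u 0, Y u 1)) p := π.contDiff.contDiffAt.comp p hY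
  have hY' : HasFDerivAt Y (fderiv ℝ Y p) p := (hY.differentiableAt hn).hasFDerivAt
  have hΦ' : HasFDerivAt (fun u => (Y u 0, Y u 1)) (π ∘L fderiv ℝ Y p) p :=
    π.hasFDerivAt.comp p hY'
  -- The images of `w₁` and `w₂` project to multiples of the coordinate axes, so the inverse
  -- function theorem applies to the horizontal projection.
  have hsurj : Function.Surjective (π ∘L fderiv ℝ Y p) := by
    intro v
    refine ⟨(v.1 / l) • w₁ + (v.2 / l) • w₂, ?_⟩
    rw [map_add, map_smul, map_smul, ContinuousLinearMap.comp_apply,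
      ContinuousLinearMap.comp_apply, h1, h2, hπ, hπ]
    ext <;> simp [stdVec, hl.ne']
  have hinj : Function.Injective (π ∘L fderiv ℝ Y p) :=
    LinearMap.injective_iff_surjective.2 hsurj
  let e : (ℝ × ℝ) ≃L[ℝ] ℝ × ℝ := ContinuousLinearEquiv.ofBijective (π ∘L fderiv ℝ Y p)
    (LinearMap.ker_eq_bot.2 hinj) (LinearMap.range_eq_top.2 hsurj)
  have he : HasFDerivAt (fun u => (Y u 0, Y u 1)) (e : ℝ × ℝ →L[ℝ] ℝ × ℝ) p := hΦ'
  have hs : HasStrictFDerivAt (fun u => (Y u 0, Y u 1)) (e : ℝ × ℝ →L[ℝ] ℝ × ℝ) p :=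
    hΦ.hasStrictFDerivAt' he hn
  have hp0 : (Y p 0, Y p 1) = (0 : ℝ × ℝ) := by rw [hY0]; rfl
  refine ⟨by rw [hs.map_nhds_eq_of_equiv, hp0], ?_⟩
  have hinv := hΦ.to_localInverse he hn
  have hinvp : hΦ.localInverse he hn 0 = p := by
    rw [← hp0]; exact hΦ.localInverse_apply_image he hn
  rw [hp0] at hinv
  refine ⟨fun q => Y (hΦ.localInverse he hn q) 2, ?_, ?_⟩
  · have hY2 : ContDiffAt ℝ ∞ (fun u => Y u 2) (hΦ.localInverse he hn 0) := by
      rw [hinvp]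
      exact (EuclideanSpace.proj (𝕜 := ℝ) (2 : Fin 3)).contDiff.contDiffAt.comp p hY
    exact hY2.comp 0 hinv
  · filter_upwards [hs.eventually_left_inverse] with u hu
    exact congrArg (fun v => Y v 2) hu.symm

lemma normMap_apply {l : ℝ} (hl : 0 < l) (n y : E3) (i : Fin 3) :
    normMap l (l • n) y i = (1 + 2 * inner ℝ y n + ‖n‖ ^ 2 * ‖y‖ ^ 2)⁻¹
      * (l * y i + ‖y‖ ^ 2 * (l * n i)) := by
  have h : normDen l (l • n) y = 1 + 2 * inner ℝ y n + ‖n‖ ^ 2 * ‖y‖ ^ 2 := by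
    rw [normDen, real_inner_smul_right, norm_smul, mul_pow, Real.norm_eq_abs, sq_abs]
    field_simp
  simp [normMap, h]
  ring

/-- The coefficients, to third order, of the image of a graph under a normalized Möbius map. -/
lemma expansion_of_normMap {f h : ℝ × ℝ → ℝ} {l : ℝ} (hl : 0 < l) (n : E3)
    {k₁ k₂ c30 c21 c12 c03 c00 α₁ α₂ β₁ β₂ β₃ g30 g21 g12 g03 : ℝ}
    (hh : (fun q : ℝ × ℝ => h q - ((k₁ * q.1 ^ 2 + k₂ * q.2 ^ 2) / 2 + (c30 * q.1 ^ 3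
      + 3 * c21 * q.1 ^ 2 * q.2 + 3 * c12 * q.1 * q.2 ^ 2 + c03 * q.2 ^ 3) / 6))
      =O[𝓝 0] fun q => ‖q‖ ^ 4)
    (hf : (fun q : ℝ × ℝ => f q - (c00 + (α₁ * q.1 + α₂ * q.2)
      + (β₁ * q.1 ^ 2 + 2 * β₂ * q.1 * q.2 + β₃ * q.2 ^ 2) / 2 + (g30 * q.1 ^ 3
      + 3 * g21 * q.1 ^ 2 * q.2 + 3 * g12 * q.1 * q.2 ^ 2 + g03 * q.2 ^ 3) / 6))
      =O[𝓝 0] fun q => ‖q‖ ^ 4)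
    (heq : ∀ᶠ q in 𝓝 (0 : ℝ × ℝ), normMap l (l • n) !₂[q.1, q.2, h q] 2
      = f (normMap l (l • n) !₂[q.1, q.2, h q] 0, normMap l (l • n) !₂[q.1, q.2, h q] 1))
    (a b : ℝ) :
    c00 = 0 ∧ α₁ * a + α₂ * b = 0 ∧ (α₁ = 0 → α₂ = 0 →
    (k₁ * a ^ 2 + k₂ * b ^ 2) / 2 + (a ^ 2 + b ^ 2) * n 2
      = l * ((β₁ * a ^ 2 + 2 * β₂ * a * b + β₃ * b ^ 2) / 2) ∧
    (c30 * a ^ 3 + 3 * c21 * a ^ 2 * b + 3 * c12 * a * b ^ 2 + c03 * b ^ 3) / 6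
      + 2 * (n 0 * a + n 1 * b) * (l * ((β₁ * a ^ 2 + 2 * β₂ * a * b + β₃ * b ^ 2) / 2))
      - l * (a ^ 2 + b ^ 2) * (β₁ * a * n 0 + β₂ * (a * n 1 + b * n 0) + β₃ * b * n 1)
      = l ^ 2 * ((g30 * a ^ 3 + 3 * g21 * a ^ 2 * b + 3 * g12 * a * b ^ 2 + g03 * b ^ 3) / 6)) := by
  obtain ⟨ε, hε, hε'⟩ := exists_remainder (n := 3) hh (line_tendsto a b) (line_isBigO a b)
  obtain ⟨p2, hp2⟩ : ∃ x, x = (k₁ * a ^ 2 + k₂ * b ^ 2) / 2 := ⟨_, rfl⟩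
  obtain ⟨p3, hp3⟩ : ∃ x, x = (c30 * a ^ 3 + 3 * c21 * a ^ 2 * b + 3 * c12 * a * b ^ 2
    + c03 * b ^ 3) / 6 := ⟨_, rfl⟩
  -- All quantities are functions of `(s, ε)` with the powers of `s` factored out: the graph point
  -- has height `s² Z`, and its image is `l D⁻¹ (s u1, s u2, s² u3)`.
  obtain ⟨Z, hZ⟩ : ∃ Z : ℝ × ℝ → ℝ, ∀ v, Z v = p2 + v.1 * p3 + v.1 * v.2 := ⟨_, fun _ => rfl⟩
  obtain ⟨σ, hσ⟩ : ∃ σ : ℝ × ℝ → ℝ, ∀ v, σ v = a ^ 2 + b ^ 2 + v.1 ^ 2 * Z v ^ 2 :=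
    ⟨_, fun _ => rfl⟩
  obtain ⟨δ, hδ⟩ : ∃ δ : ℝ × ℝ → ℝ, ∀ v, δ v = 2 * (n 0 * a + n 1 * b + v.1 * Z v * n 2)
    + ‖n‖ ^ 2 * v.1 * σ v := ⟨_, fun _ => rfl⟩
  obtain ⟨D, hD⟩ : ∃ D : ℝ × ℝ → ℝ, ∀ v, D v = 1 + v.1 * δ v := ⟨_, fun _ => rfl⟩
  obtain ⟨u1, hu1⟩ : ∃ u : ℝ × ℝ → ℝ, ∀ v, u v = a + v.1 * σ v * n 0 := ⟨_, fun _ => rfl⟩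
  obtain ⟨u2, hu2⟩ : ∃ u : ℝ × ℝ → ℝ, ∀ v, u v = b + v.1 * σ v * n 1 := ⟨_, fun _ => rfl⟩
  obtain ⟨u3, hu3⟩ : ∃ u : ℝ × ℝ → ℝ, ∀ v, u v = Z v + σ v * n 2 := ⟨_, fun _ => rfl⟩
  have hZc : Continuous Z := by rw [funext hZ]; fun_prop
  have hσc : Continuous σ := by rw [funext hσ]; fun_prop
  have hδc : Continuous δ := by rw [funext hδ]; fun_prop
  have hDc : Continuous D := by rw [funext hD]; fun_prop
  have hu1c : Continuous u1 := by rw [funext hu1]; fun_prop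
  have hu2c : Continuous u2 := by rw [funext hu2]; fun_prop
  have hu3c : Continuous u3 := by rw [funext hu3]; fun_prop
  have hZ0 : Z (0, 0) = p2 := by simp [hZ]
  have hσ0 : σ (0, 0) = a ^ 2 + b ^ 2 := by simp [hσ]
  have hδ0 : δ (0, 0) = 2 * (n 0 * a + n 1 * b) := by simp [hδ]
  have hD0 : D (0, 0) = 1 := by simp [hD]
  have hu10 : u1 (0, 0) = a := by simp [hu1]
  have hu20 : u2 (0, 0) = b := by simp [hu2]
  have hu30 : u3 (0, 0) = p2 + (a ^ 2 + b ^ 2) * n 2 := by rw [hu3, hZ0, hσ0]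
  have hne : ∀ᶠ s : ℝ in 𝓝[≠] 0, s ≠ 0 := self_mem_nhdsWithin
  have hid : Tendsto (fun s : ℝ => s) (𝓝[≠] 0) (𝓝 0) := tendsto_id.mono_left nhdsWithin_le_nhds
  have hbase : Tendsto (fun s : ℝ => (s, ε s)) (𝓝[≠] 0) (𝓝 (0, 0)) := hid.prodMk_nhds hε
  have hD1 : Tendsto (fun s : ℝ => D (s, ε s)) (𝓝[≠] 0) (𝓝 1) :=
    (hDc.tendsto' (0, 0) 1 hD0).comp hbase
  have hDne := hD1.eventually_ne one_ne_zero
  have hX : ∀ᶠ s in 𝓝[≠] 0, ∀ i, normMap l (l • n) !₂[s * a, s * b, h (s * a, s * b)] i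
      = (D (s, ε s))⁻¹ * (l * !₂[s * u1 (s, ε s), s * u2 (s, ε s), s ^ 2 * u3 (s, ε s)] i) := by
    filter_upwards [hε'] with s hs i
    have hhs : h (s * a, s * b) = s ^ 2 * Z (s, ε s) := by
      simp only [hZ, hp2, hp3]; linear_combination hs
    rw [normMap_apply hl, hhs]
    congr 1
    · congr 1
      simp only [inner_eq3, norm_sq3, hD, hδ, hσ, Matrix.cons_val_zero, Matrix.cons_val_one,
        Matrix.cons_val]
      ring
    · fin_cases i <;> simp [norm_sq3, hu1, hu2, hu3, hσ] <;> ring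
  obtain ⟨γ, hγ⟩ : ∃ γ : ℝ → ℝ × ℝ, ∀ s, γ s = s • ((D (s, ε s))⁻¹ * (l * u1 (s, ε s)),
    (D (s, ε s))⁻¹ * (l * u2 (s, ε s))) := ⟨_, fun s => rfl⟩
  have hv : Tendsto (fun s => ((D (s, ε s))⁻¹ * (l * u1 (s, ε s)),
      (D (s, ε s))⁻¹ * (l * u2 (s, ε s)))) (𝓝[≠] 0)
      (𝓝 (1⁻¹ * (l * u1 (0, 0)), 1⁻¹ * (l * u2 (0, 0)))) :=
    ((hD1.inv₀ one_ne_zero).mul (((hu1c.tendsto _).comp hbase).const_mul l)).prodMk_nhds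
      ((hD1.inv₀ one_ne_zero).mul (((hu2c.tendsto _).comp hbase).const_mul l))
  have hγ0 : Tendsto γ (𝓝[≠] 0) (𝓝 0) := by
    have := hid.smul hv
    rw [zero_smul] at this
    exact this.congr fun s => (hγ s).symm
  have hγO : γ =O[𝓝[≠] 0] fun s : ℝ => s := by
    have := (isBigO_refl (fun s : ℝ => s) (𝓝[≠] 0)).smul (hv.isBigO_one ℝ)
    refine this.congr (fun s => (hγ s).symm) fun s => by simp
  obtain ⟨η, hη, hη'⟩ := exists_remainder (n := 3) hf hγ0 hγO
  have hlim : Tendsto (fun s => (ε s, η s)) (𝓝[≠] 0) (𝓝 (0, 0)) := hε.prodMk_nhds hη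
  obtain ⟨Q, hQ⟩ : ∃ Q : ℝ × ℝ → ℝ, ∀ v, Q v = (β₁ * v.1 ^ 2 + 2 * β₂ * v.1 * v.2
    + β₃ * v.2 ^ 2) / 2 := ⟨_, fun _ => rfl⟩
  obtain ⟨C, hC⟩ : ∃ C : ℝ × ℝ → ℝ, ∀ v, C v = (g30 * v.1 ^ 3 + 3 * g21 * v.1 ^ 2 * v.2
    + 3 * g12 * v.1 * v.2 ^ 2 + g03 * v.2 ^ 3) / 6 := ⟨_, fun _ => rfl⟩
  have hQc : Continuous Q := by rw [funext hQ]; fun_prop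
  have hCc : Continuous C := by rw [funext hC]; fun_prop
  -- the basic equation
  have main : ∀ᶠ s in 𝓝[≠] 0, c00 * D (s, ε s) ^ 3
      + s * (l * (α₁ * u1 (s, ε s) + α₂ * u2 (s, ε s)) * D (s, ε s) ^ 2)
      + s ^ 2 * (l ^ 2 * Q (u1 (s, ε s), u2 (s, ε s)) * D (s, ε s)
        - l * u3 (s, ε s) * D (s, ε s) ^ 2)
      + s ^ 3 * (l ^ 3 * C (u1 (s, ε s), u2 (s, ε s)) + η s * D (s, ε s) ^ 3) = 0 := by
    filter_upwards [hX, hη', hDne, (line_tendsto a b).eventually heq] with s hs1 hs2 hs3 hs4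
    have e0 := hs1 0
    have e1 := hs1 1
    have e2 := hs1 2
    have eγ := hγ s
    simp only [Matrix.cons_val_zero, Matrix.cons_val_one, Matrix.cons_val] at e0 e1 e2
    rw [e0, e1, e2] at hs4
    rw [hQ, hC]
    generalize D (s, ε s) = d at *
    generalize u1 (s, ε s) = x1 at *
    generalize u2 (s, ε s) = x2 at *
    generalize u3 (s, ε s) = x3 at *
    have eγ' : γ s = (d⁻¹ * (l * (s * x1)), d⁻¹ * (l * (s * x2))) := by
      rw [eγ]; ext <;> simp <;> ring
    rw [← eγ'] at hs4
    rw [← hs4, eγ'] at hs2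
    field_simp at hs2
    linear_combination -hs2 / 12
  have r0 : c00 = 0 := by
    have := eq_zero_of_eventually (K := fun v : ℝ × (ℝ × ℝ) => c00 * D (v.1, v.2.1) ^ 3
      + v.1 * (l * (α₁ * u1 (v.1, v.2.1) + α₂ * u2 (v.1, v.2.1)) * D (v.1, v.2.1) ^ 2)
      + v.1 ^ 2 * (l ^ 2 * Q (u1 (v.1, v.2.1), u2 (v.1, v.2.1)) * D (v.1, v.2.1)
        - l * u3 (v.1, v.2.1) * D (v.1, v.2.1) ^ 2)
      + v.1 ^ 3 * (l ^ 3 * C (u1 (v.1, v.2.1), u2 (v.1, v.2.1)) + v.2.2 * D (v.1, v.2.1) ^ 3))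
      (by fun_prop) hlim main
    simpa [hD0] using this
  have r1 : α₁ * a + α₂ * b = 0 := by
    have := eq_zero_of_eventually (K := fun v : ℝ × (ℝ × ℝ) =>
      (l * (α₁ * u1 (v.1, v.2.1) + α₂ * u2 (v.1, v.2.1)) * D (v.1, v.2.1) ^ 2)
      + v.1 * (l ^ 2 * Q (u1 (v.1, v.2.1), u2 (v.1, v.2.1)) * D (v.1, v.2.1)
        - l * u3 (v.1, v.2.1) * D (v.1, v.2.1) ^ 2)
      + v.1 ^ 2 * (l ^ 3 * C (u1 (v.1, v.2.1), u2 (v.1, v.2.1)) + v.2.2 * D (v.1, v.2.1) ^ 3))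
      (by fun_prop) hlim (by
        filter_upwards [main, hne] with s hs hs0
        refine (mul_eq_zero.1 ?_).resolve_left hs0
        rw [← hs, r0]; ring)
    simpa [hD0, hu10, hu20, hl.ne'] using this
  refine ⟨r0, r1, fun hα₁ hα₂ => ?_⟩
  have hα : ∀ x y : ℝ, α₁ * x + α₂ * y = 0 := fun x y => by rw [hα₁, hα₂]; ring
  have r2 : p2 + (a ^ 2 + b ^ 2) * n 2 = l * Q (a, b) := by
    have := eq_zero_of_eventually (K := fun v : ℝ × (ℝ × ℝ) =>
      (l ^ 2 * Q (u1 (v.1, v.2.1), u2 (v.1, v.2.1)) * D (v.1, v.2.1)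
        - l * u3 (v.1, v.2.1) * D (v.1, v.2.1) ^ 2)
      + v.1 * (l ^ 3 * C (u1 (v.1, v.2.1), u2 (v.1, v.2.1)) + v.2.2 * D (v.1, v.2.1) ^ 3))
      (by fun_prop) hlim (by
        filter_upwards [main, hne] with s hs hs0
        refine (mul_eq_zero.1 ?_).resolve_left (pow_ne_zero 2 hs0)
        rw [← hs, r0, hα]; ring)
    simp only [hD0, hu10, hu20, hu30] at this
    have h2 : l * (l * Q (a, b) - (p2 + (a ^ 2 + b ^ 2) * n 2)) = 0 := by linarith
    have := (mul_eq_zero.1 h2).resolve_left hl.ne'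
    linarith
  have r3 : p3 + 2 * (n 0 * a + n 1 * b) * (l * Q (a, b))
      - l * (a ^ 2 + b ^ 2) * (β₁ * a * n 0 + β₂ * (a * n 1 + b * n 0) + β₃ * b * n 1)
      = l ^ 2 * C (a, b) := by
    -- By `r2` the bracket of `s²` in `main` vanishes at `s = 0`; this `K` is what remains after
    -- division by `s³`.
    have := eq_zero_of_eventually (K := fun v : ℝ × (ℝ × ℝ) =>
      l ^ 3 * C (u1 (v.1, v.2.1), u2 (v.1, v.2.1)) + v.2.2 * D (v.1, v.2.1) ^ 3
      - l * D (v.1, v.2.1) * ((p3 + v.2.1 + n 2 * v.1 * Z (v.1, v.2.1) ^ 2)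
        + δ (v.1, v.2.1) * (l * Q (a, b) + v.1 * (p3 + v.2.1 + n 2 * v.1 * Z (v.1, v.2.1) ^ 2))
        - l * σ (v.1, v.2.1) * (β₁ * a * n 0 + β₂ * (a * n 1 + b * n 0) + β₃ * b * n 1)
        - v.1 * l * σ (v.1, v.2.1) ^ 2 * Q (n 0, n 1)))
      (by fun_prop) hlim (by
        filter_upwards [main, hne] with s hs hs0
        refine (mul_eq_zero.1 ?_).resolve_left (pow_ne_zero 3 hs0)
        rw [← hs, r0, hα]
        have e1 : u3 (s, ε s) = l * Q (a, b)
            + s * (p3 + ε s + n 2 * s * Z (s, ε s) ^ 2) := by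
          rw [← r2, hu3, hσ]
          linear_combination hZ (s, ε s)
        have e2 : Q (u1 (s, ε s), u2 (s, ε s)) = Q (a, b) + s * σ (s, ε s)
            * (β₁ * a * n 0 + β₂ * (a * n 1 + b * n 0) + β₃ * b * n 1)
            + s ^ 2 * σ (s, ε s) ^ 2 * Q (n 0, n 1) := by
          rw [hQ, hQ, hQ, hu1, hu2]; ring
        rw [e1, e2]
        linear_combination (l * D (s, ε s) * s ^ 2 * (l * Q (a, b)
          + s * (p3 + ε s + n 2 * s * Z (s, ε s) ^ 2))) * hD (s, ε s))
    simp only [hD0, hu10, hu20, hδ0, hσ0, hZ0] at this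
    have h2 : l * (l ^ 2 * C (a, b) - (p3 + 2 * (n 0 * a + n 1 * b) * (l * Q (a, b))
      - l * (a ^ 2 + b ^ 2) * (β₁ * a * n 0 + β₂ * (a * n 1 + b * n 0) + β₃ * b * n 1))) = 0 := by
      linear_combination this
    have := (mul_eq_zero.1 h2).resolve_left hl.ne'
    linarith
  rw [hQ] at r2 r3
  rw [hC] at r3
  exact ⟨hp2 ▸ r2, hp3 ▸ r3⟩

/-! ## Expansions of curves on a graph -/

/-- Mean value inequality on the interval `[-|s|, |s|]`; iterating it gives Taylor's formula with
Peano remainder. -/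
lemma isLittleO_of_hasDerivAt {e e' : ℝ → ℝ} {n : ℕ} (h0 : e 0 = 0)
    (h : ∀ᶠ s in 𝓝 0, HasDerivAt e (e' s) s) (h' : e' =o[𝓝 0] fun s : ℝ => s ^ n) :
    e =o[𝓝 0] fun s : ℝ => s ^ (n + 1) := by
  refine isLittleO_iff.2 fun C hC => ?_
  obtain ⟨δ, hδ, hb⟩ := Metric.eventually_nhds_iff_ball.1 (h.and (isLittleO_iff.1 h' hC))
  filter_upwards [Metric.ball_mem_nhds (0 : ℝ) hδ] with s hs
  have hs' : ∀ x ∈ Metric.closedBall (0 : ℝ) |s|, x ∈ Metric.ball (0 : ℝ) δ := by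
    intro x hx
    rw [mem_closedBall_zero_iff] at hx
    rw [mem_ball_zero_iff] at hs ⊢
    exact lt_of_le_of_lt hx hs
  have := Convex.norm_image_sub_le_of_norm_hasDerivWithin_le (f := e) (f' := e')
    (C := C * |s| ^ n) (s := Metric.closedBall (0 : ℝ) |s|) (x := 0) (y := s)
    (fun x hx => (hb x (hs' x hx)).1.hasDerivWithinAt) (fun x hx => by
      refine (hb x (hs' x hx)).2.trans ?_
      rw [mem_closedBall_zero_iff] at hx
      rw [norm_pow]
      exact mul_le_mul_of_nonneg_left (pow_le_pow_left₀ (norm_nonneg _) hx n) hC.le)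
    (convex_closedBall _ _) (by simp) (by simp)
  rw [h0, sub_zero, sub_zero] at this
  rw [norm_pow, pow_succ, ← mul_assoc]
  exact this

lemma taylor_two {c c₁ : ℝ → ℝ} {c₂ : ℝ} (h : ∀ᶠ s in 𝓝 0, HasDerivAt c (c₁ s) s)
    (h₁ : HasDerivAt c₁ c₂ 0) :
    (fun s => c s - (c 0 + s * c₁ 0 + s ^ 2 * (c₂ / 2))) =o[𝓝 0] fun s : ℝ => s ^ 2 := by
  refine isLittleO_of_hasDerivAt (n := 1) (e' := fun s => c₁ s - (c₁ 0 + s * c₂)) (by simp) ?_ ?_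
  · filter_upwards [h] with s hs
    have := hs.sub ((((hasDerivAt_id s).mul_const (c₁ 0)).const_add (c 0)).add
      (((hasDerivAt_id s).pow 2).mul_const (c₂ / 2)))
    refine (show HasDerivAt (fun s => c s - (c 0 + s * c₁ 0 + s ^ 2 * (c₂ / 2))) _ s
      from this).congr_deriv ?_
    simp; ring
  · have := hasDerivAt_iff_isLittleO.1 h₁
    refine this.congr (fun s => ?_) fun s => by simp
    simp; ring

lemma taylor_three {c c₁ c₂ : ℝ → ℝ} {c₃ : ℝ} (h : ∀ᶠ s in 𝓝 0, HasDerivAt c (c₁ s) s)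
    (h₁ : ∀ᶠ s in 𝓝 0, HasDerivAt c₁ (c₂ s) s) (h₂ : HasDerivAt c₂ c₃ 0) :
    (fun s => c s - (c 0 + s * c₁ 0 + s ^ 2 * (c₂ 0 / 2) + s ^ 3 * (c₃ / 6)))
      =o[𝓝 0] fun s : ℝ => s ^ 3 := by
  refine isLittleO_of_hasDerivAt (n := 2)
    (e' := fun s => c₁ s - (c₁ 0 + s * c₂ 0 + s ^ 2 * (c₃ / 2))) (by simp) ?_ (taylor_two h₁ h₂)
  filter_upwards [h] with s hs
  have := hs.sub (((((hasDerivAt_id s).mul_const (c₁ 0)).const_add (c 0)).add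
    (((hasDerivAt_id s).pow 2).mul_const (c₂ 0 / 2))).add
    (((hasDerivAt_id s).pow 3).mul_const (c₃ / 6)))
  refine (show HasDerivAt (fun s => c s - (c 0 + s * c₁ 0 + s ^ 2 * (c₂ 0 / 2)
    + s ^ 3 * (c₃ / 6))) _ s from this).congr_deriv ?_
  simp; ring

lemma exists_eq_of_isLittleO {e : ℝ → ℝ} {n : ℕ} (h : e =o[𝓝 0] fun s : ℝ => s ^ n) :
    ∃ ε : ℝ → ℝ, Tendsto ε (𝓝[≠] 0) (𝓝 0) ∧ ∀ᶠ s in 𝓝[≠] 0, e s = s ^ n * ε s := by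
  refine ⟨fun s => e s / s ^ n, (h.mono nhdsWithin_le_nhds).tendsto_div_nhds_zero, ?_⟩
  filter_upwards [self_mem_nhdsWithin] with s hs
  rw [mul_div_cancel₀]
  exact pow_ne_zero n hs

/-- The expansion of a graph compared with the expansion of a curve on it. -/
lemma expansion_along_curve {h : ℝ × ℝ → ℝ} {c00 c10 c01 c20 c11 c02 c30 c21 c12 c03 : ℝ}
    (hh : (fun q : ℝ × ℝ => h q - (c00 + (c10 * q.1 + c01 * q.2)
      + (c20 * q.1 ^ 2 + 2 * c11 * q.1 * q.2 + c02 * q.2 ^ 2) / 2 + (c30 * q.1 ^ 3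
      + 3 * c21 * q.1 ^ 2 * q.2 + 3 * c12 * q.1 * q.2 ^ 2 + c03 * q.2 ^ 3) / 6))
      =O[𝓝 0] fun q => ‖q‖ ^ 4)
    {y₁ y₂ y₃ : ℝ → ℝ} {a b q₁ q₂ r₂ r₃ : ℝ}
    (h₁ : (fun s => y₁ s - (s * a + s ^ 2 * q₁)) =o[𝓝 0] fun s : ℝ => s ^ 2)
    (h₂ : (fun s => y₂ s - (s * b + s ^ 2 * q₂)) =o[𝓝 0] fun s : ℝ => s ^ 2)
    (h₃ : (fun s => y₃ s - (s ^ 2 * r₂ + s ^ 3 * r₃)) =o[𝓝 0] fun s : ℝ => s ^ 3)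
    (heq : ∀ᶠ s in 𝓝 0, y₃ s = h (y₁ s, y₂ s)) :
    c00 = 0 ∧ c10 * a + c01 * b = 0 ∧ (c10 = 0 → c01 = 0 →
      (c20 * a ^ 2 + 2 * c11 * a * b + c02 * b ^ 2) / 2 = r₂ ∧
      c20 * a * q₁ + c11 * (a * q₂ + b * q₁) + c02 * b * q₂
        + (c30 * a ^ 3 + 3 * c21 * a ^ 2 * b + 3 * c12 * a * b ^ 2 + c03 * b ^ 3) / 6 = r₃) := by
  obtain ⟨ε₁, hε₁, e₁⟩ := exists_eq_of_isLittleO h₁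
  obtain ⟨ε₂, hε₂, e₂⟩ := exists_eq_of_isLittleO h₂
  obtain ⟨ε₃, hε₃, e₃⟩ := exists_eq_of_isLittleO h₃
  have hid : Tendsto (fun s : ℝ => s) (𝓝[≠] 0) (𝓝 0) := tendsto_id.mono_left nhdsWithin_le_nhds
  have hne : ∀ᶠ s : ℝ in 𝓝[≠] 0, s ≠ 0 := self_mem_nhdsWithin
  have hv : Tendsto (fun s => (a + s * q₁ + s * ε₁ s, b + s * q₂ + s * ε₂ s)) (𝓝[≠] 0)
      (𝓝 (a + 0 * q₁ + 0 * 0, b + 0 * q₂ + 0 * 0)) :=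
    ((tendsto_const_nhds.add (hid.mul_const q₁)).add (hid.mul hε₁)).prodMk_nhds
      ((tendsto_const_nhds.add (hid.mul_const q₂)).add (hid.mul hε₂))
  obtain ⟨γ, hγ⟩ : ∃ γ : ℝ → ℝ × ℝ, ∀ s, γ s = s • (a + s * q₁ + s * ε₁ s, b + s * q₂ + s * ε₂ s) :=
    ⟨_, fun _ => rfl⟩
  have hγ0 : Tendsto γ (𝓝[≠] 0) (𝓝 0) := by
    have := hid.smul hv
    rw [zero_smul] at this
    exact this.congr fun s => (hγ s).symm
  have hγO : γ =O[𝓝[≠] 0] fun s : ℝ => s := by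
    have := (isBigO_refl (fun s : ℝ => s) (𝓝[≠] 0)).smul (hv.isBigO_one ℝ)
    refine this.congr (fun s => (hγ s).symm) fun s => by simp
  obtain ⟨η, hη, hη'⟩ := exists_remainder (n := 3) hh hγ0 hγO
  have hlim : Tendsto (fun s => (ε₁ s, ε₂ s, ε₃ s, η s)) (𝓝[≠] 0) (𝓝 (0, 0, 0, 0)) :=
    hε₁.prodMk_nhds (hε₂.prodMk_nhds (hε₃.prodMk_nhds hη))
  obtain ⟨Q, hQ⟩ : ∃ Q : ℝ × ℝ → ℝ, ∀ v, Q v = (c20 * v.1 ^ 2 + 2 * c11 * v.1 * v.2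
    + c02 * v.2 ^ 2) / 2 := ⟨_, fun _ => rfl⟩
  obtain ⟨C, hC⟩ : ∃ C : ℝ × ℝ → ℝ, ∀ v, C v = (c30 * v.1 ^ 3 + 3 * c21 * v.1 ^ 2 * v.2
    + 3 * c12 * v.1 * v.2 ^ 2 + c03 * v.2 ^ 3) / 6 := ⟨_, fun _ => rfl⟩
  have hQc : Continuous Q := by rw [funext hQ]; fun_prop
  have hCc : Continuous C := by rw [funext hC]; fun_prop
  have main : ∀ᶠ s in 𝓝[≠] 0, c00 + s * (c10 * (a + s * q₁ + s * ε₁ s)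
      + c01 * (b + s * q₂ + s * ε₂ s))
      + s ^ 2 * (Q (a + s * q₁ + s * ε₁ s, b + s * q₂ + s * ε₂ s) - r₂)
      + s ^ 3 * (C (a + s * q₁ + s * ε₁ s, b + s * q₂ + s * ε₂ s) + η s - r₃ - ε₃ s) = 0 := by
    filter_upwards [e₁, e₂, e₃, hη', heq.filter_mono nhdsWithin_le_nhds] with s i₁ i₂ i₃ hs hs'
    have hγ' : γ s = (y₁ s, y₂ s) := by
      rw [hγ]
      refine Prod.ext ?_ ?_
      · simp only [Prod.smul_mk, smul_eq_mul]; linear_combination -i₁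
      · simp only [Prod.smul_mk, smul_eq_mul]; linear_combination -i₂
    rw [hγ', ← hs', ← hγ', hγ] at hs
    simp only [Prod.smul_mk, smul_eq_mul] at hs
    rw [hQ, hC]
    linear_combination i₃ - hs
  have r0 : c00 = 0 := by
    have := eq_zero_of_eventually (K := fun v : ℝ × (ℝ × ℝ × ℝ × ℝ) => c00
      + v.1 * (c10 * (a + v.1 * q₁ + v.1 * v.2.1) + c01 * (b + v.1 * q₂ + v.1 * v.2.2.1))
      + v.1 ^ 2 * (Q (a + v.1 * q₁ + v.1 * v.2.1, b + v.1 * q₂ + v.1 * v.2.2.1) - r₂)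
      + v.1 ^ 3 * (C (a + v.1 * q₁ + v.1 * v.2.1, b + v.1 * q₂ + v.1 * v.2.2.1) + v.2.2.2.2 - r₃
        - v.2.2.2.1)) (by fun_prop) hlim main
    simpa using this
  have r1 : c10 * a + c01 * b = 0 := by
    have := eq_zero_of_eventually (K := fun v : ℝ × (ℝ × ℝ × ℝ × ℝ) =>
      (c10 * (a + v.1 * q₁ + v.1 * v.2.1) + c01 * (b + v.1 * q₂ + v.1 * v.2.2.1))
      + v.1 * (Q (a + v.1 * q₁ + v.1 * v.2.1, b + v.1 * q₂ + v.1 * v.2.2.1) - r₂)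
      + v.1 ^ 2 * (C (a + v.1 * q₁ + v.1 * v.2.1, b + v.1 * q₂ + v.1 * v.2.2.1) + v.2.2.2.2 - r₃
        - v.2.2.2.1)) (by fun_prop) hlim (by
        filter_upwards [main, hne] with s hs hs0
        refine (mul_eq_zero.1 ?_).resolve_left hs0
        rw [← hs, r0]; ring)
    simpa using this
  refine ⟨r0, r1, fun h10 h01 => ?_⟩
  have r2 : Q (a, b) = r₂ := by
    have := eq_zero_of_eventually (K := fun v : ℝ × (ℝ × ℝ × ℝ × ℝ) =>
      (Q (a + v.1 * q₁ + v.1 * v.2.1, b + v.1 * q₂ + v.1 * v.2.2.1) - r₂)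
      + v.1 * (C (a + v.1 * q₁ + v.1 * v.2.1, b + v.1 * q₂ + v.1 * v.2.2.1) + v.2.2.2.2 - r₃
        - v.2.2.2.1)) (by fun_prop) hlim (by
        filter_upwards [main, hne] with s hs hs0
        refine (mul_eq_zero.1 ?_).resolve_left (pow_ne_zero 2 hs0)
        rw [← hs, r0, h10, h01]; ring)
    simpa [sub_eq_zero] using this
  have r3 := eq_zero_of_eventually (K := fun v : ℝ × (ℝ × ℝ × ℝ × ℝ) =>
      c20 * a * (q₁ + v.2.1) + c11 * (a * (q₂ + v.2.2.1) + b * (q₁ + v.2.1))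
      + c02 * b * (q₂ + v.2.2.1) + v.1 * Q (q₁ + v.2.1, q₂ + v.2.2.1)
      + (C (a + v.1 * q₁ + v.1 * v.2.1, b + v.1 * q₂ + v.1 * v.2.2.1) + v.2.2.2.2 - r₃
        - v.2.2.2.1)) (by fun_prop) hlim (by
        filter_upwards [main, hne] with s hs hs0
        refine (mul_eq_zero.1 ?_).resolve_left (pow_ne_zero 3 hs0)
        rw [← hs, r0, h10, h01, ← r2, hQ, hQ, hQ]; ring)
  simp only [hC] at r3
  rw [hQ] at r2
  refine ⟨r2, ?_⟩
  simp only [zero_mul, add_zero] at r3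
  linarith

/-! ## Differential geometry of an immersed surface at a non-umbilic point -/

lemma cross3_apply (a b : E3) : cross3 a b = !₂[a 1 * b 2 - a 2 * b 1, a 2 * b 0 - a 0 * b 2,
    a 0 * b 1 - a 1 * b 0] := by
  ext i; fin_cases i <;> simp [cross3, crossProduct]

lemma inner_cross3_left (a b : E3) : inner ℝ (cross3 a b) a = 0 := by
  rw [inner_eq3, cross3_apply]; simp; ring

lemma inner_cross3_right (a b : E3) : inner ℝ (cross3 a b) b = 0 := by
  rw [inner_eq3, cross3_apply]; simp; ring

lemma norm_cross3_sq (a b : E3) :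
    ‖cross3 a b‖ ^ 2 = inner ℝ a a * inner ℝ b b - (inner ℝ a b) ^ 2 := by
  rw [norm_sq3, inner_eq3, inner_eq3, inner_eq3, cross3_apply]; simp; ring

lemma ContDiffAt.cross3 {f g : ℝ × ℝ → E3} {u : ℝ × ℝ} (hf : ContDiffAt ℝ ∞ f u)
    (hg : ContDiffAt ℝ ∞ g u) : ContDiffAt ℝ ∞ (fun x => cross3 (f x) (g x)) u := by
  have hf' := contDiffAt_euclidean.1 hf
  have hg' := contDiffAt_euclidean.1 hg
  refine contDiffAt_euclidean.2 fun i => ?_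
  simp only [cross3_apply]
  fin_cases i
  · exact ((hf' 1).mul (hg' 2)).sub ((hf' 2).mul (hg' 1))
  · exact ((hf' 2).mul (hg' 0)).sub ((hf' 0).mul (hg' 2))
  · exact ((hf' 0).mul (hg' 1)).sub ((hf' 1).mul (hg' 0))

lemma contDiffAt_fderiv_apply {f : ℝ × ℝ → E3} {u : ℝ × ℝ} (hf : ContDiffAt ℝ ∞ f u)
    (v : ℝ × ℝ) : ContDiffAt ℝ ∞ (fun x => fderiv ℝ f x v) u :=
  (hf.fderiv_right (m := ∞) (by simp)).clm_apply contDiffAt_const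

lemma ContDiffAt.differentiableAt_top {F : Type*} [NormedAddCommGroup F] [NormedSpace ℝ F]
    {f : ℝ × ℝ → F} {u : ℝ × ℝ} (hf : ContDiffAt ℝ ∞ f u) : DifferentiableAt ℝ f u :=
  hf.differentiableAt (by simp)

lemma fderiv_fderiv_apply {f : ℝ × ℝ → E3} {u : ℝ × ℝ} (hf : ContDiffAt ℝ ∞ f u) (v w : ℝ × ℝ) :
    fderiv ℝ (fun x => fderiv ℝ f x v) u w = fderiv ℝ (fderiv ℝ f) u w v := by
  have h := ((hf.fderiv_right (m := ∞) (by simp)).differentiableAt_top)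
  rw [fderiv_clm_apply h (differentiableAt_const v)]
  simp

lemma fderiv_fderiv_comm {f : ℝ × ℝ → E3} {u : ℝ × ℝ} (hf : ContDiffAt ℝ ∞ f u) (v w : ℝ × ℝ) :
    fderiv ℝ (fun x => fderiv ℝ f x v) u w = fderiv ℝ (fun x => fderiv ℝ f x w) u v := by
  rw [fderiv_fderiv_apply hf, fderiv_fderiv_apply hf]
  exact (hf.isSymmSndFDerivAt (by
    rw [minSmoothness_of_isRCLikeNormedField]
    exact WithTop.coe_le_coe.2 (le_top (a := (2 : ℕ∞))))).eq w v

lemma secondForm_comm {φ : ℝ × ℝ → E3} {u : ℝ × ℝ} (hf : ContDiffAt ℝ ∞ φ u) (v w : ℝ × ℝ) :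
    secondForm φ u v w = secondForm φ u w v := by
  rw [secondForm, secondForm, fderiv_fderiv_comm hf]

lemma secondForm_combo {φ : ℝ × ℝ → E3} {u : ℝ × ℝ} (hf : ContDiffAt ℝ ∞ φ u)
    (v w v' w' : ℝ × ℝ) (a b a' b' : ℝ) :
    secondForm φ u (a • v + b • w) (a' • v' + b' • w')
      = a * a' * secondForm φ u v v' + a * b' * secondForm φ u v w'
        + b * a' * secondForm φ u w v' + b * b' * secondForm φ u w w' := by
  have h : ∀ x y, secondForm φ u x y = inner ℝ (fderiv ℝ (fderiv ℝ φ) u y x) (unitNormal φ u) :=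
    fun x y => by rw [secondForm, fderiv_fderiv_apply hf]
  simp only [h, map_add, map_smul, add_apply, smul_apply, inner_add_left, real_inner_smul_left]
  ring

lemma firstForm_combo (φ : ℝ × ℝ → E3) (u v w v' w' : ℝ × ℝ) (a b a' b' : ℝ) :
    firstForm φ u (a • v + b • w) (a' • v' + b' • w')
      = a * a' * firstForm φ u v v' + a * b' * firstForm φ u v w'
        + b * a' * firstForm φ u w v' + b * b' * firstForm φ u w w' := by
  simp only [firstForm, map_add, map_smul, inner_add_left, inner_add_right, real_inner_smul_left,
    real_inner_smul_right]
  ring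

lemma firstForm_comm (φ : ℝ × ℝ → E3) (u v w : ℝ × ℝ) :
    firstForm φ u v w = firstForm φ u w v := real_inner_comm _ _

lemma eq_combo (v : ℝ × ℝ) : v = v.1 • ((1 : ℝ), (0 : ℝ)) + v.2 • ((0 : ℝ), (1 : ℝ)) := by
  ext <;> simp

lemma norm_cross3_sq_eq_firstDet (φ : ℝ × ℝ → E3) (u : ℝ × ℝ) :
    ‖cross3 (fderiv ℝ φ u (1, 0)) (fderiv ℝ φ u (0, 1))‖ ^ 2 = firstDet φ u :=
  norm_cross3_sq _ _

lemma firstDet_pos {φ : ℝ × ℝ → E3} {u : ℝ × ℝ} (h : Function.Injective (fderiv ℝ φ u)) :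
    0 < firstDet φ u := by
  have h0 : 0 ≤ firstDet φ u := by rw [← norm_cross3_sq_eq_firstDet]; positivity
  refine lt_of_le_of_ne h0 fun h1 => ?_
  have hG : 0 < firstForm φ u (0, 1) (0, 1) := by
    refine real_inner_self_pos.2 fun h2 => ?_
    have := h (h2.trans (map_zero _).symm)
    simp at this
  -- The vector `G e₁ - F e₂` has squared length `G (EG - F²)`, so a vanishing determinant would put
  -- it in the kernel of the derivative.
  have h3 := firstForm_combo φ u (1, 0) (0, 1) (1, 0) (0, 1) (firstForm φ u (0, 1) (0, 1))
    (-firstForm φ u (1, 0) (0, 1)) (firstForm φ u (0, 1) (0, 1)) (-firstForm φ u (1, 0) (0, 1))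
  have h4 : firstForm φ u
      (firstForm φ u (0, 1) (0, 1) • (1, 0) + (-firstForm φ u (1, 0) (0, 1)) • (0, 1))
      (firstForm φ u (0, 1) (0, 1) • (1, 0) + (-firstForm φ u (1, 0) (0, 1)) • (0, 1)) = 0 := by
    rw [h3, firstForm_comm φ u (0, 1) (1, 0)]
    rw [firstDet] at h1
    linear_combination -firstForm φ u (0, 1) (0, 1) * h1
  have h5 := h ((inner_self_eq_zero.1 h4).trans (map_zero _).symm)
  have := congrArg Prod.fst h5
  simp at this
  exact hG.ne' this

lemma unitNormal_inner_self {φ : ℝ × ℝ → E3} {u : ℝ × ℝ} (h : Function.Injective (fderiv ℝ φ u)) :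
    inner ℝ (unitNormal φ u) (unitNormal φ u) = 1 := by
  have h1 := firstDet_pos h
  rw [← norm_cross3_sq_eq_firstDet] at h1
  rw [unitNormal, real_inner_smul_left, real_inner_smul_right, real_inner_self_eq_norm_sq]
  have : ‖cross3 (fderiv ℝ φ u (1, 0)) (fderiv ℝ φ u (0, 1))‖ ≠ 0 := by
    intro h2; rw [h2] at h1; simp at h1
  field_simp

lemma unitNormal_inner (φ : ℝ × ℝ → E3) (u v : ℝ × ℝ) :
    inner ℝ (unitNormal φ u) (fderiv ℝ φ u v) = 0 := by
  rw [eq_combo v, map_add, map_smul, map_smul, unitNormal, real_inner_smul_left, inner_add_right,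
    real_inner_smul_right, real_inner_smul_right, inner_cross3_left, inner_cross3_right]
  simp

lemma contDiffAt_unitNormal {φ : ℝ × ℝ → E3} {u : ℝ × ℝ} (hφ : ContDiffAt ℝ ∞ φ u)
    (h : Function.Injective (fderiv ℝ φ u)) : ContDiffAt ℝ ∞ (unitNormal φ) u := by
  have hc := (contDiffAt_fderiv_apply hφ (1, 0)).cross3 (contDiffAt_fderiv_apply hφ (0, 1))
  have h1 := firstDet_pos h
  rw [← norm_cross3_sq_eq_firstDet] at h1
  have h2 : cross3 (fderiv ℝ φ u (1, 0)) (fderiv ℝ φ u (0, 1)) ≠ 0 := by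
    intro h2; rw [h2] at h1; simp at h1
  exact ((hc.norm ℝ h2).inv (norm_ne_zero_iff.2 h2)).smul hc

lemma contDiffAt_firstForm {φ : ℝ × ℝ → E3} {u : ℝ × ℝ} (hφ : ContDiffAt ℝ ∞ φ u)
    (v w : ℝ × ℝ) : ContDiffAt ℝ ∞ (fun x => firstForm φ x v w) u :=
  (contDiffAt_fderiv_apply hφ v).inner ℝ (contDiffAt_fderiv_apply hφ w)

lemma contDiffAt_secondForm {φ : ℝ × ℝ → E3} {u : ℝ × ℝ} (hφ : ContDiffAt ℝ ∞ φ u)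
    (h : Function.Injective (fderiv ℝ φ u)) (v w : ℝ × ℝ) :
    ContDiffAt ℝ ∞ (fun x => secondForm φ x v w) u :=
  (contDiffAt_fderiv_apply (contDiffAt_fderiv_apply hφ v) w).inner ℝ (contDiffAt_unitNormal hφ h)

lemma contDiffAt_curvatures {φ : ℝ × ℝ → E3} {u : ℝ × ℝ} (hφ : ContDiffAt ℝ ∞ φ u)
    (h : Function.Injective (fderiv ℝ φ u)) :
    ContDiffAt ℝ ∞ (meanCurv φ) u ∧ ContDiffAt ℝ ∞ (gaussCurv φ) u := by
  have hI := contDiffAt_firstForm hφ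
  have hII := contDiffAt_secondForm hφ h
  have hd : ContDiffAt ℝ ∞ (firstDet φ) u := ((hI _ _).mul (hI _ _)).sub ((hI _ _).pow 2)
  have h0 := (firstDet_pos h).ne'
  constructor
  · exact ((((hI _ _).mul (hII _ _)).sub ((contDiffAt_const.mul (hI _ _)).mul (hII _ _))).add
      ((hI _ _).mul (hII _ _))).div (contDiffAt_const.mul hd) (mul_ne_zero two_ne_zero h0)
  · exact (((hII _ _).mul (hII _ _)).sub ((hII _ _).pow 2)).div hd h0

/-- The principal curvatures are roots of the characteristic equation in every basis. -/
lemma characteristic_equation {φ : ℝ × ℝ → E3} {u : ℝ × ℝ} (hφ : ContDiffAt ℝ ∞ φ u)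
    (h : Function.Injective (fderiv ℝ φ u)) {k : ℝ}
    (hk : k ^ 2 - 2 * meanCurv φ u * k + gaussCurv φ u = 0) (v w : ℝ × ℝ) :
    (secondForm φ u v v - k * firstForm φ u v v) * (secondForm φ u w w - k * firstForm φ u w w)
      = (secondForm φ u v w - k * firstForm φ u v w) ^ 2 := by
  have h0 := (firstDet_pos h).ne'
  have h1 : firstDet φ u * k ^ 2 - (firstForm φ u (1, 0) (1, 0) * secondForm φ u (0, 1) (0, 1)
    - 2 * firstForm φ u (1, 0) (0, 1) * secondForm φ u (1, 0) (0, 1)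
    + firstForm φ u (0, 1) (0, 1) * secondForm φ u (1, 0) (1, 0)) * k
    + (secondForm φ u (1, 0) (1, 0) * secondForm φ u (0, 1) (0, 1)
    - secondForm φ u (1, 0) (0, 1) ^ 2) = 0 := by
    rw [meanCurv, gaussCurv] at hk
    field_simp at hk
    linear_combination hk
  rw [firstDet] at h1
  rw [eq_combo v, eq_combo w]
  simp only [secondForm_combo hφ, firstForm_combo]
  rw [firstForm_comm φ u (0, 1) (1, 0), secondForm_comm hφ (0, 1) (1, 0)]
  -- Changing the basis multiplies the determinant of `II - k I` by the square of the determinant of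
  -- `(v, w)`.
  linear_combination (v.1 * w.2 - v.2 * w.1) ^ 2 * h1

lemma princCurv_root {φ : ℝ × ℝ → E3} {u : ℝ × ℝ} (h : 0 ≤ meanCurv φ u ^ 2 - gaussCurv φ u) :
    princCurv₁ φ u ^ 2 - 2 * meanCurv φ u * princCurv₁ φ u + gaussCurv φ u = 0 ∧
    princCurv₂ φ u ^ 2 - 2 * meanCurv φ u * princCurv₂ φ u + gaussCurv φ u = 0 := by
  have h1 := Real.sq_sqrt h
  rw [princCurv₁, princCurv₂]
  constructor <;> linear_combination h1

lemma discriminant_pos {φ : ℝ × ℝ → E3} {u : ℝ × ℝ} (h : ¬ IsUmbilic φ u) :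
    0 < meanCurv φ u ^ 2 - gaussCurv φ u := by
  by_contra h1
  refine h ?_
  rw [IsUmbilic, princCurv₁, princCurv₂, Real.sqrt_eq_zero_of_nonpos (not_lt.1 h1)]
  ring

lemma princCurv_lt {φ : ℝ × ℝ → E3} {u : ℝ × ℝ} (h : ¬ IsUmbilic φ u) :
    princCurv₂ φ u < princCurv₁ φ u := by
  have := Real.sqrt_pos.2 (discriminant_pos h)
  rw [princCurv₁, princCurv₂]
  linarith

/-! ## The third order expansion of a surface over its tangent plane -/

lemma exists_frame {a b c : E3} (ha : inner ℝ a a = 1) (hb : inner ℝ b b = 1)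
    (hc : inner ℝ c c = 1) (hab : inner ℝ a b = 0) (hca : inner ℝ c a = 0)
    (hcb : inner ℝ c b = 0) :
    ∃ A : E3 ≃ₗᵢ[ℝ] E3, ∀ x, A x 0 = inner ℝ a x ∧ A x 1 = inner ℝ b x ∧ A x 2 = inner ℝ c x := by
  have ho : Orthonormal ℝ ![a, b, c] := by
    rw [orthonormal_iff_ite]
    intro i j
    have hba := real_inner_comm a b
    have hac := real_inner_comm c a
    have hbc := real_inner_comm c b
    fin_cases i <;> fin_cases j <;> simp_all
  have hcard : Fintype.card (Fin 3) = Module.finrank ℝ E3 := by simp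
  let B := basisOfOrthonormalOfCardEqFinrank ho hcard
  have hB : ⇑B = ![a, b, c] := coe_basisOfOrthonormalOfCardEqFinrank ho hcard
  let O : OrthonormalBasis (Fin 3) ℝ E3 := B.toOrthonormalBasis (by rw [hB]; exact ho)
  have hO : ⇑O = ![a, b, c] := by rw [B.coe_toOrthonormalBasis, hB]
  refine ⟨O.repr, fun x => ?_⟩
  simp only [O.repr_apply_apply, hO]
  exact ⟨rfl, rfl, rfl⟩

/-- The derivative of a principal curvature along its own line of curvature. -/
lemma fderiv_princCurv {φ : ℝ × ℝ → E3} {p v w : ℝ × ℝ} {k : ℝ × ℝ → ℝ}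
    (hev : ∀ᶠ u in 𝓝 p, ContDiffAt ℝ ∞ φ u) (hinj : ∀ᶠ u in 𝓝 p, Function.Injective (fderiv ℝ φ u))
    (hk : DifferentiableAt ℝ k p)
    (hroot : ∀ᶠ u in 𝓝 p, k u ^ 2 - 2 * meanCurv φ u * k u + gaussCurv φ u = 0)
    (hv : firstForm φ p v v = 1) (hw : firstForm φ p w w = 1) (hvw : firstForm φ p v w = 0)
    (hkv : ∀ x, secondForm φ p v x = k p * firstForm φ p v x)
    (hkw : secondForm φ p w w ≠ k p) :
    fderiv ℝ k p v = inner ℝ (fderiv ℝ (fun y => fderiv ℝ (fun x => fderiv ℝ φ x v) y v) p v)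
        (unitNormal φ p)
      - 3 * k p * inner ℝ (fderiv ℝ φ p v) (fderiv ℝ (fun x => fderiv ℝ φ x v) p v) := by
  have hinjp := hinj.self_of_nhds
  have hφ := hev.self_of_nhds
  have hn := (contDiffAt_unitNormal hφ hinjp).differentiableAt_top
  have h1 := contDiffAt_fderiv_apply hφ
  have h2 : ∀ v w, ContDiffAt ℝ ∞ (fun y => fderiv ℝ (fun x => fderiv ℝ φ x v) y w) p :=
    fun v w => contDiffAt_fderiv_apply (h1 v) w
  -- the derivative of the normal
  have hnn : inner ℝ (fderiv ℝ (unitNormal φ) p v) (unitNormal φ p) = 0 := by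
    have e1 : (fun u => inner ℝ (unitNormal φ u) (unitNormal φ u)) =ᶠ[𝓝 p] fun _ => (1 : ℝ) := by
      filter_upwards [hinj] with u hu using unitNormal_inner_self hu
    have e2 := e1.fderiv_eq (𝕜 := ℝ)
    have e3 := congrArg (fun L : (ℝ × ℝ) →L[ℝ] ℝ => L v) e2
    simp only [fderiv_inner_apply ℝ hn hn, fderiv_fun_const] at e3
    rw [real_inner_comm] at e3
    simp at e3
    exact e3
  have hnx : ∀ x, inner ℝ (fderiv ℝ (unitNormal φ) p v) (fderiv ℝ φ p x) = -secondForm φ p v x := by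
    intro x
    have e1 : (fun u => inner ℝ (unitNormal φ u) (fderiv ℝ φ u x)) = fun _ => (0 : ℝ) :=
      funext fun u => unitNormal_inner φ u x
    have e3 := congrArg (fun f : ℝ × ℝ → ℝ => fderiv ℝ f p v) e1
    simp only [fderiv_inner_apply ℝ hn (h1 x).differentiableAt_top, fderiv_fun_const] at e3
    rw [secondForm_comm hφ, secondForm, real_inner_comm]
    simp at e3
    rw [real_inner_comm] at e3 ⊢
    linarith
  obtain ⟨A, hA⟩ := exists_frame (a := fderiv ℝ φ p v) (b := fderiv ℝ φ p w)
    (c := unitNormal φ p) hv hw (unitNormal_inner_self hinjp) hvw (unitNormal_inner φ p v)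
    (unitNormal_inner φ p w)
  -- Rodrigues' formula: in a principal direction the derivative of the normal is `-k` times the
  -- tangent vector.
  have hshape : ∀ x : E3, inner ℝ x (fderiv ℝ (unitNormal φ) p v)
      = -(k p * inner ℝ (fderiv ℝ φ p v) x) := by
    intro x
    rw [← A.inner_map_map, inner_eq3]
    simp only [hA]
    rw [real_inner_comm (fderiv ℝ (unitNormal φ) p v) (fderiv ℝ φ p v),
      real_inner_comm (fderiv ℝ (unitNormal φ) p v) (fderiv ℝ φ p w),
      real_inner_comm (fderiv ℝ (unitNormal φ) p v) (unitNormal φ p), hnn, hnx, hnx, hkv, hkv,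
      hv, hvw]
    ring
  -- derivatives of the fundamental forms
  have hI := contDiffAt_firstForm hφ
  have hII := contDiffAt_secondForm hφ hinjp
  have dI : fderiv ℝ (fun u => firstForm φ u v v) p v
      = 2 * inner ℝ (fderiv ℝ φ p v) (fderiv ℝ (fun x => fderiv ℝ φ x v) p v) := by
    simp only [firstForm]
    rw [fderiv_inner_apply ℝ (h1 v).differentiableAt_top (h1 v).differentiableAt_top,
      real_inner_comm (fderiv ℝ φ p v)]
    ring
  have dII : fderiv ℝ (fun u => secondForm φ u v v) p v
      = inner ℝ (fderiv ℝ (fun y => fderiv ℝ (fun x => fderiv ℝ φ x v) y v) p v) (unitNormal φ p)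
        - k p * inner ℝ (fderiv ℝ φ p v) (fderiv ℝ (fun x => fderiv ℝ φ x v) p v) := by
    simp only [secondForm]
    rw [fderiv_inner_apply ℝ (h2 v v).differentiableAt_top hn, hshape]
    ring
  -- the derivative of the characteristic equation
  have hB : ∀ x y, DifferentiableAt ℝ (fun u => secondForm φ u x y - k u * firstForm φ u x y) p :=
    fun x y => (hII x y).differentiableAt_top.sub (hk.mul (hI x y).differentiableAt_top)
  have e1 : (fun u => (secondForm φ u v v - k u * firstForm φ u v v)
      * (secondForm φ u w w - k u * firstForm φ u w w)) =ᶠ[𝓝 p]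
      fun u => (secondForm φ u v w - k u * firstForm φ u v w) ^ 2 := by
    filter_upwards [hev, hinj, hroot] with u h h' h'' using characteristic_equation h h' h'' v w
  have e2 := congrArg (fun L : (ℝ × ℝ) →L[ℝ] ℝ => L v) e1.fderiv_eq
  have z1 : secondForm φ p v v - k p * firstForm φ p v v = 0 := by rw [hkv]; ring
  have z2 : secondForm φ p v w - k p * firstForm φ p v w = 0 := by rw [hkv]; ring
  rw [fderiv_fun_mul (hB v v) (hB w w), fderiv_fun_pow 2 (hB v w), z1, z2] at e2
  simp only [add_apply, smul_apply, smul_eq_mul, hw, mul_one] at e2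
  -- At `p` the squared term has zero derivative and the `(w, w)` factor is nonzero, so the `(v, v)`
  -- factor vanishes to first order. Since `v` and `w` are constant parameter vectors, no field of
  -- principal directions has to be differentiated.
  have e3 : fderiv ℝ (fun u => secondForm φ u v v - k u * firstForm φ u v v) p v = 0 := by
    refine (mul_eq_zero.1 ?_).resolve_left (sub_ne_zero.2 hkw)
    rw [zero_mul, zero_add] at e2
    rw [e2]
    simp
  rw [fderiv_fun_sub (hII v v).differentiableAt_top (hk.fun_mul (hI v v).differentiableAt_top),
    fderiv_fun_mul hk (hI v v).differentiableAt_top] at e3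
  simp only [sub_apply, add_apply, smul_apply, smul_eq_mul, hv, dI, dII] at e3
  linarith

/-- The expansion of the coordinates of a smooth surface along a line of the parameter plane. -/
lemma inner_expansion {φ : ℝ × ℝ → E3} {p : ℝ × ℝ} (hev : ∀ᶠ u in 𝓝 p, ContDiffAt ℝ ∞ φ u)
    (x : E3) (v : ℝ × ℝ) :
    ((fun s : ℝ => inner ℝ x (φ (p + s • v) - φ p) - (s * inner ℝ x (fderiv ℝ φ p v)
      + s ^ 2 * (inner ℝ x (fderiv ℝ (fun y => fderiv ℝ φ y v) p v) / 2)))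
      =o[𝓝 0] fun s : ℝ => s ^ 2) ∧
    (fun s : ℝ => inner ℝ x (φ (p + s • v) - φ p) - (s * inner ℝ x (fderiv ℝ φ p v)
      + s ^ 2 * (inner ℝ x (fderiv ℝ (fun y => fderiv ℝ φ y v) p v) / 2)
      + s ^ 3 * (inner ℝ x (fderiv ℝ (fun z => fderiv ℝ (fun y => fderiv ℝ φ y v) z v) p v) / 6)))
      =o[𝓝 0] fun s : ℝ => s ^ 3 := by
  have hline : Tendsto (fun s : ℝ => p + s • v) (𝓝 0) (𝓝 p) := by
    have : Continuous fun s : ℝ => p + s • v := by fun_prop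
    simpa using this.tendsto 0
  have hd : ∀ {ψ : ℝ × ℝ → E3} {s : ℝ}, ContDiffAt ℝ ∞ ψ (p + s • v) →
      HasDerivAt (fun s : ℝ => inner ℝ x (ψ (p + s • v)))
        (inner ℝ x (fderiv ℝ ψ (p + s • v) v)) s := by
    intro ψ s hψ
    have h1 : HasDerivAt (fun s : ℝ => p + s • v) v s := by
      simpa using ((hasDerivAt_id s).smul_const v).const_add p
    have h2 := hψ.differentiableAt_top.hasFDerivAt.comp_hasDerivAt s h1
    exact ((innerSL ℝ x).hasFDerivAt.comp_hasDerivAt s h2)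
  have hev' := hline.eventually hev
  have h0 : ∀ᶠ s in 𝓝 (0 : ℝ), HasDerivAt (fun s : ℝ => inner ℝ x (φ (p + s • v) - φ p))
      (inner ℝ x (fderiv ℝ φ (p + s • v) v)) s := by
    filter_upwards [hev'] with s hs
    simp only [inner_sub_right]
    exact (hd hs).sub_const _
  have h1 : ∀ᶠ s in 𝓝 (0 : ℝ), HasDerivAt (fun s : ℝ => inner ℝ x (fderiv ℝ φ (p + s • v) v))
      (inner ℝ x (fderiv ℝ (fun y => fderiv ℝ φ y v) (p + s • v) v)) s := by
    filter_upwards [hev'] with s hs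
    exact hd (ψ := fun y => fderiv ℝ φ y v) (contDiffAt_fderiv_apply hs v)
  have h2 : HasDerivAt (fun s : ℝ => inner ℝ x (fderiv ℝ (fun y => fderiv ℝ φ y v) (p + s • v) v))
      (inner ℝ x (fderiv ℝ (fun z => fderiv ℝ (fun y => fderiv ℝ φ y v) z v) (p + (0 : ℝ) • v) v))
      0 := hd (ψ := fun z => fderiv ℝ (fun y => fderiv ℝ φ y v) z v)
      (contDiffAt_fderiv_apply (contDiffAt_fderiv_apply hev'.self_of_nhds v) v)
  have t2 := taylor_two h0 h1.self_of_nhds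
  have t3 := taylor_three h0 h1 h2
  simp only [zero_smul, add_zero, sub_self, inner_zero_right, zero_add] at t2 t3
  exact ⟨t2, t3⟩

lemma norm_pow_five_isBigO : (fun q : ℝ × ℝ => ‖q‖ ^ 5) =O[𝓝 0] fun q => ‖q‖ ^ 4 := by
  refine IsBigO.of_bound 1 ?_
  filter_upwards [Metric.ball_mem_nhds (0 : ℝ × ℝ) one_pos] with q hq
  rw [mem_ball_zero_iff] at hq
  rw [norm_pow, norm_pow, norm_norm, one_mul]
  exact pow_le_pow_of_le_one (norm_nonneg _) hq.le (by norm_num)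

lemma quartic_isBigO (a b c d e : ℝ) : (fun q : ℝ × ℝ => (a * q.1 ^ 4 + 4 * b * q.1 ^ 3 * q.2
    + 6 * c * q.1 ^ 2 * q.2 ^ 2 + 4 * d * q.1 * q.2 ^ 3 + e * q.2 ^ 4) / 24)
    =O[𝓝 0] fun q => ‖q‖ ^ 4 := by
  have h1 : (fun q : ℝ × ℝ => q.1) =O[𝓝 0] fun q => ‖q‖ :=
    IsBigO.of_bound 1 (Eventually.of_forall fun q => by simpa using norm_fst_le q)
  have h2 : (fun q : ℝ × ℝ => q.2) =O[𝓝 0] fun q => ‖q‖ :=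
    IsBigO.of_bound 1 (Eventually.of_forall fun q => by simpa using norm_snd_le q)
  have t1 := (h1.pow 4).const_mul_left a
  have t2 := (((h1.pow 3).mul h2).const_mul_left (4 * b)).congr_right
    (g₂ := fun q => ‖q‖ ^ 4) fun q => by ring
  have t3 := (((h1.pow 2).mul (h2.pow 2)).const_mul_left (6 * c)).congr_right
    (g₂ := fun q => ‖q‖ ^ 4) fun q => by ring
  have t4 := ((h1.mul (h2.pow 3)).const_mul_left (4 * d)).congr_right
    (g₂ := fun q => ‖q‖ ^ 4) fun q => by ring
  have t5 := (h2.pow 4).const_mul_left e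
  refine (((((t1.add t2).add t3).add t4).add t5).const_mul_left (1 / 24)).congr_left fun q => ?_
  ring

lemma isBigO_four_of_five {f P : ℝ × ℝ → ℝ} {a b c d e : ℝ}
    (h : (fun q : ℝ × ℝ => f q - (P q + (a * q.1 ^ 4 + 4 * b * q.1 ^ 3 * q.2
      + 6 * c * q.1 ^ 2 * q.2 ^ 2 + 4 * d * q.1 * q.2 ^ 3 + e * q.2 ^ 4) / 24))
      =O[𝓝 0] fun q => ‖q‖ ^ 5) :
    (fun q => f q - P q) =O[𝓝 0] fun q => ‖q‖ ^ 4 :=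
  ((h.trans norm_pow_five_isBigO).add (quartic_isBigO a b c d e)).congr_left fun q => by ring

/-- The surface over its tangent plane, in the principal frame, to third order. -/
lemma exists_monge {U : Set (ℝ × ℝ)} {φ : ℝ × ℝ → E3} (hS : IsImmersedSurface U φ)
    {p : ℝ × ℝ} (hp : p ∈ U) (humb : ¬ IsUmbilic φ p)
    {w₁ w₂ : ℝ × ℝ} (hw : IsPrincipalFrame φ p w₁ w₂) :
    ∃ (A : E3 ≃ₗᵢ[ℝ] E3) (h : ℝ × ℝ → ℝ) (c21 c12 : ℝ),
      A (fderiv ℝ φ p w₁) = stdVec 0 ∧ A (fderiv ℝ φ p w₂) = stdVec 1 ∧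
      A (unitNormal φ p) = stdVec 2 ∧ ContDiffAt ℝ ∞ φ p ∧
      map (fun u => (A (φ u - φ p) 0, A (φ u - φ p) 1)) (𝓝 p) = 𝓝 (0 : ℝ × ℝ) ∧
      (∀ᶠ u in 𝓝 p, A (φ u - φ p) 2 = h (A (φ u - φ p) 0, A (φ u - φ p) 1)) ∧
      (fun q : ℝ × ℝ => h q - ((princCurv₁ φ p * q.1 ^ 2 + princCurv₂ φ p * q.2 ^ 2) / 2
        + (fderiv ℝ (princCurv₁ φ) p w₁ * q.1 ^ 3 + 3 * c21 * q.1 ^ 2 * q.2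
          + 3 * c12 * q.1 * q.2 ^ 2 + fderiv ℝ (princCurv₂ φ) p w₂ * q.2 ^ 3) / 6))
        =O[𝓝 0] fun q => ‖q‖ ^ 4 := by
  obtain ⟨hU, hφU, hinjU⟩ := hS
  obtain ⟨hw1, hw2, hk1, hk2⟩ := hw
  have hev : ∀ᶠ u in 𝓝 p, ContDiffAt ℝ ∞ φ u := by
    filter_upwards [hU.mem_nhds hp] with u hu using hφU.contDiffAt (hU.mem_nhds hu)
  have hφ := hev.self_of_nhds
  have hinj : ∀ᶠ u in 𝓝 p, Function.Injective (fderiv ℝ φ u) := by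
    filter_upwards [hU.mem_nhds hp] with u hu using hinjU u hu
  have hinjp := hinj.self_of_nhds
  have hlt := princCurv_lt humb
  -- the principal directions are orthogonal
  have h12 : firstForm φ p w₁ w₂ = 0 := by
    have e1 := hk1 w₂
    have e2 := hk2 w₁
    rw [secondForm_comm hφ, firstForm_comm, e1] at e2
    have : (princCurv₁ φ p - princCurv₂ φ p) * firstForm φ p w₁ w₂ = 0 := by
      linarith
    exact (mul_eq_zero.1 this).resolve_left (by linarith)
  -- smoothness of the principal curvatures
  obtain ⟨hH, hK⟩ := contDiffAt_curvatures hφ hinjp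
  have hdisc := discriminant_pos humb
  have hD : ContDiffAt ℝ ∞ (fun u => meanCurv φ u ^ 2 - gaussCurv φ u) p := (hH.pow 2).sub hK
  have hroot := hD.sqrt hdisc.ne'
  have hd1 : DifferentiableAt ℝ (princCurv₁ φ) p := (hH.add hroot).differentiableAt_top
  have hd2 : DifferentiableAt ℝ (princCurv₂ φ) p := (hH.sub hroot).differentiableAt_top
  have hpos : ∀ᶠ u in 𝓝 p, 0 < meanCurv φ u ^ 2 - gaussCurv φ u :=
    hD.continuousAt.eventually_const_lt hdisc
  have hk1' := fderiv_princCurv hev hinj hd1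
    (by filter_upwards [hpos] with u hu using (princCurv_root hu.le).1) hw1 hw2 h12 hk1
    (by rw [hk2, hw2, mul_one]; exact hlt.ne)
  have hk2' := fderiv_princCurv hev hinj hd2
    (by filter_upwards [hpos] with u hu using (princCurv_root hu.le).2) hw2 hw1
    (by rw [firstForm_comm, h12]) hk2 (by rw [hk1, hw1, mul_one]; exact hlt.ne')
  -- the frame
  obtain ⟨A, hA⟩ := exists_frame (a := fderiv ℝ φ p w₁) (b := fderiv ℝ φ p w₂)
    (c := unitNormal φ p) hw1 hw2 (unitNormal_inner_self hinjp) h12 (unitNormal_inner φ p w₁)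
    (unitNormal_inner φ p w₂)
  have hA1 : A (fderiv ℝ φ p w₁) = stdVec 0 := by
    obtain ⟨e0, e1, e2⟩ := hA (fderiv ℝ φ p w₁)
    rw [unitNormal_inner] at e2
    rw [show inner ℝ (fderiv ℝ φ p w₁) (fderiv ℝ φ p w₁) = (1 : ℝ) from hw1] at e0
    rw [real_inner_comm, show inner ℝ (fderiv ℝ φ p w₁) (fderiv ℝ φ p w₂) = (0 : ℝ) from h12] at e1
    ext i; fin_cases i <;> simp [stdVec, e0, e1, e2]
  have hA2 : A (fderiv ℝ φ p w₂) = stdVec 1 := by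
    obtain ⟨e0, e1, e2⟩ := hA (fderiv ℝ φ p w₂)
    rw [unitNormal_inner] at e2
    rw [show inner ℝ (fderiv ℝ φ p w₂) (fderiv ℝ φ p w₂) = (1 : ℝ) from hw2] at e1
    rw [show inner ℝ (fderiv ℝ φ p w₁) (fderiv ℝ φ p w₂) = (0 : ℝ) from h12] at e0
    ext i; fin_cases i <;> simp [stdVec, e0, e1, e2]
  have hA3 : A (unitNormal φ p) = stdVec 2 := by
    obtain ⟨e0, e1, e2⟩ := hA (unitNormal φ p)
    rw [unitNormal_inner_self hinjp] at e2
    rw [real_inner_comm, unitNormal_inner] at e0 e1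
    ext i; fin_cases i <;> simp [stdVec, e0, e1, e2]
  -- the graph
  have hY : ContDiffAt ℝ ∞ (fun u => A (φ u - φ p)) p :=
    (A : E3 →L[ℝ] E3).contDiff.contDiffAt.comp p (hφ.sub contDiffAt_const)
  have hY' : ∀ v, fderiv ℝ (fun u => A (φ u - φ p)) p v = A (fderiv ℝ φ p v) := by
    intro v
    have := (hasFDerivAt_frame A (φ p)).comp p hφ.differentiableAt_top.hasFDerivAt
    rw [show (fun u => A (φ u - φ p)) = (fun x => A (x - φ p)) ∘ φ from rfl, this.fderiv]
    rfl
  obtain ⟨hmap, h, hh, hgraph⟩ := exists_graph (l := 1) one_pos hY (by simp)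
    (by rw [hY', hA1, one_smul]) (by rw [hY', hA2, one_smul])
  obtain ⟨c, hc⟩ := exists_taylor_four hh
  have hc3 : (fun q : ℝ × ℝ => h q - (c 0 0 + (c 1 0 * q.1 + c 0 1 * q.2)
      + (c 2 0 * q.1 ^ 2 + 2 * c 1 1 * q.1 * q.2 + c 0 2 * q.2 ^ 2) / 2 + (c 3 0 * q.1 ^ 3
      + 3 * c 2 1 * q.1 ^ 2 * q.2 + 3 * c 1 2 * q.1 * q.2 ^ 2 + c 0 3 * q.2 ^ 3) / 6))
      =O[𝓝 0] fun q => ‖q‖ ^ 4 := isBigO_four_of_five hc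
  -- The coefficients of `h` are read along the images of straight lines in the parameter plane; the
  -- tangential accelerations `q₁`, `q₂` enter the cubic term.
  have key : ∀ a b : ℝ, _ := fun a b => expansion_along_curve hc3
    (a := a) (b := b)
    (y₁ := fun s => A (φ (p + s • (a • w₁ + b • w₂)) - φ p) 0)
    (y₂ := fun s => A (φ (p + s • (a • w₁ + b • w₂)) - φ p) 1)
    (y₃ := fun s => A (φ (p + s • (a • w₁ + b • w₂)) - φ p) 2)
    (q₁ := inner ℝ (fderiv ℝ φ p w₁)
      (fderiv ℝ (fun y => fderiv ℝ φ y (a • w₁ + b • w₂)) p (a • w₁ + b • w₂)) / 2)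
    (q₂ := inner ℝ (fderiv ℝ φ p w₂)
      (fderiv ℝ (fun y => fderiv ℝ φ y (a • w₁ + b • w₂)) p (a • w₁ + b • w₂)) / 2)
    (r₂ := (princCurv₁ φ p * a ^ 2 + princCurv₂ φ p * b ^ 2) / 2)
    (r₃ := inner ℝ (unitNormal φ p)
      (fderiv ℝ (fun z => fderiv ℝ (fun y => fderiv ℝ φ y (a • w₁ + b • w₂)) z (a • w₁ + b • w₂))
        p (a • w₁ + b • w₂)) / 6)
    (by
      have := (inner_expansion hev (fderiv ℝ φ p w₁) (a • w₁ + b • w₂)).1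
      rw [show inner ℝ (fderiv ℝ φ p w₁) (fderiv ℝ φ p (a • w₁ + b • w₂)) = a from by
        have := firstForm_combo φ p w₁ w₁ w₁ w₂ 1 0 a b
        rw [hw1, h12] at this
        simpa [firstForm] using this] at this
      simpa only [(hA _).1] using this)
    (by
      have := (inner_expansion hev (fderiv ℝ φ p w₂) (a • w₁ + b • w₂)).1
      rw [show inner ℝ (fderiv ℝ φ p w₂) (fderiv ℝ φ p (a • w₁ + b • w₂)) = b from by
        have := firstForm_combo φ p w₂ w₂ w₁ w₂ 1 0 a b
        rw [hw2, firstForm_comm φ p w₂ w₁, h12] at this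
        simpa [firstForm] using this] at this
      simpa only [(hA _).2.1] using this)
    (by
      have := (inner_expansion hev (unitNormal φ p) (a • w₁ + b • w₂)).2
      rw [unitNormal_inner, show inner ℝ (unitNormal φ p) (fderiv ℝ
        (fun y => fderiv ℝ φ y (a • w₁ + b • w₂)) p (a • w₁ + b • w₂))
        = princCurv₁ φ p * a ^ 2 + princCurv₂ φ p * b ^ 2 from by
          have e := secondForm_combo hφ w₁ w₂ w₁ w₂ a b a b
          rw [hk1, hk1, hk2, hk2, firstForm_comm φ p w₂ w₁, h12, hw1, hw2] at e
          rw [real_inner_comm]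
          refine e.trans ?_
          ring] at this
      simpa only [(hA _).2.2, mul_zero, zero_add] using this)
    (by
      have hline : Tendsto (fun s : ℝ => p + s • (a • w₁ + b • w₂)) (𝓝 0) (𝓝 p) := by
        have : Continuous fun s : ℝ => p + s • (a • w₁ + b • w₂) := by fun_prop
        simpa using this.tendsto 0
      exact hline.eventually hgraph)
  have k10 := key 1 0
  have k01 := key 0 1
  have k11 := key 1 1
  simp only [one_smul, zero_smul, add_zero, zero_add, mul_one, mul_zero, one_pow, ne_eq,
    OfNat.ofNat_ne_zero, not_false_eq_true, zero_pow, zero_mul] at k10 k01 k11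
  obtain ⟨z00, z10, k10⟩ := k10
  obtain ⟨-, z01, k01⟩ := k01
  -- The cubic identity on each axis contains the same acceleration term as `fderiv_princCurv`,
  -- which makes the pure cubic coefficients the derivatives of the principal curvatures.
  obtain ⟨e20, e30⟩ := k10 z10 z01
  obtain ⟨e02, e03⟩ := k01 z10 z01
  obtain ⟨e11, -⟩ := k11.2.2 z10 z01
  have z20 : c 2 0 = princCurv₁ φ p := by linarith
  have z02 : c 0 2 = princCurv₂ φ p := by linarith
  have z11 : c 1 1 = 0 := by rw [z20, z02] at e11; linarith
  rw [real_inner_comm] at hk1' hk2'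
  rw [z20, z11] at e30
  rw [z02, z11] at e03
  refine ⟨A, h, c 2 1, c 1 2, hA1, hA2, hA3, hφ, hmap, hgraph, hc3.congr_left fun q => ?_⟩
  rw [hk1', hk2', z00, z10, z01, z20, z02, z11]
  linear_combination -q.1 ^ 3 * e30 - q.2 ^ 3 * e03

/-! ## The standard position of a surface -/

lemma contDiffAt_normMap (l : ℝ) (m : E3) : ContDiffAt ℝ ∞ (normMap l m) 0 := by
  have h1 : ContDiff ℝ ∞ (normDen l m) := by
    have : ContDiff ℝ ∞ fun y : E3 => 1 + 2 / l * inner ℝ y m + ‖m‖ ^ 2 / l ^ 2 * ‖y‖ ^ 2 :=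
      (contDiff_const.add (contDiff_const.mul (contDiff_id.inner ℝ contDiff_const))).add
        (contDiff_const.mul (contDiff_norm_sq ℝ))
    exact this
  have h2 : ContDiff ℝ ∞ fun y : E3 => l • y + ‖y‖ ^ 2 • m :=
    (contDiff_id.const_smul l).add ((contDiff_norm_sq ℝ).smul contDiff_const)
  exact (h1.contDiffAt.inv (by simp [normDen])).smul h2.contDiffAt

lemma eq_vec_of_apply {x : E3} {f : ℝ × ℝ → ℝ} (h : x 2 = f (x 0, x 1)) :
    x = !₂[x 0, x 1, f (x 0, x 1)] := by
  ext i; fin_cases i <;> simp [h]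

/-- Proportional lifts induce the same projective map, and the domain is visible on the lift as the
set where the first coordinate is nonzero. -/
lemma Moebius.image_eq_of_lift {T : LV →ₗ[ℝ] LV} {κ : ℝ} (hκ : κ ≠ 0) {g g' : Moebius}
    (hg : IsLiftOf T g) (hg' : IsLiftOf (κ • T) g') (C : Set E3) : g'.image C = g.image C := by
  have hmem : ∀ {S : LV →ₗ[ℝ] LV} {g : Moebius}, IsLiftOf S g → ∀ x,
      x ∈ g.domain ↔ (S (lift x)).1 ≠ 0 := by
    intro S g hg x
    refine ⟨fun hx => ?_, fun hx => by_contra fun h => hx (hg.2 x h)⟩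
    obtain ⟨d, hd, h⟩ := hg.1 x hx
    rw [h]
    simpa [lift] using hd
  have hdom : g'.domain = g.domain := by
    ext x
    rw [hmem hg, hmem hg', LinearMap.smul_apply]
    simp [hκ]
  rw [Moebius.image, Moebius.image, hdom]
  refine image_congr fun x hx => ?_
  obtain ⟨d, hd, h⟩ := hg.1 x hx.2
  obtain ⟨d', hd', h'⟩ := hg'.1 x (hdom ▸ hx.2)
  rw [LinearMap.smul_apply, h, smul_smul] at h'
  have h1 : κ * d = d' := by simpa [lift] using congrArg Prod.fst h'
  have h2 : (κ * d) • g.toFun x = d' • g'.toFun x := congrArg (fun v : LV => v.2.1) h'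
  rw [h1] at h2
  exact (smul_right_injective E3 hd' h2).symm

lemma eq_smul_of_frame {L : E3 →L[ℝ] E3} {A : E3 ≃ₗᵢ[ℝ] E3} {l : ℝ} {x₀ x₁ x₂ : E3}
    (a₀ : A x₀ = stdVec 0) (a₁ : A x₁ = stdVec 1) (a₂ : A x₂ = stdVec 2)
    (h₀ : L x₀ = l • stdVec 0) (h₁ : L x₁ = l • stdVec 1) (h₂ : L x₂ = l • stdVec 2) (v : E3) :
    L v = l • A v := by
  have hv : v = A v 0 • x₀ + A v 1 • x₁ + A v 2 • x₂ := by
    apply A.injective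
    simp only [map_add, map_smul, a₀, a₁, a₂]
    ext i; fin_cases i <;> simp [stdVec]
  conv_lhs => rw [hv]
  conv_rhs => rw [hv]
  simp only [map_add, map_smul, a₀, a₁, a₂, h₀, h₁, h₂]
  module

/-- Every surface has an essentially unique standard position at a non-umbilic point. -/
lemma exists_standard_position {U : Set (ℝ × ℝ)} {φ : ℝ × ℝ → E3} (hS : IsImmersedSurface U φ)
    {p : ℝ × ℝ} (hp : p ∈ U) (humb : ¬ IsUmbilic φ p)
    {w₁ w₂ : ℝ × ℝ} (hw : IsPrincipalFrame φ p w₁ w₂) :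
    ∃ (κ : ℝ) (T : LV ≃ₗ[ℝ] LV) (g : Moebius) (f : ℝ × ℝ → ℝ) (a b c d Ψ : ℝ),
      IsConformal κ (T : LV →ₗ[ℝ] LV) ∧ IsLiftOf (T : LV →ₗ[ℝ] LV) g ∧
      SurfaceInStandardPosition g φ p w₁ w₂ f ∧
      ((fun q : ℝ × ℝ => f q - ((q.1 ^ 2 - q.2 ^ 2) / 2
        + (theta₁ φ p w₁ * q.1 ^ 3 + theta₂ φ p w₂ * q.2 ^ 3) / 6
        + (a * q.1 ^ 4 + 4 * b * q.1 ^ 3 * q.2 + 6 * Ψ * q.1 ^ 2 * q.2 ^ 2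
          + 4 * c * q.1 * q.2 ^ 3 + d * q.2 ^ 4) / 24))
        =O[𝓝 0] fun q => ‖q‖ ^ 5) ∧
      ∀ g' f', SurfaceInStandardPosition g' φ p w₁ w₂ f' →
        (∀ C, g'.image C = g.image C) ∧ f' =ᶠ[𝓝 0] f := by
  obtain ⟨A, h, c21, c12, hA1, hA2, hA3, hφ, hmap, hgraph, hh⟩ := exists_monge hS hp humb hw
  have hlt := princCurv_lt humb
  rw [theta₁, theta₂]
  obtain ⟨l, hl_def⟩ : ∃ l, l = halfDiff φ p := ⟨_, rfl⟩
  rw [← hl_def]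
  rw [halfDiff] at hl_def
  generalize princCurv₁ φ p = k₁ at *
  generalize princCurv₂ φ p = k₂ at *
  generalize fderiv ℝ (princCurv₁ φ) p w₁ = c30 at *
  generalize fderiv ℝ (princCurv₂ φ) p w₂ = c03 at *
  have hl : 0 < l := by linarith
  -- transfer of graph equations
  have transfer : ∀ {l' : ℝ} {n' : E3} {f' : ℝ × ℝ → ℝ},
      (∀ᶠ u in 𝓝 p, normMap l' (l' • n') (A (φ u - φ p)) 2
        = f' (normMap l' (l' • n') (A (φ u - φ p)) 0, normMap l' (l' • n') (A (φ u - φ p)) 1)) →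
      ∀ᶠ q in 𝓝 (0 : ℝ × ℝ), normMap l' (l' • n') !₂[q.1, q.2, h q] 2
        = f' (normMap l' (l' • n') !₂[q.1, q.2, h q] 0,
          normMap l' (l' • n') !₂[q.1, q.2, h q] 1) := by
    intro l' n' f' hf'
    rw [← hmap, eventually_map]
    filter_upwards [hf', hgraph] with u hu hu'
    rw [eq_vec_of_apply hu'] at hu
    exact hu
  have hφd : HasFDerivAt (fun u => A (φ u - φ p)) ((A : E3 →L[ℝ] E3) ∘L fderiv ℝ φ p) p :=
    (hasFDerivAt_frame A (φ p)).comp p hφ.differentiableAt_top.hasFDerivAt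
  have hYs : ContDiffAt ℝ ∞ (fun u => A (φ u - φ p)) p :=
    (A : E3 →L[ℝ] E3).contDiff.contDiffAt.comp p (hφ.sub contDiffAt_const)
  -- The third component makes the principal curvatures opposite, and the scale `l = (k₁ - k₂) / 2`
  -- makes them `±1`. The first two components cancel the mixed cubic terms `c12 / 2 - 2 l n₀` and
  -- `c21 / 2 + 2 l n₁`.
  obtain ⟨n, hn0, hn1, hn2⟩ : ∃ n : E3, n 0 = c12 / (4 * l) ∧ n 1 = -c21 / (4 * l) ∧
      n 2 = -(k₁ + k₂) / 4 := ⟨!₂[c12 / (4 * l), -c21 / (4 * l), -(k₁ + k₂) / 4], rfl, rfl, rfl⟩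
  have hT := (normLift_conformal hl (l • n)).comp (isoLift_conformal (frameMap (φ p) A))
  obtain ⟨g, hg⟩ := exists_moebius_of_conformal hT
  obtain ⟨hgd, hgf⟩ := moebius_of_normLift (one_ne_zero (α := ℝ)) (by rw [one_smul]; exact hg)
  have hgφ : ∀ {g : Moebius} {l : ℝ} {m : E3}, φ p ∈ g.domain →
      (∀ x ∈ g.domain, g.toFun x = normMap l m (A (x - φ p))) →
      ∀ᶠ u in 𝓝 p, g.toFun (φ u) = normMap l m (A (φ u - φ p)) := by
    intro g l m hd hx
    filter_upwards [hφ.continuousAt.eventually_mem (domain_mem_nhds hd)] with u hu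
    exact hx _ hu
  -- the graph
  have hn0s : ContDiffAt ℝ ∞ (normMap l (l • n)) (A (φ p - φ p)) := by
    rw [sub_self, map_zero]; exact contDiffAt_normMap _ _
  have hnd : HasFDerivAt (normMap l (l • n)) (l • ContinuousLinearMap.id ℝ E3)
      (A (φ p - φ p)) := by
    rw [sub_self, map_zero]; exact normMap_hasFDerivAt _ _
  have hYd := (hnd.comp p hφd).fderiv
  obtain ⟨hmap', f, hf, hfgraph⟩ := exists_graph
    (Y := fun u => normMap l (l • n) (A (φ u - φ p))) hl
    (ContDiffAt.comp (g := normMap l (l • n)) (f := fun u => A (φ u - φ p)) p hn0s hYs)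
    (by rw [sub_self, map_zero, normMap_zero])
    (show fderiv ℝ (normMap l (l • n) ∘ fun u => A (φ u - φ p)) p w₁ = _ by
      rw [hYd]; simp [hA1])
    (show fderiv ℝ (normMap l (l • n) ∘ fun u => A (φ u - φ p)) p w₂ = _ by
      rw [hYd]; simp [hA2])
  obtain ⟨c, hc⟩ := exists_taylor_four hf
  have key := expansion_of_normMap hl n hh (isBigO_four_of_five hc) (transfer hfgraph)
  have hexp : (fun q : ℝ × ℝ => f q - ((q.1 ^ 2 - q.2 ^ 2) / 2
        + (c30 / l ^ 2 * q.1 ^ 3 + c03 / l ^ 2 * q.2 ^ 3) / 6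
        + (c 4 0 * q.1 ^ 4 + 4 * c 3 1 * q.1 ^ 3 * q.2 + 6 * c 2 2 * q.1 ^ 2 * q.2 ^ 2
          + 4 * c 1 3 * q.1 * q.2 ^ 3 + c 0 4 * q.2 ^ 4) / 24))
        =O[𝓝 0] fun q => ‖q‖ ^ 5 := by
    have K10 := key 1 0
    have K01 := key 0 1
    have z00 := K10.1
    have z10 : c 1 0 = 0 := by linarith [K10.2.1]
    have z01 : c 0 1 = 0 := by linarith [K01.2.1]
    have K := fun a b => (key a b).2.2 z10 z01
    have q10 := (K 1 0).1
    have q01 := (K 0 1).1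
    have q11 := (K 1 1).1
    have z20 : c 2 0 = 1 := by
      have : l * (c 2 0 - 1) = 0 := by rw [hn2] at q10; linarith
      linarith [(mul_eq_zero.1 this).resolve_left hl.ne']
    have z02 : c 0 2 = -1 := by
      have : l * (c 0 2 + 1) = 0 := by rw [hn2] at q01; linarith
      linarith [(mul_eq_zero.1 this).resolve_left hl.ne']
    have z11 : c 1 1 = 0 := by
      have : l * c 1 1 = 0 := by rw [hn2, z20, z02] at q11; linarith
      exact (mul_eq_zero.1 this).resolve_left hl.ne'
    have K3 : ∀ a b : ℝ, (c30 * a ^ 3 + c03 * b ^ 3) = l ^ 2 * (c 3 0 * a ^ 3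
        + 3 * c 2 1 * a ^ 2 * b + 3 * c 1 2 * a * b ^ 2 + c 0 3 * b ^ 3) := by
      intro a b
      have := (K a b).2
      rw [z20, z02, z11] at this
      have e0 : l * n 0 = c12 / 4 := by rw [hn0]; field_simp
      have e1 : l * n 1 = -c21 / 4 := by rw [hn1]; field_simp
      linear_combination 6 * this + 12 * a * b ^ 2 * e0 - 12 * a ^ 2 * b * e1
    have hl2 : l ^ 2 ≠ 0 := by positivity
    have z30 : c30 = l ^ 2 * c 3 0 := by linarith [K3 1 0]
    have z03 : c03 = l ^ 2 * c 0 3 := by linarith [K3 0 1]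
    have z21 : c 2 1 = 0 := by
      have : l ^ 2 * c 2 1 = 0 := by linarith [K3 1 1, K3 1 (-1), K3 0 1]
      exact (mul_eq_zero.1 this).resolve_left hl2
    have z12 : c 1 2 = 0 := by
      have : l ^ 2 * c 1 2 = 0 := by linarith [K3 1 1, K3 1 (-1), K3 1 0]
      exact (mul_eq_zero.1 this).resolve_left hl2
    refine hc.congr_left fun q => ?_
    rw [z00, z10, z01, z20, z02, z11, z21, z12, z30, z03]
    field_simp
    ring
  refine ⟨_, hT.equiv, g, f, c 4 0, c 3 1, c 1 3, c 0 4, c 2 2, hT, hg, ?_, hexp, ?_⟩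
  · refine ⟨hgd, by rw [hgf _ hgd, sub_self, map_zero, normMap_zero], ⟨l, hl, ?_, ?_, ?_⟩, ?_, ?_⟩
    · rw [moebius_hasFDerivAt hgd hgf, hA1]
    · rw [moebius_hasFDerivAt hgd hgf, hA2]
    · rw [moebius_hasFDerivAt hgd hgf, hA3]
    · filter_upwards [hgφ hgd hgf, hfgraph] with u hu hu'
      rw [hu]; exact hu'
    · exact ⟨c 2 2, c30 / l ^ 2, c03 / l ^ 2, c 4 0, c 3 1, c 1 3, c 0 4, hexp⟩
  · rintro g' f' ⟨hgd', hg0', ⟨l', hl', e1, e2, e3⟩, hgraph', Ψ', t₁, t₂, a', b', c', d', hf'⟩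
    obtain ⟨_, T', hT', hTg'⟩ := exists_lift_of_moebius g'
    obtain ⟨m, κ, hκ, hTm⟩ := exists_normLift hT' hTg' hl' hgd' hg0'
      (eq_smul_of_frame hA1 hA2 hA3 e1 e2 e3)
    obtain ⟨n', rfl⟩ : ∃ n', m = l' • n' := ⟨l'⁻¹ • m, (smul_inv_smul₀ hl'.ne' m).symm⟩
    rw [hTm] at hTg'
    have hgf' := (moebius_of_normLift hκ hTg').2
    have hgr : ∀ᶠ u in 𝓝 p, normMap l' (l' • n') (A (φ u - φ p)) 2
        = f' (normMap l' (l' • n') (A (φ u - φ p)) 0, normMap l' (l' • n') (A (φ u - φ p)) 1) := by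
      filter_upwards [hgφ hgd' hgf', hgraph'] with u hu hu'
      rw [← hu]; exact hu'
    -- The same coefficient equations, now with the standard target prescribed, force `l'` and `n'`.
    have key' := expansion_of_normMap (c00 := 0) (α₁ := 0) (α₂ := 0) (β₁ := 1) (β₂ := 0) (β₃ := -1)
      (g30 := t₁) (g21 := 0) (g12 := 0) (g03 := t₂) hl' n' hh
      ((isBigO_four_of_five hf').congr_left fun q => by ring) (transfer hgr)
    have K := fun a b => (key' a b).2.2 rfl rfl
    have q10 := (K 1 0).1
    have q01 := (K 0 1).1
    have hll : l' = l := by linarith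
    subst hll
    have z2 : n' 2 = -(k₁ + k₂) / 4 := by linarith
    have c11 := (K 1 1).2
    have c1m := (K 1 (-1)).2
    have c10 := (K 1 0).2
    have c01 := (K 0 1).2
    have z0 : n' 0 = c12 / (4 * l') := by
      field_simp
      linarith
    have z1 : n' 1 = -c21 / (4 * l') := by
      field_simp
      linarith
    have hnn : n' = n := by
      ext i; fin_cases i
      · exact z0.trans hn0.symm
      · exact z1.trans hn1.symm
      · exact z2.trans hn2.symm
    subst hnn
    refine ⟨fun C => Moebius.image_eq_of_lift hκ hg hTg' C, ?_⟩
    rw [EventuallyEq, ← hmap', eventually_map]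
    filter_upwards [hgr, hfgraph] with u hu hu'
    rw [← hu, ← hu']

/-! ## Cyclides tangent to a surface -/

lemma HasStandardExpansion.tendsto {f : ℝ × ℝ → ℝ} {Ψ : ℝ} (hf : HasStandardExpansion f Ψ) :
    Tendsto f (𝓝 0) (𝓝 0) := by
  obtain ⟨t₁, t₂, a, b, c, d, h⟩ := hf
  have h1 : Tendsto (fun q : ℝ × ℝ => ‖q‖ ^ 5) (𝓝 0) (𝓝 0) := by
    have : Continuous fun q : ℝ × ℝ => ‖q‖ ^ 5 := by fun_prop
    exact this.tendsto' 0 0 (by simp)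
  have h2 : Continuous fun q : ℝ × ℝ => (q.1 ^ 2 - q.2 ^ 2) / 2
      + (t₁ * q.1 ^ 3 + t₂ * q.2 ^ 3) / 6 + (a * q.1 ^ 4 + 4 * b * q.1 ^ 3 * q.2
        + 6 * Ψ * q.1 ^ 2 * q.2 ^ 2 + 4 * c * q.1 * q.2 ^ 3 + d * q.2 ^ 4) / 24 := by fun_prop
  have h3 := (h.trans_tendsto h1).add (h2.tendsto' 0 0 (by simp))
  rw [add_zero] at h3
  exact h3.congr fun q => by ring

lemma tendsto_graph {f : ℝ × ℝ → ℝ} (hf : Tendsto f (𝓝 0) (𝓝 0)) :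
    Tendsto (fun q : ℝ × ℝ => (!₂[q.1, q.2, f q] : E3)) (𝓝 0) (𝓝 0) := by
  have h1 : Continuous fun v : (ℝ × ℝ) × ℝ => (!₂[v.1.1, v.1.2, v.2] : E3) := by fun_prop
  have h2 : (!₂[(0 : ℝ), 0, 0] : E3) = 0 := by ext i; fin_cases i <;> rfl
  exact (h1.tendsto' ((0 : ℝ × ℝ), (0 : ℝ)) 0 (by simp [h2])).comp (tendsto_id.prodMk_nhds hf)

lemma IsGraphNearOrigin.mem {A : Set E3} {f : ℝ × ℝ → ℝ} (h : IsGraphNearOrigin A f)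
    (hf : Tendsto f (𝓝 0) (𝓝 0)) : ∀ᶠ q : ℝ × ℝ in 𝓝 0, !₂[q.1, q.2, f q] ∈ A := by
  filter_upwards [(tendsto_graph hf).eventually h] with q hq
  exact hq.2 (by simp)

lemma IsGraphNearOrigin.eventuallyEq {A : Set E3} {f f' : ℝ × ℝ → ℝ} (h : IsGraphNearOrigin A f)
    (h' : IsGraphNearOrigin A f') (hf : Tendsto f (𝓝 0) (𝓝 0)) : f =ᶠ[𝓝 0] f' := by
  filter_upwards [h.mem hf, (tendsto_graph hf).eventually h'] with q h1 h2
  simpa using h2.1 h1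

/-- The difference of two standard expansions along a line on which the cubic parts agree. -/
lemma sub_along_line {f f' : ℝ × ℝ → ℝ} {t₁ t₂ a b c d Ψ t₁' t₂' a' b' c' d' Ψ' x y : ℝ}
    (hf : (fun q : ℝ × ℝ => f q - ((q.1 ^ 2 - q.2 ^ 2) / 2 + (t₁ * q.1 ^ 3 + t₂ * q.2 ^ 3) / 6
      + (a * q.1 ^ 4 + 4 * b * q.1 ^ 3 * q.2 + 6 * Ψ * q.1 ^ 2 * q.2 ^ 2
        + 4 * c * q.1 * q.2 ^ 3 + d * q.2 ^ 4) / 24)) =O[𝓝 0] fun q => ‖q‖ ^ 5)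
    (hf' : (fun q : ℝ × ℝ => f' q - ((q.1 ^ 2 - q.2 ^ 2) / 2 + (t₁' * q.1 ^ 3 + t₂' * q.2 ^ 3) / 6
      + (a' * q.1 ^ 4 + 4 * b' * q.1 ^ 3 * q.2 + 6 * Ψ' * q.1 ^ 2 * q.2 ^ 2
        + 4 * c' * q.1 * q.2 ^ 3 + d' * q.2 ^ 4) / 24)) =O[𝓝 0] fun q => ‖q‖ ^ 5)
    (h : (t₁ - t₁') * x ^ 3 + (t₂ - t₂') * y ^ 3 = 0) :
    (fun s : ℝ => f (s * x, s * y) - f' (s * x, s * y)) =O[𝓝 0] (fun s : ℝ => s ^ 4) ∧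
    ((fun s : ℝ => f (s * x, s * y) - f' (s * x, s * y)) =O[𝓝 0] (fun s : ℝ => s ^ 5) ↔
      (a - a') * x ^ 4 + 4 * (b - b') * x ^ 3 * y + 6 * (Ψ - Ψ') * x ^ 2 * y ^ 2
        + 4 * (c - c') * x * y ^ 3 + (d - d') * y ^ 4 = 0) := by
  obtain ⟨δ, hδ⟩ : ∃ δ, δ = (a - a') * x ^ 4 + 4 * (b - b') * x ^ 3 * y
    + 6 * (Ψ - Ψ') * x ^ 2 * y ^ 2 + 4 * (c - c') * x * y ^ 3 + (d - d') * y ^ 4 := ⟨_, rfl⟩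
  rw [← hδ]
  have hline : Tendsto (fun s : ℝ => (s * x, s * y)) (𝓝 0) (𝓝 0) := by
    have : Continuous fun s : ℝ => (s * x, s * y) := by fun_prop
    exact this.tendsto' 0 0 (by simp)
  have hO : (fun s : ℝ => ‖(s * x, s * y)‖ ^ 5) =O[𝓝 0] fun s : ℝ => s ^ 5 := by
    refine IsBigO.pow (IsBigO.of_bound ‖(x, y)‖ (Eventually.of_forall fun s => ?_)) 5
    rw [show (s * x, s * y) = s • (x, y) from rfl, norm_norm, norm_smul, mul_comm]
  have h5 : (fun s : ℝ => f (s * x, s * y) - f' (s * x, s * y) - s ^ 4 * (δ / 24))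
      =O[𝓝 0] fun s : ℝ => s ^ 5 := by
    refine (((hf.sub hf').comp_tendsto hline).trans hO).congr_left fun s => ?_
    simp only [Function.comp_apply, hδ]
    linear_combination -(s ^ 3 / 6) * h
  have h54 : (fun s : ℝ => s ^ 5) =O[𝓝 0] fun s : ℝ => s ^ 4 := by
    have h1 : (fun s : ℝ => s) =O[𝓝 0] fun _ => (1 : ℝ) := (tendsto_id (α := ℝ)).isBigO_one ℝ
    exact ((isBigO_refl (fun s : ℝ => s ^ 4) (𝓝 0)).mul h1).congr (fun s => by ring)
      fun s => by ring
  have hδ4 : (fun s : ℝ => s ^ 4 * (δ / 24)) =O[𝓝 0] fun s : ℝ => s ^ 4 :=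
    ((isBigO_refl (fun s : ℝ => s ^ 4) (𝓝 0)).const_mul_left (δ / 24)).congr_left fun s => by ring
  refine ⟨((h5.trans h54).add hδ4).congr_left fun s => by ring, fun h6 => ?_, fun h6 => ?_⟩
  · have h7 : (fun s : ℝ => s ^ 4 * (δ / 24)) =O[𝓝 0] fun s : ℝ => s ^ 5 :=
      (h6.sub h5).congr_left fun s => by ring
    have h8 : (fun s : ℝ => s ^ 4 * (δ / 24)) =o[𝓝 0] fun s : ℝ => s ^ 4 := by
      refine h7.trans_isLittleO ?_
      have h3 : (fun s : ℝ => s) =o[𝓝 0] fun _ => (1 : ℝ) := (isLittleO_one_iff ℝ).2 tendsto_id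
      exact ((isBigO_refl (fun s : ℝ => s ^ 4) (𝓝 0)).mul_isLittleO h3).congr (fun s => by ring)
        fun s => by ring
    have h9 := (h8.mono (nhdsWithin_le_nhds (s := {0}ᶜ))).tendsto_div_nhds_zero
    have h10 : Tendsto (fun s : ℝ => s ^ 4 * (δ / 24) / s ^ 4) (𝓝[≠] 0) (𝓝 (δ / 24)) := by
      refine tendsto_const_nhds.congr' ?_
      filter_upwards [self_mem_nhdsWithin] with s hs
      rw [mul_div_cancel_left₀ _ (pow_ne_zero 4 hs)]
    linarith [tendsto_nhds_unique h9 h10]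
  · exact h5.congr_left fun s => by rw [h6]; ring

lemma IsDupinAngle.cubic_eq_zero {θ₁ θ₂ α : ℝ} (h : IsDupinAngle θ₁ θ₂ α) :
    θ₁ * Real.cos α ^ 3 + θ₂ * Real.sin α ^ 3 = 0 := by
  rcases h with ⟨h2, hc, ht⟩ | ⟨h2, hc⟩
  · rw [Real.tan_eq_sin_div_cos] at ht
    field_simp at ht
    linarith
  · rw [h2, hc]; ring

lemma continuous_lift : Continuous lift := by
  have : Continuous fun x : E3 => ((1 : ℝ), x, ‖x‖ ^ 2) := by fun_prop
  exact this

/-- Near the image of a finite point, the image of a quadric is the quadric of the conjugate. -/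
lemma eventually_mem_image_cyc {κ : ℝ} {T : LV ≃ₗ[ℝ] LV} (hT : IsConformal κ (T : LV →ₗ[ℝ] LV))
    {g : Moebius} (hg : IsLiftOf (T : LV →ₗ[ℝ] LV) g) {x : E3} (hx : x ∈ g.domain)
    (hx0 : g.toFun x = 0) (M : LV →ₗ[ℝ] LV) :
    ∀ᶠ y in 𝓝 0, y ∈ g.image (cyc M) ↔ y ∈ cyc (T.conj M) := by
  have hc : Continuous fun y : E3 => (T.symm (lift y)).1 :=
    continuous_fst.comp ((T.symm : LV →ₗ[ℝ] LV).continuous_of_finiteDimensional.comp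
      continuous_lift)
  have h0 : (T.symm (lift 0)).1 ≠ 0 := by
    obtain ⟨d, hd, h⟩ := hg.1 x hx
    rw [hx0, LinearEquiv.coe_coe, ← T.eq_symm_apply, map_smul] at h
    intro h1
    have := congrArg Prod.fst h
    rw [Prod.smul_fst, h1] at this
    simp [lift] at this
  filter_upwards [hc.continuousAt.eventually_ne h0] with y hy
  exact mem_image_cyc hT hg M hy

lemma IsGraphNearOrigin.congr {A B : Set E3} {f : ℝ × ℝ → ℝ} (h : IsGraphNearOrigin A f)
    (hAB : ∀ᶠ y in 𝓝 0, y ∈ B ↔ y ∈ A) : IsGraphNearOrigin B f := by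
  filter_upwards [h, hAB] with y h1 h2
  exact h2.trans h1

/-! ### The one-parameter family and the osculating cyclide -/

theorem theorem1 (U : Set (ℝ × ℝ)) (φ : ℝ × ℝ → E3) (hS : IsImmersedSurface U φ)
    (p : ℝ × ℝ) (hp : p ∈ U) (humb : ¬ IsUmbilic φ p)
    (w₁ w₂ : ℝ × ℝ) (hw : IsPrincipalFrame φ p w₁ w₂)
    (hDupin : ¬ (theta₁ φ p w₁ = 0 ∧ theta₂ φ p w₂ = 0))
    (α : ℝ) (hα : IsDupinAngle (theta₁ φ p w₁) (theta₂ φ p w₂) α) :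
    (∃ 𝒞 : ℝ → Set E3,
      (∀ Ψ : ℝ, IsDupinCyclide (𝒞 Ψ) ∧ HasInvariantPsi (𝒞 Ψ) (φ p) (unitNormal φ p) Ψ ∧
        TangentOfOrder 3 φ p w₁ w₂ α (𝒞 Ψ)) ∧
      (∀ C : Set E3, IsDupinCyclide C → TangentOfOrder 3 φ p w₁ w₂ α C → ∃! Ψ : ℝ, C = 𝒞 Ψ)) ∧
    (theta₁ φ p w₁ ≠ 0 → theta₂ φ p w₂ ≠ 0 →
      ∃! C : Set E3, IsDupinCyclide C ∧ TangentOfOrder 4 φ p w₁ w₂ α C) := by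
  obtain ⟨κ, T, g, fS, a, b, c, d, ΨS, hT, hg, hpos, hexp, huniq⟩ :=
    exists_standard_position hS hp humb hw
  obtain ⟨hgd, hg0, ⟨l, hl, hd1, hd2, hd3⟩, hgraphS, hstdS⟩ := id hpos
  have hTs : IsConformal κ⁻¹ (T.symm : LV →ₗ[ℝ] LV) := hT.symm
  have himage := eventually_mem_image_cyc hT hg hgd hg0
  have hconj : ∀ M, T.conj (T.symm.conj M) = M := fun M =>
    LinearMap.ext fun v => by simp [LinearEquiv.conj_apply]
  have hconj' : ∀ M, T.symm.conj (T.conj M) = M := fun M =>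
    LinearMap.ext fun v => by simp [LinearEquiv.conj_apply]
  -- The standard cyclides pulled back to `p`; the parameter is `-Ψ / 2` because `stdOp E` has
  -- invariant `-2E`.
  obtain ⟨𝒞, h𝒞⟩ : ∃ 𝒞 : ℝ → Set E3, ∀ Ψ, 𝒞 Ψ = cyc (T.symm.conj (stdOp (-Ψ / 2))) :=
    ⟨_, fun _ => rfl⟩
  have hcyc : ∀ Ψ, IsDupinCyclide (𝒞 Ψ) := fun Ψ => by
    rw [h𝒞]; exact stdOp_cyclide _ _ _ hTs
  -- the members of the family as graphs
  have hfam : ∀ Ψ, ∃ f : ℝ × ℝ → ℝ, ((fun q : ℝ × ℝ => f q - ((q.1 ^ 2 - q.2 ^ 2) / 2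
      + (0 * q.1 ^ 3 + 0 * q.2 ^ 3) / 6 + (3 * q.1 ^ 4 + 4 * 0 * q.1 ^ 3 * q.2
        + 6 * Ψ * q.1 ^ 2 * q.2 ^ 2 + 4 * 0 * q.1 * q.2 ^ 3 + -3 * q.2 ^ 4) / 24))
      =O[𝓝 0] fun q => ‖q‖ ^ 5) ∧ IsGraphNearOrigin (g.image (𝒞 Ψ)) f := by
    intro Ψ
    obtain ⟨f, hf, hfg⟩ := exists_graph_stdOp (-Ψ / 2)
    refine ⟨f, by rwa [show -2 * (-Ψ / 2) = Ψ by ring] at hf, ?_⟩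
    refine hfg.congr ?_
    have := himage (T.symm.conj (stdOp (-Ψ / 2)))
    rwa [hconj, ← h𝒞] at this
  choose F hF hFg using hfam
  have hFstd : ∀ Ψ, HasStandardExpansion (F Ψ) Ψ := fun Ψ => ⟨0, 0, 3, 0, 0, -3, hF Ψ⟩
  -- Local information becomes global here: the germ at the origin determines the operator up to an
  -- affine change, hence the whole set `C`.
  have hclass : ∀ C, IsDupinCyclide C → ∀ f Ψ, IsGraphNearOrigin (g.image C) f →
      HasStandardExpansion f Ψ → C = 𝒞 Ψ := by
    intro C hC f Ψ hf hΨ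
    obtain ⟨M, hM, rfl⟩ := hC.exists_op
    have h1 : IsGraphNearOrigin (cyc (T.conj M)) f :=
      hf.congr ((himage M).mono fun y hy => hy.symm)
    obtain ⟨a, b, ha, hab⟩ := (hM.conj hT).exists_eq_stdOp hΨ
      ((h1.mem hΨ.tendsto).mono fun q hq => hq.1)
    have h2 : M = a • T.symm.conj (stdOp (-Ψ / 2)) + b • LinearMap.id := by
      rw [← hconj' M, hab, map_add, map_smul, map_smul, LinearEquiv.conj_id]
    rw [h𝒞, h2, cyc_smul_add ha]
  have hline : ∀ x y : ℝ, Tendsto (fun s : ℝ => (s * x, s * y)) (𝓝 0) (𝓝 0) := fun x y => by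
    have : Continuous fun s : ℝ => (s * x, s * y) := by fun_prop
    exact this.tendsto' 0 0 (by simp)
  have hinj : ∀ Ψ Ψ', 𝒞 Ψ = 𝒞 Ψ' → Ψ = Ψ' := by
    intro Ψ Ψ' h
    have h1 : F Ψ =ᶠ[𝓝 0] F Ψ' := (hFg Ψ).eventuallyEq (h ▸ hFg Ψ') (hFstd Ψ).tendsto
    -- On the diagonal the quartic difference is `6 (Ψ - Ψ')`, so equal germs have equal invariants.
    have h2 := (sub_along_line (x := 1) (y := 1) (hF Ψ) (hF Ψ') (by ring)).2.1
      ((isBigO_zero (E' := ℝ) _ _).congr' (((hline 1 1).eventually h1).mono fun s hs => by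
        simp only [hs, sub_self]) EventuallyEq.rfl)
    linarith
  have hcubic : (theta₁ φ p w₁ - 0) * Real.cos α ^ 3
      + (theta₂ φ p w₂ - 0) * Real.sin α ^ 3 = 0 := by
    rw [sub_zero, sub_zero, hα.cubic_eq_zero]
  have hcontact := fun Ψ => sub_along_line hexp (hF Ψ) hcubic
  refine ⟨⟨𝒞, fun Ψ => ⟨hcyc Ψ, ?_, ?_⟩, ?_⟩, fun h1 h2 => ?_⟩
  · exact ⟨g, F Ψ, hgd, hg0, ⟨l, hl, hd3⟩, hFg Ψ, hFstd Ψ⟩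
  · exact ⟨g, fS, F Ψ, hpos, hFg Ψ, ⟨Ψ, hFstd Ψ⟩, (hcontact Ψ).1⟩
  · rintro C hC ⟨g', fS', fC, hS', hCg, ⟨Ψ, hΨ⟩, -⟩
    rw [(huniq g' fS' hS').1] at hCg
    have h := hclass C hC fC Ψ hCg hΨ
    exact ⟨Ψ, h, fun Ψ' h' => hinj _ _ (h'.symm.trans h)⟩
  · have hcos : Real.cos α ≠ 0 := by
      rcases hα with ⟨-, hc, -⟩ | ⟨h3, -⟩
      · exact hc
      · exact (h2 h3).elim
    have hsin : Real.sin α ≠ 0 := by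
      intro h3
      have := hα.cubic_eq_zero
      rw [h3] at this
      simp [h1, hcos] at this
    have h6 : 6 * Real.cos α ^ 2 * Real.sin α ^ 2 ≠ 0 := by positivity
    -- Vanishing of the quartic term is an affine equation in `Ψ`, with slope `-6 cos² α sin² α ≠
    -- 0`.
    obtain ⟨Ψ₀, hΨ₀⟩ : ∃ Ψ₀ : ℝ, ∀ Ψ, (a - 3) * Real.cos α ^ 4
        + 4 * (b - 0) * Real.cos α ^ 3 * Real.sin α
        + 6 * (ΨS - Ψ) * Real.cos α ^ 2 * Real.sin α ^ 2
        + 4 * (c - 0) * Real.cos α * Real.sin α ^ 3 + (d - -3) * Real.sin α ^ 4 = 0 ↔ Ψ = Ψ₀ := by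
      refine ⟨((a - 3) * Real.cos α ^ 4 + 4 * b * Real.cos α ^ 3 * Real.sin α
        + 6 * ΨS * Real.cos α ^ 2 * Real.sin α ^ 2 + 4 * c * Real.cos α * Real.sin α ^ 3
        + (d + 3) * Real.sin α ^ 4) / (6 * Real.cos α ^ 2 * Real.sin α ^ 2), fun Ψ => ?_⟩
      rw [eq_div_iff h6]
      constructor <;> intro h <;> linear_combination -h
    refine ⟨𝒞 Ψ₀, ⟨hcyc Ψ₀, g, fS, F Ψ₀, hpos, hFg Ψ₀, ⟨Ψ₀, hFstd Ψ₀⟩,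
      (hcontact Ψ₀).2.2 ((hΨ₀ Ψ₀).2 rfl)⟩, ?_⟩
    rintro C ⟨hC, g', fS', fC, hS', hCg, ⟨Ψ, hΨ⟩, htan⟩
    obtain ⟨himg, hfS⟩ := huniq g' fS' hS'
    rw [himg] at hCg
    have h := hclass C hC fC Ψ hCg hΨ
    -- The given graph functions have the germs of `fS` and `F Ψ`, so the contact condition becomes
    -- the affine equation above.
    have hfC : fC =ᶠ[𝓝 0] F Ψ := hCg.eventuallyEq (h ▸ hFg Ψ) hΨ.tendsto
    have h3 := (hcontact Ψ).2.1 (htan.congr'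
      (((hline (Real.cos α) (Real.sin α)).eventually (hfS.and hfC)).mono
      fun s hs => by simp only [hs.1, hs.2]) EventuallyEq.rfl)
    rw [h, (hΨ₀ Ψ).1 h3]

end
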